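/- Let $0<q<1$ and let $M$ be the field of meromorphic functions on $\mathbb C$. Let $F(\lambda)=\frac{q^{2(\lambda+1)}-q^{-2}}{q^{2(\lambda+1)}-1}$, $G(\lambda)=\frac{(q^{2(\lambda+1)}-q^{2})(q^{2(\lambda+1)}-q^{-2})}{(q^{2(\lambda+1)}-1)^2}$, $H(\lambda,\mu)=\frac{(q-q^{-1})(q^{2(\lambda+\mu+2)}-1)}{(q^{2(\lambda+1)}-1)(q^{2(\mu+1)}-1)}$, $I(\lambda,\mu)=\frac{(q-q^{-1})(q^{2(\mu+1)}-q^{2(\lambda+1)})}{(q^{2(\lambda+1)}-1)(q^{2(\mu+1)}-1)}$. Let $\mathcal F=\mathcal F_R(\mathrm{SL}(2))$ be the complex algebra generated by $\alpha,\beta,\gamma,\delta$ and two mutually commuting copies $\mu_l(f)=f(\lambda)$, $\mu_r(f)=f(\mu)$ $(f\in M)$ of $M$, with relations $f(\lambda)\alpha=\alpha f(\lambda+1)$, $f(\mu)\alpha=\alpha f(\mu+1)$, $f(\lambda)\beta=\beta f(\lambda+1)$, $f(\mu)\beta=\beta f(\mu-1)$, $f(\lambda)\gamma=\gamma f(\lambda-1)$,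 $f(\mu)\gamma=\gamma f(\mu+1)$, $f(\lambda)\delta=\delta f(\lambda-1)$, $f(\mu)\delta=\delta f(\mu-1)$, $\alpha\beta=qF(\mu-1)\beta\alpha$, $\alpha\gamma=qF(\lambda)\gamma\alpha$, $\beta\delta=qF(\lambda)\delta\beta$, $\gamma\delta=qF(\mu-1)\delta\gamma$, $\alpha\delta-\delta\alpha=H(\lambda,\mu)\gamma\beta$, $G(\mu)\alpha\delta-G(\lambda)\delta\alpha=H(\lambda,\mu)\beta\gamma$, $\beta\gamma-G(\mu)\gamma\beta=I(\lambda,\mu)\delta\alpha$, $\beta\gamma-G(\lambda)\gamma\beta=I(\lambda,\mu)\alpha\delta$, and $\alpha\delta-qF(\lambda)\gamma\beta=1$. It is bigraded by $\alpha\in\mathcal F_{1,1}$, $\beta\in\mathcal F_{1,-1}$, $\gamma\in\mathcal F_{-1,1}$, $\delta\in\mathcal F_{-1,-1}$, $f(\lambda),f(\mu)\in\mathcal F_{0,0}$. An $\mathfrak h$-space is an $M$-vector space $V=\bigoplus_{n\in\mathbb C}V_n$ graded by $M$-subspaces, and $\mathcal F\widetilde\otimes V=\bigoplus_{m,n}\mathcal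 F_{mn}\otimes_M V_n$, the tensor product being taken modulo $f(\mu)a\otimes v=a\otimes fv$, with $f(a\otimes v)=f(\lambda)a\otimes v$ and $\mathcal F_{mn}\otimes_M V_n$ in degree $m$. The coproduct $\Delta:\mathcal F\to\mathcal F\widetilde\otimes\mathcal F$ is the algebra homomorphism with $\Delta(\alpha)=\alpha\otimes\alpha+\beta\otimes\gamma$, $\Delta(\beta)=\alpha\otimes\beta+\beta\otimes\delta$, $\Delta(\gamma)=\gamma\otimes\alpha+\delta\otimes\gamma$, $\Delta(\delta)=\gamma\otimes\beta+\delta\otimes\delta$, $\Delta(f(\lambda))=f(\lambda)\otimes1$, $\Delta(f(\mu))=1\otimes f(\mu)$ (here $\mathcal F$ is an $\mathfrak h$-space by $fa=f(\lambda)a$ and $\mathcal F_m=\bigoplus_n\mathcal F_{mn}$), and the counit $\varepsilon$ is the homomorphism to difference operators on $M$ with $\varepsilon(\alpha)=T_{-1}$, $\varepsilon(\beta)=\varepsilon(\gamma)=0$, $\varepsilon(\delta)=T_1$, $\varepsilon(f(\lambda))=\varepsilon(f(\mu))=f$, where $(T_af)(\lambda)=f(\lambda+a)$. A corepresentation is a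 grade-preserving $M$-linear map $\pi:V\to\mathcal F\widetilde\otimes V$ with $(\Delta\otimes\mathrm{id})\pi=(\mathrm{id}\otimes\pi)\pi$ and $(\varepsilon\otimes\mathrm{id})\pi=\mathrm{id}$; isomorphisms of corepresentations are the grade-preserving $M$-linear bijections commuting with the coactions. For $N\ge0$ let $V_N\subseteq\mathcal F$ be the $\mu_l(M)$-span of $\gamma^{N-k}\alpha^k$, $0\le k\le N$. **Proposition (Peter–Weyl).** $\Delta$ is a corepresentation of $\mathcal F$ on itself (the regular corepresentation), and it restricts to a corepresentation on each $V_N$. There are unique matrix elements $t^N_{kj}\in\mathcal F$ $(N\ge0$, $0\le k,j\le N)$ with $\Delta(\gamma^{N-k}\alpha^k)=\sum_{j=0}^N t^N_{kj}\otimes\gamma^{N-j}\alpha^j$ in $\mathcal F\widetilde\otimes V_N$. Moreover: 1. the map $M\otimes_{\mathbb C}M\to\mathcal F$, $f\otimes g\mapsto f(\lambda)g(\mu)$, is injective, so its image $\mu_l(M)\mu_r(M)$ is isomorphic to $M\otimes_{\mathbb C} M$, and the elements $t^N_{kj}$ $(N\ge 0$, $0\le k,j\le N)$ form a basis of $\mathcal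 F$ as a left module over $\mu_l(M)\mu_r(M)$; 2. the regular corepresentation is isomorphic to $\bigoplus_{N\ge0}V_N\otimes_{\mathbb C}M^{N+1}$ (coaction and $M$-structure on the factor $V_N$), through $\gamma^{N-k}\alpha^k\otimes(g_0,\dots,g_N)\mapsto\sum_{j}g_j(\mu)t^N_{kj}$; the multiplicity spaces $M^{N+1}$ are infinite-dimensional over $\mathbb C$; 3. each $V_N$ is irreducible: $V_N\ne0$, and if $U\subseteq V_N$ is an $\mathfrak h$-subspace with $\Delta(U)\subseteq\mathcal F\widetilde\otimes U$, then $U=0$ or $U=V_N$. -/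

import Mathlib

open scoped TensorProduct

namespace DynSL2

noncomputable section

/-! ### The field of meromorphic functions on the complex plane -/

/-- Everywhere defined representatives of meromorphic functions on `ℂ` (arbitrary values at the
poles). -/
def merFun : Subalgebra ℂ (ℂ → ℂ) where
  carrier := {f | Meromorphic f}
  mul_mem' hf hg := Meromorphic.mul hf hg
  add_mem' hf hg := Meromorphic.add hf hg
  algebraMap_mem' c := Meromorphic.const c

/-- Representatives of the zero function: those that vanish off a closed discrete set. -/
def merNull : Ideal merFun where
  carrier := {f | (f : ℂ → ℂ) =ᶠ[Filter.codiscrete ℂ] 0}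
  zero_mem' := by simp [Filter.EventuallyEq]
  add_mem' := by
    intro f g hf hg
    have h := Filter.EventuallyEq.add (Set.mem_ofPred_eq ▸ hf) (Set.mem_ofPred_eq ▸ hg)
    simpa using h
  smul_mem' := by
    intro c f hf
    have h := (Filter.EventuallyEq.refl (Filter.codiscrete ℂ) (c : ℂ → ℂ)).mul
      (Set.mem_ofPred_eq ▸ hf)
    simpa using h

/-- The field `M` of meromorphic functions on `ℂ`. -/
def Mer : Type := merFun ⧸ merNull

instance merNull_isMaximal : merNull.IsMaximal := by
  rw [Ideal.isMaximal_iff]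
  constructor
  · intro h
    have h1 : ∀ᶠ x in Filter.codiscrete ℂ, (1 : ℂ) = 0 := h
    have h2 : (∅ : Set ℂ) ∈ Filter.codiscrete ℂ := by
      filter_upwards [h1] with x hx
      exact absurd hx one_ne_zero
    rw [mem_codiscrete] at h2
    have h3 := h2 0
    simp only [Set.compl_empty, Filter.principal_univ, disjoint_top] at h3
    exact (NormedField.nhdsNE_neBot (0 : ℂ)).ne h3
  · intro J f hJ hf hfJ
    have hm : Meromorphic (f : ℂ → ℂ) := f.2
    have hinv : Meromorphic ((f : ℂ → ℂ)⁻¹) := hm.inv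
    have hne : ∀ᶠ x in Filter.codiscrete ℂ, (f : ℂ → ℂ) x ≠ 0 := by
      apply MeromorphicAt.MeromorphicOn.codiscreteWithin_setOfPred_ne_zero (hm.meromorphicOn)
      by_contra hcon
      push Not at hcon
      obtain ⟨u, -, hu⟩ := hcon
      apply hf
      have hall : ∀ x : ℂ, meromorphicOrderAt (f : ℂ → ℂ) x = ⊤ := by
        by_contra hx
        push Not at hx
        obtain ⟨x, hx⟩ := hx
        exact (hm.meromorphicOn (s := Set.univ)).meromorphicOrderAt_ne_top_of_isPreconnected
          isPreconnected_univ (Set.mem_univ x) (Set.mem_univ u) hx hu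
      change {x | (f : ℂ → ℂ) x = 0} ∈ Filter.codiscrete ℂ
      rw [mem_codiscrete]
      intro x
      rw [Filter.disjoint_principal_right, compl_compl]
      exact meromorphicOrderAt_eq_top_iff.1 (hall x)
    have hmul : f * ⟨_, hinv⟩ - 1 ∈ merNull := by
      change ∀ᶠ x in Filter.codiscrete ℂ, (f : ℂ → ℂ) x * ((f : ℂ → ℂ) x)⁻¹ - 1 = 0
      filter_upwards [hne] with x hx
      rw [mul_inv_cancel₀ hx, sub_self]
    have h1 : f * ⟨_, hinv⟩ ∈ J := J.mul_mem_right _ hfJ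
    have := J.sub_mem h1 (hJ hmul)
    simpa using this

instance : CommRing Mer := inferInstanceAs (CommRing (merFun ⧸ merNull))

theorem Mer.isField : IsField Mer :=
  (Ideal.Quotient.maximal_ideal_iff_isField_quotient merNull).1 inferInstance

open Classical in
instance : Field Mer where
  inv a := if h : a = 0 then 0 else Classical.choose (Mer.isField.mul_inv_cancel h)
  exists_pair_ne := Mer.isField.exists_pair_ne
  mul_inv_cancel a h := by
    rw [dif_neg h]
    exact Classical.choose_spec (Mer.isField.mul_inv_cancel h)
  inv_zero := dif_pos rfl
  nnqsmul := _
  nnqsmul_def := fun _ _ => rfl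
  qsmul := _
  qsmul_def := fun _ _ => rfl

instance : Algebra ℂ Mer := inferInstanceAs (Algebra ℂ (merFun ⧸ merNull))

/-- The class of a meromorphic function. -/
def Mer.of (f : ℂ → ℂ) (hf : Meromorphic f) : Mer := Ideal.Quotient.mk merNull ⟨f, hf⟩

/-- Translation `f ↦ f(· + z)` on representatives. -/
def shiftFun (z : ℂ) : merFun →ₐ[ℂ] merFun where
  toFun f := ⟨fun x => (f : ℂ → ℂ) (x + z),
    Meromorphic.meromorphic_fun_comp_add_const_iff_meromorphic.2 f.2⟩
  map_one' := rfl
  map_mul' _ _ := rfl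
  map_zero' := rfl
  map_add' _ _ := rfl
  commutes' _ := rfl

theorem shiftFun_mem (z : ℂ) : merNull ≤ merNull.comap (shiftFun z) := by
  intro f hf
  have h : {x | (f : ℂ → ℂ) x = 0} ∈ Filter.codiscrete ℂ := hf
  change {x | (f : ℂ → ℂ) (x + z) = 0} ∈ Filter.codiscrete ℂ
  rw [mem_codiscrete] at h ⊢
  intro x
  have hx := h (x + z)
  rw [Filter.disjoint_principal_right, compl_compl] at hx ⊢
  have ht : Filter.Tendsto (fun y : ℂ => y + z) (nhdsWithin x {x}ᶜ)
      (nhdsWithin (x + z) {x + z}ᶜ) := by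
    apply tendsto_nhdsWithin_of_tendsto_nhds_of_eventually_within
    · exact ((continuous_id.add continuous_const).tendsto x).mono_left nhdsWithin_le_nhds
    · filter_upwards [self_mem_nhdsWithin] with y hy
      simpa using hy
  exact ht hx

/-- The automorphism `T_z` of the field of meromorphic functions, `(T_z f)(x) = f(x + z)`. -/
def shift (z : ℂ) : Mer →ₐ[ℂ] Mer := Ideal.quotientMapₐ merNull (shiftFun z) (shiftFun_mem z)

theorem shift_of (z : ℂ) (f : ℂ → ℂ) (hf : Meromorphic f) :
    shift z (Mer.of f hf) = Mer.of (fun x => f (x + z))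
      (Meromorphic.meromorphic_fun_comp_add_const_iff_meromorphic.2 hf) := rfl

theorem shift_shift (z w : ℂ) (f : Mer) : shift z (shift w f) = shift (z + w) f := by
  obtain ⟨⟨f, hf⟩, rfl⟩ := Ideal.Quotient.mk_surjective f
  change Mer.of _ _ = Mer.of _ _
  congr 1
  funext x
  change f (x + z + w) = f (x + (z + w))
  rw [add_assoc]

theorem shift_zero (f : Mer) : shift 0 f = f := by
  obtain ⟨⟨f, hf⟩, rfl⟩ := Ideal.Quotient.mk_surjective f
  change Mer.of _ _ = Mer.of _ _
  congr 1
  funext x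
  change f (x + 0) = f x
  rw [add_zero]

/-! ### The auxiliary functions -/

/-- The entire function `q^{2(x+1)}`. -/
def qx (q : Set.Ioo (0 : ℝ) 1) (x : ℂ) : ℂ := ((q : ℝ) : ℂ) ^ (2 * (x + 1))

theorem q_ne_zero (q : Set.Ioo (0 : ℝ) 1) : ((q : ℝ) : ℂ) ≠ 0 := by
  exact_mod_cast q.2.1.ne'

@[fun_prop]
theorem qx_meromorphic (q : Set.Ioo (0 : ℝ) 1) : Meromorphic (qx q) := by
  have h : Differentiable ℂ (qx q) := by
    intro x
    exact DifferentiableAt.const_cpow (by fun_prop) (Or.inl (q_ne_zero q))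
  intro x
  exact (h.analyticAt x).meromorphicAt

/-- `q` as a complex number. -/
abbrev qc (q : Set.Ioo (0 : ℝ) 1) : ℂ := ((q : ℝ) : ℂ)

/-- `F(x) = (q^{2(x+1)} - q^{-2}) / (q^{2(x+1)} - 1)`. -/
def fF (q : Set.Ioo (0 : ℝ) 1) : Mer :=
  Mer.of (fun x => (qx q x - qc q ^ (-2 : ℤ)) / (qx q x - 1)) (by fun_prop)

/-- `G(x) = (q^{2(x+1)} - q^2) (q^{2(x+1)} - q^{-2}) / (q^{2(x+1)} - 1)^2`. -/
def fG (q : Set.Ioo (0 : ℝ) 1) : Mer :=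
  Mer.of (fun x => (qx q x - qc q ^ 2) * (qx q x - qc q ^ (-2 : ℤ)) / (qx q x - 1) ^ 2)
    (by fun_prop)

/-- `q^{2(x+1)} / (q^{2(x+1)} - 1)`. -/
def fU (q : Set.Ioo (0 : ℝ) 1) : Mer := Mer.of (fun x => qx q x / (qx q x - 1)) (by fun_prop)

/-- `1 / (q^{2(x+1)} - 1)`. -/
def fW (q : Set.Ioo (0 : ℝ) 1) : Mer := Mer.of (fun x => 1 / (qx q x - 1)) (by fun_prop)

/-- The set where the denominators are nonzero is codiscrete. -/
theorem qx_sub_ne (q : Set.Ioo (0 : ℝ) 1) (z : ℂ) :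
    ∀ᶠ x in Filter.codiscrete ℂ, qx q (x + z) - 1 ≠ 0 := by
  have hm : Meromorphic (fun x => qx q (x + z) - 1) :=
    (Meromorphic.meromorphic_fun_comp_add_const_iff_meromorphic.2 (qx_meromorphic q)).fun_sub (.const 1)
  apply MeromorphicAt.MeromorphicOn.codiscreteWithin_setOfPred_ne_zero hm.meromorphicOn
  have h0 : meromorphicOrderAt (fun x => qx q (x + z) - 1) (-z) ≠ ⊤ := by
    have hd : DifferentiableOn ℂ (fun x => qx q (x + z) - 1) Set.univ := by
      intro x _
      apply DifferentiableAt.differentiableWithinAt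
      exact (DifferentiableAt.const_cpow (by fun_prop) (Or.inl (q_ne_zero q))).sub_const 1
    have ha := (hd.analyticAt (z := -z) Filter.univ_mem)
    rw [meromorphicOrderAt_ne_top_iff_eventually_ne_zero ha.meromorphicAt]
    apply Filter.Eventually.filter_mono nhdsWithin_le_nhds
    apply ha.continuousAt.eventually_ne
    have : qx q (-z + z) = ((q : ℝ) : ℂ) ^ 2 := by
      rw [qx, neg_add_cancel, zero_add, mul_one]
      exact Complex.cpow_ofNat _ 2
    rw [this]
    have hq1 : (q : ℝ) ^ 2 - 1 ≠ 0 := by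
      have h1 := q.2.1
      have h2 := q.2.2
      nlinarith
    exact_mod_cast hq1
  intro u _
  exact (hm.meromorphicOn (s := Set.univ)).meromorphicOrderAt_ne_top_of_isPreconnected
    isPreconnected_univ (Set.mem_univ (-z)) (Set.mem_univ u) h0

/-- Equality of classes can be checked off a closed discrete set. -/
theorem Mer.of_eq {f g : ℂ → ℂ} (hf : Meromorphic f) (hg : Meromorphic g)
    (h : ∀ᶠ x in Filter.codiscrete ℂ, f x = g x) : Mer.of f hf = Mer.of g hg := by
  apply Ideal.Quotient.eq.2
  change ∀ᶠ x in Filter.codiscrete ℂ, f x - g x = 0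
  filter_upwards [h] with x hx
  rw [hx, sub_self]

/-- `K(x) = q⁻¹ / F(x - 1)`, written without division. -/
def fK (q : Set.Ioo (0 : ℝ) 1) : Mer :=
  Mer.of (fun x => (qc q)⁻¹ * (1 + (1 - qc q ^ 2) * (1 / (qx q x - 1)))) (by fun_prop)

theorem fU_eq (q : Set.Ioo (0 : ℝ) 1) : fU q = 1 + fW q := by
  refine Mer.of_eq (g := fun x => 1 + 1 / (qx q x - 1)) _ (by fun_prop) ?_
  filter_upwards [qx_sub_ne q 0] with x hx
  rw [add_zero] at hx
  field_simp
  ring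

theorem fF_eq (q : Set.Ioo (0 : ℝ) 1) :
    fF q = 1 + (1 - (qc q)⁻¹ ^ 2) • fW q := by
  refine Mer.of_eq (g := fun x => 1 + (1 - (qc q)⁻¹ ^ 2) * (1 / (qx q x - 1))) _ (by fun_prop) ?_
  filter_upwards [qx_sub_ne q 0] with x hx
  rw [add_zero] at hx
  have := q_ne_zero q
  simp only [zpow_neg, zpow_ofNat]
  field_simp
  ring

theorem fK_eq (q : Set.Ioo (0 : ℝ) 1) :
    fK q = (qc q)⁻¹ • (1 + (1 - qc q ^ 2) • fW q) := rfl

theorem fG_eq (q : Set.Ioo (0 : ℝ) 1) : fG q = (qc q • fF q) * fK q := by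
  refine Mer.of_eq (g := fun x => (qc q * ((qx q x - qc q ^ (-2 : ℤ)) / (qx q x - 1))) *
    ((qc q)⁻¹ * (1 + (1 - qc q ^ 2) * (1 / (qx q x - 1))))) _ (by fun_prop) ?_
  filter_upwards [qx_sub_ne q 0] with x hx
  rw [add_zero] at hx
  have := q_ne_zero q
  field_simp
  ring

theorem fF_shift_mul_fK (q : Set.Ioo (0 : ℝ) 1) :
    (qc q • shift (-1) (fF q)) * fK q = 1 := by
  refine Mer.of_eq (f := fun x => (qc q * ((qx q (x + -1) - qc q ^ (-2 : ℤ)) /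
    (qx q (x + -1) - 1))) * ((qc q)⁻¹ * (1 + (1 - qc q ^ 2) * (1 / (qx q x - 1)))))
    (g := fun _ => 1) (((Meromorphic.const _).fun_mul
      (Meromorphic.meromorphic_fun_comp_add_const_iff_meromorphic.2
      (show Meromorphic (fun y => (qx q y - qc q ^ (-2 : ℤ)) / (qx q y - 1)) by
        fun_prop))).fun_mul (by fun_prop)) (by fun_prop) ?_
  filter_upwards [qx_sub_ne q 0, qx_sub_ne q (-1)] with x hx hx1
  rw [add_zero] at hx
  have h0 := q_ne_zero q
  have h2 : qx q x = qc q ^ 2 * qx q (x + -1) := by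
    rw [qx, qx, show 2 * (x + 1) = (2 : ℂ) + 2 * (x + -1 + 1) by ring, Complex.cpow_add _ _ h0]
    congr 1
    exact Complex.cpow_ofNat _ 2
  rw [h2] at hx ⊢
  simp only [zpow_neg, zpow_ofNat]
  field_simp
  ring

/-! ### The algebra `F_R(SL(2))` -/

/-- Generators: two copies `f(λ)`, `f(μ)` of `M`, and `α, β, γ, δ`. -/
inductive Gen : Type
  | l (f : Mer)
  | r (f : Mer)
  | α
  | β
  | γ
  | δ

/-- The free algebra on the generators. -/
abbrev Free : Type := FreeAlgebra ℂ Gen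

/-- A generator as an element of the free algebra. -/
abbrev gen (x : Gen) : Free := FreeAlgebra.ι ℂ x

open Gen in
/-- `H(λ,μ) = (q - q⁻¹)(q^{2(λ+μ+2)} - 1) / ((q^{2(λ+1)} - 1)(q^{2(μ+1)} - 1))`, as an element of
the free algebra; note `q^{2(λ+μ+2)} = q^{2(λ+1)} q^{2(μ+1)}`. -/
def freeH (q : Set.Ioo (0 : ℝ) 1) : Free :=
  (qc q - (qc q)⁻¹) • (gen (l (fU q)) * gen (r (fU q)) - gen (l (fW q)) * gen (r (fW q)))

open Gen in
/-- `I(λ,μ) = (q - q⁻¹)(q^{2(μ+1)} - q^{2(λ+1)}) / ((q^{2(λ+1)} - 1)(q^{2(μ+1)} - 1))`, as an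
element of the free algebra. -/
def freeI (q : Set.Ioo (0 : ℝ) 1) : Free :=
  (qc q - (qc q)⁻¹) • (gen (l (fW q)) * gen (r (fU q)) - gen (l (fU q)) * gen (r (fW q)))

open Gen in
/-- The defining relations of `F_R(SL(2))`. -/
inductive Rel (q : Set.Ioo (0 : ℝ) 1) : Free → Free → Prop
  -- the two copies of `M` are unital `ℂ`-subalgebras, commuting with each other
  | l_scalar (z : ℂ) : Rel q (gen (l (algebraMap ℂ Mer z))) (algebraMap ℂ Free z)
  | l_add (f g : Mer) : Rel q (gen (l (f + g))) (gen (l f) + gen (l g))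
  | l_mul (f g : Mer) : Rel q (gen (l (f * g))) (gen (l f) * gen (l g))
  | r_scalar (z : ℂ) : Rel q (gen (r (algebraMap ℂ Mer z))) (algebraMap ℂ Free z)
  | r_add (f g : Mer) : Rel q (gen (r (f + g))) (gen (r f) + gen (r g))
  | r_mul (f g : Mer) : Rel q (gen (r (f * g))) (gen (r f) * gen (r g))
  | lr_comm (f g : Mer) : Rel q (gen (l f) * gen (r g)) (gen (r g) * gen (l f))
  -- commutation of the dynamical variables with the generators
  | l_α (f : Mer) : Rel q (gen (l f) * gen α) (gen α * gen (l (shift 1 f)))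
  | r_α (f : Mer) : Rel q (gen (r f) * gen α) (gen α * gen (r (shift 1 f)))
  | l_β (f : Mer) : Rel q (gen (l f) * gen β) (gen β * gen (l (shift 1 f)))
  | r_β (f : Mer) : Rel q (gen (r f) * gen β) (gen β * gen (r (shift (-1) f)))
  | l_γ (f : Mer) : Rel q (gen (l f) * gen γ) (gen γ * gen (l (shift (-1) f)))
  | r_γ (f : Mer) : Rel q (gen (r f) * gen γ) (gen γ * gen (r (shift 1 f)))
  | l_δ (f : Mer) : Rel q (gen (l f) * gen δ) (gen δ * gen (l (shift (-1) f)))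
  | r_δ (f : Mer) : Rel q (gen (r f) * gen δ) (gen δ * gen (r (shift (-1) f)))
  -- `αβ = q F(μ-1) βα`, `αγ = q F(λ) γα`, `βδ = q F(λ) δβ`, `γδ = q F(μ-1) δγ`
  | αβ : Rel q (gen α * gen β) (qc q • (gen (r (shift (-1) (fF q))) * gen β * gen α))
  | αγ : Rel q (gen α * gen γ) (qc q • (gen (l (fF q)) * gen γ * gen α))
  | βδ : Rel q (gen β * gen δ) (qc q • (gen (l (fF q)) * gen δ * gen β))
  | γδ : Rel q (gen γ * gen δ) (qc q • (gen (r (shift (-1) (fF q))) * gen δ * gen γ))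
  -- the four mixed relations
  | cross₁ : Rel q (gen α * gen δ - gen δ * gen α) (freeH q * gen γ * gen β)
  | cross₂ : Rel q (gen (r (fG q)) * gen α * gen δ - gen (l (fG q)) * gen δ * gen α)
      (freeH q * gen β * gen γ)
  | cross₃ : Rel q (gen β * gen γ - gen (r (fG q)) * gen γ * gen β) (freeI q * gen δ * gen α)
  | cross₄ : Rel q (gen β * gen γ - gen (l (fG q)) * gen γ * gen β) (freeI q * gen α * gen δ)
  -- the determinant `c = αδ - q F(λ) γβ` equals `1`
  | det : Rel q (gen α * gen δ - qc q • (gen (l (fF q)) * gen γ * gen β)) 1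

/-- The algebra `F_R(SL(2))`. -/
def F (q : Set.Ioo (0 : ℝ) 1) : Type := RingQuot (Rel q)

variable (q : Set.Ioo (0 : ℝ) 1)

instance : Ring (F q) := inferInstanceAs (Ring (RingQuot (Rel q)))

instance : Algebra ℂ (F q) := inferInstanceAs (Algebra ℂ (RingQuot (Rel q)))

/-- The quotient map from the free algebra. -/
def proj : Free →ₐ[ℂ] F q := RingQuot.mkAlgHom ℂ (Rel q)

theorem proj_rel {x y : Free} (h : Rel q x y) : proj q x = proj q y :=
  RingQuot.mkAlgHom_rel ℂ h

/-- The generator `α`. -/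
def gα : F q := proj q (gen .α)

/-- The generator `β`. -/
def gβ : F q := proj q (gen .β)

/-- The generator `γ`. -/
def gγ : F q := proj q (gen .γ)

/-- The generator `δ`. -/
def gδ : F q := proj q (gen .δ)

/-- The left moment map `μ_l(f) = f(λ)`. -/
def μl : Mer →ₐ[ℂ] F q where
  toFun f := proj q (gen (.l f))
  map_one' := by
    have h := proj_rel q (.l_scalar 1)
    simpa using h
  map_mul' f g := by
    rw [proj_rel q (.l_mul f g), map_mul]
  map_zero' := by
    have h := proj_rel q (.l_scalar 0)
    simpa using h
  map_add' f g := by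
    rw [proj_rel q (.l_add f g), map_add]
  commutes' z := by
    rw [proj_rel q (.l_scalar z), AlgHom.commutes]

/-- The right moment map `μ_r(f) = f(μ)`. -/
def μr : Mer →ₐ[ℂ] F q where
  toFun f := proj q (gen (.r f))
  map_one' := by
    have h := proj_rel q (.r_scalar 1)
    simpa using h
  map_mul' f g := by
    rw [proj_rel q (.r_mul f g), map_mul]
  map_zero' := by
    have h := proj_rel q (.r_scalar 0)
    simpa using h
  map_add' f g := by
    rw [proj_rel q (.r_add f g), map_add]
  commutes' z := by
    rw [proj_rel q (.r_scalar z), AlgHom.commutes]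

variable {q}

theorem μl_μr (f g : Mer) : μl q f * μr q g = μr q g * μl q f := by
  have h := proj_rel q (.lr_comm f g)
  rwa [map_mul, map_mul] at h

theorem μl_α (f : Mer) : μl q f * gα q = gα q * μl q (shift 1 f) := by
  have h := proj_rel q (.l_α f)
  rwa [map_mul, map_mul] at h

theorem μr_α (f : Mer) : μr q f * gα q = gα q * μr q (shift 1 f) := by
  have h := proj_rel q (.r_α f)
  rwa [map_mul, map_mul] at h

theorem μl_β (f : Mer) : μl q f * gβ q = gβ q * μl q (shift 1 f) := by
  have h := proj_rel q (.l_β f)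
  rwa [map_mul, map_mul] at h

theorem μr_β (f : Mer) : μr q f * gβ q = gβ q * μr q (shift (-1) f) := by
  have h := proj_rel q (.r_β f)
  rwa [map_mul, map_mul] at h

theorem μl_γ (f : Mer) : μl q f * gγ q = gγ q * μl q (shift (-1) f) := by
  have h := proj_rel q (.l_γ f)
  rwa [map_mul, map_mul] at h

theorem μr_γ (f : Mer) : μr q f * gγ q = gγ q * μr q (shift 1 f) := by
  have h := proj_rel q (.r_γ f)
  rwa [map_mul, map_mul] at h

theorem μl_δ (f : Mer) : μl q f * gδ q = gδ q * μl q (shift (-1) f) := by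
  have h := proj_rel q (.l_δ f)
  rwa [map_mul, map_mul] at h

theorem μr_δ (f : Mer) : μr q f * gδ q = gδ q * μr q (shift (-1) f) := by
  have h := proj_rel q (.r_δ f)
  rwa [map_mul, map_mul] at h

variable (q)

/-- `q F`. -/
def cA : Mer := qc q • fF q

/-- `q F(· - 1)`. -/
def cB : Mer := qc q • shift (-1) (fF q)

theorem cB_mul_fK : cB q * fK q = 1 := fF_shift_mul_fK q

theorem cA_add_fK : cA q + fK q = algebraMap ℂ Mer (qc q + (qc q)⁻¹) := by
  have h : qc q ≠ 0 := q_ne_zero q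
  rw [cA, fF_eq, fK_eq, Algebra.algebraMap_eq_smul_one]
  match_scalars <;> field_simp
  ring

theorem αβ_rel : gα q * gβ q = μr q (cB q) * (gβ q * gα q) := by
  rw [cB, map_smul, smul_mul_assoc, ← mul_assoc]
  have h := proj_rel q .αβ
  rwa [map_mul, map_smul, map_mul, map_mul] at h

theorem αγ_rel : gα q * gγ q = μl q (cA q) * (gγ q * gα q) := by
  rw [cA, map_smul, smul_mul_assoc, ← mul_assoc]
  have h := proj_rel q .αγ
  rwa [map_mul, map_smul, map_mul, map_mul] at h

theorem βδ_rel : gβ q * gδ q = μl q (cA q) * (gδ q * gβ q) := by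
  rw [cA, map_smul, smul_mul_assoc, ← mul_assoc]
  have h := proj_rel q .βδ
  rwa [map_mul, map_smul, map_mul, map_mul] at h

theorem γδ_rel : gγ q * gδ q = μr q (cB q) * (gδ q * gγ q) := by
  rw [cB, map_smul, smul_mul_assoc, ← mul_assoc]
  have h := proj_rel q .γδ
  rwa [map_mul, map_smul, map_mul, map_mul] at h

/-- In any algebra with two commuting copies of `M`: the value of `H`. -/
theorem H_value {T : Type*} [Ring T] [Algebra ℂ T] (L R : Mer →ₐ[ℂ] T) :
    (qc q - (qc q)⁻¹) • (L (fU q) * R (fU q) - L (fW q) * R (fW q)) =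
      L (cA q) - R (fK q) := by
  have h : qc q ≠ 0 := q_ne_zero q
  rw [fU_eq, cA, fF_eq, fK_eq]
  simp only [map_add, map_one, map_smul, smul_add, mul_add, add_mul, one_mul, mul_one, smul_sub]
  match_scalars <;> field_simp <;> ring

/-- In any algebra with two commuting copies of `M`: the value of `I`. -/
theorem I_value {T : Type*} [Ring T] [Algebra ℂ T] (L R : Mer →ₐ[ℂ] T) :
    (qc q - (qc q)⁻¹) • (L (fW q) * R (fU q) - L (fU q) * R (fW q)) =
      L (cA q) - R (cA q) := by
  have h : qc q ≠ 0 := q_ne_zero q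
  rw [fU_eq, cA, fF_eq]
  simp only [map_add, map_one, map_smul, smul_add, mul_add, add_mul, one_mul, mul_one, smul_sub]
  match_scalars <;> field_simp <;> ring

theorem det_rel : gα q * gδ q = 1 + μl q (cA q) * (gγ q * gβ q) := by
  rw [← sub_eq_iff_eq_add, cA, map_smul, smul_mul_assoc, ← mul_assoc]
  have h := proj_rel q .det
  rwa [map_sub, map_mul, map_smul, map_mul, map_mul, map_one] at h

theorem δα_rel : gδ q * gα q = 1 + μr q (fK q) * (gγ q * gβ q) := by
  have h : gα q * gδ q - gδ q * gα q =
      ((qc q - (qc q)⁻¹) • (μl q (fU q) * μr q (fU q) - μl q (fW q) * μr q (fW q))) *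
        gγ q * gβ q := by
    have h0 := proj_rel q .cross₁
    rw [freeH] at h0
    simp only [map_sub, map_mul, map_smul] at h0
    exact h0
  rw [H_value, det_rel, mul_assoc] at h
  rw [sub_eq_iff_eq_add', ← sub_eq_iff_eq_add] at h
  rw [← h, sub_mul]
  abel

theorem βγ_rel : gβ q * gγ q =
    μl q (cA q) - μr q (cA q) + μl q (cA q) * (μr q (fK q) * (gγ q * gβ q)) := by
  have h : gβ q * gγ q - μl q (fG q) * gγ q * gβ q =
      ((qc q - (qc q)⁻¹) • (μl q (fW q) * μr q (fU q) - μl q (fU q) * μr q (fW q))) *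
        gα q * gδ q := by
    have h0 := proj_rel q .cross₄
    rw [freeI] at h0
    simp only [map_sub, map_mul, map_smul] at h0
    exact h0
  have hG : μl q (fG q) = μl q (cA q) * μl q (fK q) := by rw [fG_eq, map_mul]; rfl
  have e1 : μl q (cA q) + μl q (fK q) = μr q (cA q) + μr q (fK q) := by
    rw [← map_add, ← map_add, cA_add_fK, AlgHom.commutes, AlgHom.commutes]
  have e2 : μl q (cA q) - μr q (cA q) = μr q (fK q) - μl q (fK q) := by
    rw [sub_eq_sub_iff_add_eq_add, e1, add_comm]
  rw [I_value, mul_assoc, mul_assoc, det_rel, mul_add, mul_one, sub_eq_iff_eq_add, hG] at h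
  rw [h]
  have e3 : (μl q (cA q) - μr q (cA q)) * (μl q (cA q) * (gγ q * gβ q)) =
      μl q (cA q) * (μr q (fK q) * (gγ q * gβ q)) -
        μl q (cA q) * μl q (fK q) * (gγ q * gβ q) := by
    rw [e2, ← mul_assoc, sub_mul, ← μl_μr, ← map_mul, mul_comm (fK q), map_mul, sub_mul,
      mul_assoc, mul_assoc]
  rw [e3]
  abel

/-! ### The universal property -/

/-- Data defining an algebra homomorphism out of `F_R(SL(2))`. The relations are those of `Rel`
in solved form. -/
structure LiftData (T : Type*) [Ring T] [Algebra ℂ T] where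
  L : Mer →ₐ[ℂ] T
  R : Mer →ₐ[ℂ] T
  a : T
  b : T
  c : T
  d : T
  LR : ∀ f g, L f * R g = R g * L f
  La : ∀ f, L f * a = a * L (shift 1 f)
  Ra : ∀ f, R f * a = a * R (shift 1 f)
  Lb : ∀ f, L f * b = b * L (shift 1 f)
  Rb : ∀ f, R f * b = b * R (shift (-1) f)
  Lc : ∀ f, L f * c = c * L (shift (-1) f)
  Rc : ∀ f, R f * c = c * R (shift 1 f)
  Ld : ∀ f, L f * d = d * L (shift (-1) f)
  Rd : ∀ f, R f * d = d * R (shift (-1) f)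
  ab : a * b = R (cB q) * (b * a)
  ac : a * c = L (cA q) * (c * a)
  bd : b * d = L (cA q) * (d * b)
  cd : c * d = R (cB q) * (d * c)
  ad : a * d = 1 + L (cA q) * (c * b)
  da : d * a = 1 + R (fK q) * (c * b)
  bc : b * c = L (cA q) - R (cA q) + L (cA q) * (R (fK q) * (c * b))

variable {q}

/-- The value of a generator. -/
def LiftData.val {T : Type*} [Ring T] [Algebra ℂ T] (D : LiftData q T) : Gen → T
  | .l f => D.L f
  | .r f => D.R f
  | .α => D.a
  | .β => D.b
  | .γ => D.c
  | .δ => D.d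

theorem LiftData.val_rel {T : Type*} [Ring T] [Algebra ℂ T] (D : LiftData q T) {x y : Free}
    (h : Rel q x y) : FreeAlgebra.lift ℂ D.val x = FreeAlgebra.lift ℂ D.val y := by
  have hG (S : Mer →ₐ[ℂ] T) : S (fG q) = S (cA q) * S (fK q) := by rw [fG_eq, map_mul]; rfl
  have e1 : D.L (fK q) = D.R (cA q) + D.R (fK q) - D.L (cA q) := by
    rw [eq_sub_iff_add_eq', ← map_add, ← map_add, cA_add_fK, AlgHom.commutes, AlgHom.commutes]
  have hLR (f g : Mer) (x : T) : D.R g * (D.L f * x) = D.L f * (D.R g * x) := by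
    rw [← mul_assoc, ← D.LR, mul_assoc]
  have hRR (f g : Mer) : D.R g * D.R f = D.R f * D.R g := by
    rw [← map_mul, mul_comm, map_mul]
  have hRRx (f g : Mer) (x : T) : D.R g * (D.R f * x) = D.R f * (D.R g * x) := by
    rw [← mul_assoc, hRR, mul_assoc]
  cases h with
  | l_scalar z => simp [LiftData.val]
  | l_add f g => simp [LiftData.val]
  | l_mul f g => simp [LiftData.val]
  | r_scalar z => simp [LiftData.val]
  | r_add f g => simp [LiftData.val]
  | r_mul f g => simp [LiftData.val]
  | lr_comm f g => simpa [LiftData.val] using D.LR f g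
  | l_α f => simpa [LiftData.val] using D.La f
  | r_α f => simpa [LiftData.val] using D.Ra f
  | l_β f => simpa [LiftData.val] using D.Lb f
  | r_β f => simpa [LiftData.val] using D.Rb f
  | l_γ f => simpa [LiftData.val] using D.Lc f
  | r_γ f => simpa [LiftData.val] using D.Rc f
  | l_δ f => simpa [LiftData.val] using D.Ld f
  | r_δ f => simpa [LiftData.val] using D.Rd f
  | αβ =>
    have h := D.ab
    rw [cB, map_smul, smul_mul_assoc, ← mul_assoc] at h
    simpa only [map_mul, map_smul, FreeAlgebra.lift_ι_apply, LiftData.val] using h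
  | αγ =>
    have h := D.ac
    rw [cA, map_smul, smul_mul_assoc, ← mul_assoc] at h
    simpa only [map_mul, map_smul, FreeAlgebra.lift_ι_apply, LiftData.val] using h
  | βδ =>
    have h := D.bd
    rw [cA, map_smul, smul_mul_assoc, ← mul_assoc] at h
    simpa only [map_mul, map_smul, FreeAlgebra.lift_ι_apply, LiftData.val] using h
  | γδ =>
    have h := D.cd
    rw [cB, map_smul, smul_mul_assoc, ← mul_assoc] at h
    simpa only [map_mul, map_smul, FreeAlgebra.lift_ι_apply, LiftData.val] using h
  | cross₁ =>
    simp only [freeH, map_sub, map_mul, map_smul, FreeAlgebra.lift_ι_apply, LiftData.val]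
    rw [H_value, D.ad, D.da, mul_assoc, sub_mul]
    abel
  | cross₂ =>
    simp only [freeH, map_sub, map_mul, map_smul, FreeAlgebra.lift_ι_apply, LiftData.val]
    rw [H_value, mul_assoc, mul_assoc, mul_assoc, D.ad, D.da, D.bc, hG, hG, e1]
    simp only [mul_add, add_mul, mul_sub, sub_mul, mul_one, mul_assoc, ← D.LR, hLR,
      hRR (fK q) (cA q), hRRx (fK q) (cA q)]
    abel
  | cross₃ =>
    simp only [freeI, map_sub, map_mul, map_smul, FreeAlgebra.lift_ι_apply, LiftData.val]
    rw [I_value, mul_assoc, mul_assoc, D.da, D.bc, hG]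
    simp only [mul_add, sub_mul, mul_one, mul_assoc]
    abel
  | cross₄ =>
    simp only [freeI, map_sub, map_mul, map_smul, FreeAlgebra.lift_ι_apply, LiftData.val]
    rw [I_value, mul_assoc, mul_assoc, D.ad, D.bc, hG, e1]
    simp only [mul_add, add_mul, mul_sub, sub_mul, mul_one, mul_assoc, hLR]
    abel
  | det =>
    simp only [map_sub, map_mul, map_smul, FreeAlgebra.lift_ι_apply, LiftData.val, map_one]
    rw [D.ad, cA, map_smul, smul_mul_assoc, mul_assoc]
    abel

/-- The algebra homomorphism defined by its values on the generators. -/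
def LiftData.lift {T : Type*} [Ring T] [Algebra ℂ T] (D : LiftData q T) : F q →ₐ[ℂ] T :=
  RingQuot.liftAlgHom ℂ ⟨FreeAlgebra.lift ℂ D.val, fun _ _ h => D.val_rel h⟩

theorem LiftData.lift_proj {T : Type*} [Ring T] [Algebra ℂ T] (D : LiftData q T) (x : Gen) :
    D.lift (proj q (gen x)) = D.val x := by
  have h : D.lift (proj q (gen x)) = FreeAlgebra.lift ℂ D.val (gen x) :=
    RingQuot.liftAlgHom_mkAlgHom_apply ..
  rw [h, FreeAlgebra.lift_ι_apply]

variable (q)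

/-! ### Bigrading, moment maps, counit -/

/-- `HasBidegree q m n a` says that `a` lies in the component `F_{mn}` of the bigrading determined by
`α ∈ F_{1,1}`, `β ∈ F_{1,-1}`, `γ ∈ F_{-1,1}`, `δ ∈ F_{-1,-1}`, `f(λ), f(μ) ∈ F_{0,0}`. -/
inductive HasBidegree : ℂ → ℂ → F q → Prop
  | left (f : Mer) : HasBidegree 0 0 (μl q f)
  | right (f : Mer) : HasBidegree 0 0 (μr q f)
  | α : HasBidegree 1 1 (gα q)
  | β : HasBidegree 1 (-1) (gβ q)
  | γ : HasBidegree (-1) 1 (gγ q)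
  | δ : HasBidegree (-1) (-1) (gδ q)
  | mul {m n m' n' : ℂ} {a b : F q} (ha : HasBidegree m n a) (hb : HasBidegree m' n' b) :
      HasBidegree (m + m') (n + n') (a * b)
  | zero (m n : ℂ) : HasBidegree m n 0
  | add {m n : ℂ} {a b : F q} (ha : HasBidegree m n a) (hb : HasBidegree m n b) :
      HasBidegree m n (a + b)

/-- The map `M ⊗ M → F_R(SL(2))`, `f ⊗ g ↦ μ_l(f) μ_r(g)`. -/
def moment : Mer ⊗[ℂ] Mer →ₐ[ℂ] F q :=
  Algebra.TensorProduct.lift (μl q) (μr q) (fun f g => μl_μr f g)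

/-- The subalgebra `μ_l(M) μ_r(M)`. -/
abbrev base : Subalgebra ℂ (F q) := (moment q).range

/-- Data for the counit `ε`, with values in the difference operators on `M`:
`ε(α) = T_{-1}`, `ε(β) = ε(γ) = 0`, `ε(δ) = T_1`, `ε(f(λ)) = ε(f(μ)) = f`. -/
def counitData : LiftData q (Module.End ℂ Mer) where
  L := Algebra.lmul ℂ Mer
  R := Algebra.lmul ℂ Mer
  a := (shift (-1)).toLinearMap
  b := 0
  c := 0
  d := (shift 1).toLinearMap
  LR f g := by
    ext x
    simp [mul_left_comm]
  La f := by
    ext x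
    simp [shift_shift, shift_zero]
  Ra f := by
    ext x
    simp [shift_shift, shift_zero]
  Lb f := by simp
  Rb f := by simp
  Lc f := by simp
  Rc f := by simp
  Ld f := by
    ext x
    simp [shift_shift, shift_zero]
  Rd f := by
    ext x
    simp [shift_shift, shift_zero]
  ab := by simp
  ac := by simp
  bd := by simp
  cd := by simp
  ad := by
    ext x
    simp [shift_shift, shift_zero]
  da := by
    ext x
    simp [shift_shift, shift_zero]
  bc := by simp

/-- The counit `ε`, with values in the (difference) operators on `M`. -/
def counit : F q →ₐ[ℂ] Module.End ℂ Mer := (counitData q).lift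

/-! ### Tensor products over `M`

`F ⊗_M V` is the tensor product modulo `μ_r(f) a ⊗ v = a ⊗ f v`; it is a vector space over `M` through
`f (a ⊗ v) = μ_l(f) a ⊗ v`. For a graded `V`, the space `F ⊗̃ V = ⨁_{m,n} F_{mn} ⊗_M V_n` is a direct
summand of `F ⊗_M V = ⨁_{m,n,n'} F_{mn} ⊗_M V_{n'}`; its components are `FT.grade` below. -/

/-- `F_R(SL(2))` is a vector space over `M` by `f a = μ_l(f) a`. -/
instance : Module Mer (F q) := Module.compHom (F q) (μl q).toRingHom

theorem smul_def (f : Mer) (a : F q) : f • a = μl q f * a := rfl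

instance : IsScalarTower ℂ Mer (F q) where
  smul_assoc z f a := by
    rw [smul_def, smul_def, map_smul, smul_mul_assoc]

/-- A copy of `F_R(SL(2))`, a vector space over `M` by `f a = μ_r(f) a`. -/
def FR : Type := F q

instance : Ring (FR q) := inferInstanceAs (Ring (F q))

instance : Module Mer (FR q) := Module.compHom (F q) (μr q).toRingHom

/-- The space `F ⊗_M V`. -/
def FT (V : Type*) [AddCommGroup V] [Module Mer V] : Type _ := FR q ⊗[Mer] V

section FT

variable {q}
variable {V W P : Type*} [AddCommGroup V] [Module Mer V] [AddCommGroup W] [Module Mer W]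
  [AddCommGroup P] [Module Mer P]

instance : AddCommGroup (FT q V) := inferInstanceAs (AddCommGroup (FR q ⊗[Mer] V))

/-- Left multiplication by `μ_l(f)` on `FR`. -/
def lmulFR : Mer →+* Module.End Mer (FR q) where
  toFun f :=
    { toFun := fun a : F q => μl q f * a
      map_add' := fun a b : F q => mul_add (μl q f) a b
      map_smul' := fun g => fun a : F q => by
        change μl q f * (μr q g * a) = μr q g * (μl q f * a)
        rw [← mul_assoc, μl_μr, mul_assoc] }
  map_one' := LinearMap.ext fun a : F q => by
    change μl q 1 * a = a
    rw [map_one, one_mul]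
  map_mul' f g := LinearMap.ext fun a : F q => by
    change μl q (f * g) * a = μl q f * (μl q g * a)
    rw [map_mul, mul_assoc]
  map_zero' := LinearMap.ext fun a : F q => by
    change μl q 0 * a = 0
    rw [map_zero, zero_mul]
  map_add' f g := LinearMap.ext fun a : F q => by
    change μl q (f + g) * a = μl q f * a + μl q g * a
    rw [map_add, add_mul]

/-- Left multiplication by `μ_l(f)` on `F ⊗_M V`. -/
def lmulFT : Mer →+* Module.End Mer (FR q ⊗[Mer] V) where
  toFun f := LinearMap.rTensor V (lmulFR f)
  map_one' := by rw [map_one]; exact LinearMap.rTensor_id V (FR q)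
  map_mul' f g := by rw [map_mul]; exact LinearMap.rTensor_comp V (lmulFR f) (lmulFR g)
  map_zero' := by rw [map_zero, LinearMap.rTensor_zero]
  map_add' f g := by rw [map_add, LinearMap.rTensor_add]

instance : Module Mer (FT q V) :=
  Module.compHom (FR q ⊗[Mer] V) (lmulFT (q := q) (V := V))

instance : Module ℂ (FT q V) := Module.compHom (FT q V) (algebraMap ℂ Mer)

instance : IsScalarTower ℂ Mer (FT q V) where
  smul_assoc z f x := by
    change (z • f) • x = algebraMap ℂ Mer z • f • x
    rw [Algebra.smul_def]
    exact mul_smul (algebraMap ℂ Mer z) f x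

/-- The pure tensor `a ⊗ v`. -/
def FT.tmul (a : F q) (v : V) : FT q V := TensorProduct.tmul (M := FR q) Mer a v

theorem FT.smul_tmul (f : Mer) (a : F q) (v : V) : f • FT.tmul a v = FT.tmul (μl q f * a) v := rfl

theorem FT.tmul_smul (f : Mer) (a : F q) (v : V) : FT.tmul a (f • v) = FT.tmul (μr q f * a) v :=
  TensorProduct.tmul_smul (M := FR q) f a v

theorem FT.add_tmul (a b : F q) (v : V) : FT.tmul (a + b) v = FT.tmul a v + FT.tmul b v :=
  TensorProduct.add_tmul (M := FR q) a b v

theorem FT.tmul_add (a : F q) (v w : V) : FT.tmul a (v + w) = FT.tmul a v + FT.tmul a w :=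
  TensorProduct.tmul_add (M := FR q) a v w

theorem FT.sub_tmul (a b : F q) (v : V) : FT.tmul (a - b) v = FT.tmul a v - FT.tmul b v :=
  TensorProduct.sub_tmul (M := FR q) (R := Mer) a b v

theorem FT.tmul_sub (a : F q) (v w : V) : FT.tmul a (v - w) = FT.tmul a v - FT.tmul a w :=
  TensorProduct.tmul_sub (M := FR q) (R := Mer) a v w

theorem FT.zero_tmul (v : V) : FT.tmul (0 : F q) v = 0 := TensorProduct.zero_tmul (FR q) v

theorem FT.tmul_zero (a : F q) : FT.tmul a (0 : V) = 0 := TensorProduct.tmul_zero (M := FR q) V a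

theorem FT.induction {p : FT q V → Prop} (zero : p 0) (tmul : ∀ a v, p (FT.tmul a v))
    (add : ∀ x y, p x → p y → p (x + y)) (x : FT q V) : p x :=
  TensorProduct.induction_on (motive := p) x zero tmul add

/-- Additive maps out of `F ⊗_M V`. -/
def FT.lift {A : Type*} [AddCommGroup A] (f : F q →+ V →+ A)
    (hf : ∀ (g : Mer) (a : F q) (v : V), f (μr q g * a) v = f a (g • v)) : FT q V →+ A :=
  TensorProduct.liftAddHom (M := FR q) f hf

theorem FT.lift_tmul {A : Type*} [AddCommGroup A] (f : F q →+ V →+ A)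
    (hf : ∀ (g : Mer) (a : F q) (v : V), f (μr q g * a) v = f a (g • v)) (a : F q) (v : V) :
    FT.lift f hf (FT.tmul a v) = f a v := rfl

/-- `id ⊗ φ : F ⊗_M V → F ⊗_M W`. -/
def FT.map (φ : V →ₗ[Mer] W) : FT q V →ₗ[Mer] FT q W where
  toFun := LinearMap.lTensor (FR q) φ
  map_add' x y := map_add (LinearMap.lTensor (FR q) φ) x y
  map_smul' f x := by
    have h : LinearMap.lTensor (FR q) φ ∘ₗ LinearMap.rTensor V (lmulFR f) =
        LinearMap.rTensor W (lmulFR f) ∘ₗ LinearMap.lTensor (FR q) φ := by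
      rw [LinearMap.lTensor_comp_rTensor, LinearMap.rTensor_comp_lTensor]
    exact LinearMap.congr_fun h x

theorem FT.map_tmul (φ : V →ₗ[Mer] W) (a : F q) (v : V) :
    FT.map φ (FT.tmul a v) = FT.tmul a (φ v) := rfl

theorem FT.map_injective (φ : V →ₗ[Mer] W) (hφ : Function.Injective φ) :
    Function.Injective (FT.map (q := q) φ) :=
  Module.Flat.lTensor_preserves_injective_linearMap (M := FR q) φ hφ

/-- The `M`-linear map `a ↦ a ⊗ v` (for the left structure). -/
def FT.tmulRight (v : V) : F q →ₗ[Mer] FT q V where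
  toFun a := FT.tmul a v
  map_add' a b := FT.add_tmul a b v
  map_smul' _ _ := rfl

/-- Given a grading of `V`, the component of degree `m` of `F ⊗̃ V = ⨁_{m,n} F_{mn} ⊗_M V_n`, as a
subspace of `F ⊗_M V`. -/
def FT.grade (gr : ℂ → Submodule Mer V) (m : ℂ) : Submodule Mer (FT q V) :=
  Submodule.span Mer {x | ∃ (n : ℂ) (a : F q) (v : V), HasBidegree q m n a ∧ v ∈ gr n ∧
    x = FT.tmul a v}

/-- `ε ⊗ id : F ⊗_M V → V`, `a ⊗ v ↦ (ε(a) 1) v`; in particular `f T_{-n} ⊗ v ↦ f v`. -/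
def FT.counitMap : FT q V →+ V :=
  FT.lift
    { toFun := fun a =>
        { toFun := fun v => counit q a 1 • v
          map_zero' := smul_zero _
          map_add' := smul_add _ }
      map_zero' := by
        ext v
        simp
      map_add' := fun a b => by
        ext v
        simp [add_smul] }
    (by
      intro g a v
      have h : counit q (μr q g) = Algebra.lmul ℂ Mer g :=
        LiftData.lift_proj (counitData q) (.r g)
      simp only [AddMonoidHom.coe_mk, ZeroHom.coe_mk]
      rw [map_mul, h, ← mul_smul, mul_comm]
      rfl)

end FT

/-! ### The coproduct

The algebra `F ⊗̃ F = ⨁_{m,k,n} F_{mk} ⊗_M F_{kn} ⊆ F ⊗_M F`, with product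
`(a ⊗ b)(x ⊗ y) = a x ⊗ b y`, acts on `F ⊗_M F` by the same formula, and an element of it is recovered
from its action by applying it to `1 ⊗ 1`. The coproduct is the algebra homomorphism
`Δ : F → F ⊗̃ F` with the prescribed values on generators; it is obtained from the algebra
homomorphism `a ↦ (multiplication by Δ(a))` by evaluation at `1 ⊗ 1`. -/

section coproduct

variable {q}

/-- The operator `x ⊗ y ↦ a x ⊗ b y` on `F ⊗_M F`, for `a ∈ F_{mk}`, `b ∈ F_{kn}`: the bidegrees enter
only through the commutation relations with the moment maps. -/
def opMul (k : ℂ) (a b : F q) (ha : ∀ f, μr q f * a = a * μr q (shift k f))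
    (hb : ∀ f, μl q f * b = b * μl q (shift k f)) : Module.End ℂ (FT q (F q)) :=
  let φ : FT q (F q) →+ FT q (F q) := FT.lift
    { toFun := fun x =>
        { toFun := fun y => FT.tmul (a * x) (b * y)
          map_zero' := by rw [mul_zero, FT.tmul_zero]
          map_add' := fun y y' => by rw [mul_add, FT.tmul_add] }
      map_zero' := by
        ext y
        exact (congrArg (FT.tmul · (b * y)) (mul_zero a)).trans (FT.zero_tmul _)
      map_add' := fun x x' => by
        ext y
        exact (congrArg (FT.tmul · (b * y)) (mul_add a x x')).trans (FT.add_tmul _ _ _) }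
    (by
      intro g x y
      have h1 : a * (μr q g * x) = μr q (shift (-k) g) * (a * x) := by
        rw [← mul_assoc, ← mul_assoc, ha, shift_shift, add_neg_cancel, shift_zero]
      have h2 : b * (μl q g * y) = μl q (shift (-k) g) * (b * y) := by
        rw [← mul_assoc, ← mul_assoc, hb, shift_shift, add_neg_cancel, shift_zero]
      change FT.tmul (a * (μr q g * x)) (b * y) = FT.tmul (a * x) (b * (μl q g * y))
      rw [h1, h2, ← FT.tmul_smul]
      rfl)
  { toFun := φ
    map_add' := φ.map_add
    map_smul' := by
      intro z x
      induction x using FT.induction with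
      | zero => simp
      | tmul x y =>
        have e (u v : F q) : z • FT.tmul u v = FT.tmul (z • u) v := by
          change algebraMap ℂ Mer z • FT.tmul u v = _
          rw [FT.smul_tmul, AlgHom.commutes, Algebra.smul_def]
        rw [e]
        change FT.tmul (a * (z • x)) (b * y) = z • FT.tmul (a * x) (b * y)
        rw [e, mul_smul_comm]
      | add x y hx hy => rw [smul_add, map_add, map_add, smul_add, hx, hy] }

theorem opMul_tmul (k : ℂ) (a b : F q) (ha : ∀ f, μr q f * a = a * μr q (shift k f))
    (hb : ∀ f, μl q f * b = b * μl q (shift k f)) (x y : F q) :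
    opMul k a b ha hb (FT.tmul x y) = FT.tmul (a * x) (b * y) := rfl

theorem end_ext {φ ψ : Module.End ℂ (FT q (F q))}
    (h : ∀ x y, φ (FT.tmul x y) = ψ (FT.tmul x y)) : φ = ψ := by
  ext t
  induction t using FT.induction with
  | zero => rw [map_zero, map_zero]
  | tmul x y => exact h x y
  | add x y hx hy => rw [map_add, map_add, hx, hy]

theorem comm_zero_left (f g : Mer) : μl q f * μl q g = μl q g * μl q (shift 0 f) := by
  rw [shift_zero, ← map_mul, mul_comm, map_mul]

theorem comm_zero_right (f g : Mer) : μr q f * μr q g = μr q g * μr q (shift 0 f) := by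
  rw [shift_zero, ← map_mul, mul_comm, map_mul]

/-- Multiplication by `f(λ) ⊗ 1`. -/
def opL : Mer →ₐ[ℂ] Module.End ℂ (FT q (F q)) where
  toFun f := opMul 0 (μl q f) 1 (fun g => by rw [shift_zero, μl_μr])
    (fun g => by rw [shift_zero, mul_one, one_mul])
  map_one' := end_ext fun x y => by
    rw [opMul_tmul, map_one, one_mul, one_mul]; rfl
  map_mul' f g := end_ext fun x y => by
    rw [Module.End.mul_apply, opMul_tmul, opMul_tmul, opMul_tmul, map_mul, one_mul, one_mul,
      mul_assoc]
  map_zero' := end_ext fun x y => by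
    rw [opMul_tmul, map_zero, zero_mul, FT.zero_tmul]; rfl
  map_add' f g := end_ext fun x y => by
    rw [LinearMap.add_apply, opMul_tmul, opMul_tmul, opMul_tmul, map_add, add_mul, FT.add_tmul]
  commutes' z := end_ext fun x y => by
    rw [opMul_tmul, one_mul, ← FT.smul_tmul]; rfl

/-- Multiplication by `1 ⊗ f(μ)`. -/
def opR : Mer →ₐ[ℂ] Module.End ℂ (FT q (F q)) where
  toFun f := opMul 0 1 (μr q f) (fun g => by rw [shift_zero, mul_one, one_mul])
    (fun g => by rw [shift_zero, μl_μr])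
  map_one' := end_ext fun x y => by
    rw [opMul_tmul, map_one, one_mul, one_mul]; rfl
  map_mul' f g := end_ext fun x y => by
    rw [Module.End.mul_apply, opMul_tmul, opMul_tmul, opMul_tmul, map_mul, one_mul, one_mul,
      mul_assoc]
  map_zero' := end_ext fun x y => by
    rw [opMul_tmul, map_zero, zero_mul, FT.tmul_zero]; rfl
  map_add' f g := end_ext fun x y => by
    rw [LinearMap.add_apply, opMul_tmul, opMul_tmul, opMul_tmul, map_add, add_mul, FT.tmul_add]
  commutes' z := end_ext fun x y => by
    rw [opMul_tmul, one_mul, AlgHom.commutes]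
    have h : algebraMap ℂ (F q) z * y = algebraMap ℂ Mer z • y := by
      rw [smul_def, AlgHom.commutes]
    rw [h, FT.tmul_smul, AlgHom.commutes, ← AlgHom.commutes (μl q), ← FT.smul_tmul]
    rfl

/-- Multiplication by `α ⊗ α + β ⊗ γ`. -/
def opα : Module.End ℂ (FT q (F q)) :=
  opMul 1 (gα q) (gα q) μr_α μl_α + opMul (-1) (gβ q) (gγ q) μr_β μl_γ

/-- Multiplication by `α ⊗ β + β ⊗ δ`. -/
def opβ : Module.End ℂ (FT q (F q)) :=
  opMul 1 (gα q) (gβ q) μr_α μl_β + opMul (-1) (gβ q) (gδ q) μr_β μl_δ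

/-- Multiplication by `γ ⊗ α + δ ⊗ γ`. -/
def opγ : Module.End ℂ (FT q (F q)) :=
  opMul 1 (gγ q) (gα q) μr_γ μl_α + opMul (-1) (gδ q) (gγ q) μr_δ μl_γ

/-- Multiplication by `γ ⊗ β + δ ⊗ δ`. -/
def opδ : Module.End ℂ (FT q (F q)) :=
  opMul 1 (gγ q) (gβ q) μr_γ μl_β + opMul (-1) (gδ q) (gδ q) μr_δ μl_δ

theorem opα_tmul (x y : F q) : opα (FT.tmul x y) =
    FT.tmul (gα q * x) (gα q * y) + FT.tmul (gβ q * x) (gγ q * y) := rfl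

theorem opβ_tmul (x y : F q) : opβ (FT.tmul x y) =
    FT.tmul (gα q * x) (gβ q * y) + FT.tmul (gβ q * x) (gδ q * y) := rfl

theorem opγ_tmul (x y : F q) : opγ (FT.tmul x y) =
    FT.tmul (gγ q * x) (gα q * y) + FT.tmul (gδ q * x) (gγ q * y) := rfl

theorem opδ_tmul (x y : F q) : opδ (FT.tmul x y) =
    FT.tmul (gγ q * x) (gβ q * y) + FT.tmul (gδ q * x) (gδ q * y) := rfl

theorem opL_tmul (f : Mer) (x y : F q) : opL f (FT.tmul x y) = FT.tmul (μl q f * x) y := by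
  change FT.tmul (μl q f * x) (1 * y) = _
  rw [one_mul]

theorem opR_tmul (f : Mer) (x y : F q) : opR f (FT.tmul x y) = FT.tmul x (μr q f * y) := by
  change FT.tmul (1 * x) (μr q f * y) = _
  rw [one_mul]

/-- The middle variable: `f(μ) ⊗ 1 = 1 ⊗ f(λ)`. -/
theorem tmul_mid (f : Mer) (x y : F q) : FT.tmul (μr q f * x) y = FT.tmul x (μl q f * y) :=
  (FT.tmul_smul f x y).symm

theorem βγ_rel2 : gβ q * gγ q = μl q (cA q) * (gδ q * gα q) - μr q (cA q) := by
  rw [δα_rel, βγ_rel, mul_add, mul_one]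
  abel

theorem βγ_rel3 : gβ q * gγ q = μr q (fK q) * (gα q * gδ q) - μl q (fK q) := by
  have e1 : μl q (cA q) + μl q (fK q) = μr q (cA q) + μr q (fK q) := by
    rw [← map_add, ← map_add, cA_add_fK, AlgHom.commutes, AlgHom.commutes]
  have e2 : μl q (cA q) - μr q (cA q) = μr q (fK q) - μl q (fK q) := by
    rw [sub_eq_sub_iff_add_eq_add, e1, add_comm]
  have e3 (x : F q) : μr q (fK q) * (μl q (cA q) * x) = μl q (cA q) * (μr q (fK q) * x) := by
    rw [← mul_assoc, ← μl_μr, mul_assoc]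
  rw [det_rel, βγ_rel, mul_add, mul_one, e2, e3]
  abel

theorem μrBK : μr q (cB q) * μr q (fK q) = 1 := by
  rw [← map_mul, cB_mul_fK, map_one]

theorem μlBK : μl q (cB q) * μl q (fK q) = 1 := by
  rw [← map_mul, cB_mul_fK, map_one]

theorem key_rel : μl q (cB q) * (gα q * gδ q) + gγ q * gβ q =
    μr q (cB q) * (μl q (cB q) * (gβ q * gγ q) + gδ q * gα q) := by
  have h1 : μl q (cB q) * (gβ q * gγ q) =
      μl q (cB q) * (μr q (fK q) * (gα q * gδ q)) - 1 := by
    rw [βγ_rel3, mul_sub, μlBK]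
  have h2 : gδ q * gα q = 1 + μr q (fK q) * (gγ q * gβ q) := δα_rel q
  rw [h1, h2, mul_add, mul_sub, mul_add, ← mul_assoc (μr q _) (μr q _), μrBK, one_mul]
  rw [← mul_assoc (μr q (cB q)), ← μl_μr, mul_assoc, ← mul_assoc (μr q (cB q)), μrBK, one_mul]
  abel

theorem mid_sub (f g : Mer) (u x y : F q) : FT.tmul ((μl q f * u - μr q g) * x) y =
    FT.tmul (μl q f * (u * x)) y - FT.tmul x (μl q g * y) := by
  rw [sub_mul, FT.sub_tmul, tmul_mid, mul_assoc]

theorem ad_op : (opα * opδ : Module.End ℂ (FT q (F q))) = 1 + opL (cA q) * (opγ * opβ) := by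
  refine end_ext fun x y => ?_
  have h : FT.tmul (gα q * (gδ q * x)) (gα q * (gδ q * y)) =
      FT.tmul x (gα q * (gδ q * y)) +
        FT.tmul (μl q (cA q) * (gγ q * (gβ q * x))) (gα q * (gδ q * y)) := by
    rw [← mul_assoc (gα q) (gδ q) x, det_rel, add_mul, one_mul, FT.add_tmul, mul_assoc, mul_assoc]
  have h2 : FT.tmul (gβ q * (gγ q * x)) (gγ q * (gβ q * y)) =
      FT.tmul (μl q (cA q) * (gδ q * (gα q * x))) (gγ q * (gβ q * y)) -
        FT.tmul x (μl q (cA q) * (gγ q * (gβ q * y))) := by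
    rw [← mul_assoc (gβ q) (gγ q) x, βγ_rel2, mid_sub, mul_assoc]
  have h3 : FT.tmul x (gα q * (gδ q * y)) =
      FT.tmul x y + FT.tmul x (μl q (cA q) * (gγ q * (gβ q * y))) := by
    rw [← mul_assoc (gα q) (gδ q) y, det_rel, add_mul, one_mul, FT.tmul_add, mul_assoc, mul_assoc]
  have h4 : gα q * (gγ q * x) = μl q (cA q) * (gγ q * (gα q * x)) := by
    rw [← mul_assoc, αγ_rel, mul_assoc, mul_assoc]
  have h5 : gβ q * (gδ q * x) = μl q (cA q) * (gδ q * (gβ q * x)) := by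
    rw [← mul_assoc, βδ_rel, mul_assoc, mul_assoc]
  simp only [Module.End.mul_apply, LinearMap.add_apply, Module.End.one_apply, map_add, opα_tmul,
    opβ_tmul, opγ_tmul, opδ_tmul, opL_tmul, h, h2, h4, h5]
  rw [h3]
  abel

theorem da_op : (opδ * opα : Module.End ℂ (FT q (F q))) = 1 + opR (fK q) * (opγ * opβ) := by
  refine end_ext fun x y => ?_
  have hK : μr q (fK q) * μr q (cB q) = 1 := by rw [← map_mul, mul_comm, cB_mul_fK, map_one]
  have h1 (y : F q) : μr q (fK q) * (gα q * (gβ q * y)) = gβ q * (gα q * y) := by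
    rw [← mul_assoc (gα q), αβ_rel, mul_assoc, mul_assoc, ← mul_assoc (μr q (fK q)), hK, one_mul]
  have h2 (y : F q) : μr q (fK q) * (gγ q * (gδ q * y)) = gδ q * (gγ q * y) := by
    rw [← mul_assoc (gγ q), γδ_rel, mul_assoc, mul_assoc, ← mul_assoc (μr q (fK q)), hK, one_mul]
  have h3 : FT.tmul (gγ q * (gβ q * x)) (gβ q * (gγ q * y)) =
      FT.tmul (gγ q * (gβ q * x)) (μr q (fK q) * (gα q * (gδ q * y))) -
        FT.tmul (μr q (fK q) * (gγ q * (gβ q * x))) y := by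
    rw [← mul_assoc (gβ q) (gγ q) y, βγ_rel3, sub_mul, FT.tmul_sub, tmul_mid, mul_assoc, mul_assoc]
  have h4 : FT.tmul (gδ q * (gα q * x)) (gδ q * (gα q * y)) =
      FT.tmul (gδ q * (gα q * x)) y +
        FT.tmul (gδ q * (gα q * x)) (μr q (fK q) * (gγ q * (gβ q * y))) := by
    rw [← mul_assoc (gδ q) (gα q) y, δα_rel, add_mul, one_mul, FT.tmul_add, mul_assoc, mul_assoc]
  have h5 : FT.tmul (gδ q * (gα q * x)) y =
      FT.tmul x y + FT.tmul (μr q (fK q) * (gγ q * (gβ q * x))) y := by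
    rw [← mul_assoc (gδ q) (gα q) x, δα_rel, add_mul, one_mul, FT.add_tmul, mul_assoc, mul_assoc]
  simp only [Module.End.mul_apply, LinearMap.add_apply, Module.End.one_apply, map_add, opα_tmul,
    opβ_tmul, opγ_tmul, opδ_tmul, opR_tmul, h1, h2, h3, h4]
  rw [h5]
  abel

/-- The common computation behind several relations: for right factors `u, v, w, z`. -/
theorem collapse (x Y Z : F q) :
    FT.tmul (gα q * (gδ q * x)) Y + FT.tmul (gβ q * (gγ q * x)) Z =
      FT.tmul x (Y - μl q (cA q) * Z) +
        (FT.tmul (μl q (cA q) * (gγ q * (gβ q * x))) Y +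
          FT.tmul (μl q (cA q) * (gδ q * (gα q * x))) Z) := by
  rw [← mul_assoc (gα q) (gδ q) x, det_rel, ← mul_assoc (gβ q) (gγ q) x, βγ_rel2, mid_sub,
    add_mul, one_mul, FT.add_tmul, FT.tmul_sub]
  simp only [mul_assoc]
  abel

theorem αγ_x (x : F q) : gα q * (gγ q * x) = μl q (cA q) * (gγ q * (gα q * x)) := by
  rw [← mul_assoc, αγ_rel, mul_assoc, mul_assoc]

theorem βδ_x (x : F q) : gβ q * (gδ q * x) = μl q (cA q) * (gδ q * (gβ q * x)) := by
  rw [← mul_assoc, βδ_rel, mul_assoc, mul_assoc]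

theorem αβ_x (x : F q) : gα q * (gβ q * x) = μr q (cB q) * (gβ q * (gα q * x)) := by
  rw [← mul_assoc, αβ_rel, mul_assoc, mul_assoc]

theorem γδ_x (x : F q) : gγ q * (gδ q * x) = μr q (cB q) * (gδ q * (gγ q * x)) := by
  rw [← mul_assoc, γδ_rel, mul_assoc, mul_assoc]

theorem ac_op : (opα * opγ : Module.End ℂ (FT q (F q))) = opL (cA q) * (opγ * opα) := by
  refine end_ext fun x y => ?_
  have h := collapse x (gα q * (gγ q * y)) (gγ q * (gα q * y))
  rw [← αγ_x y, sub_self, FT.tmul_zero, zero_add] at h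
  simp only [Module.End.mul_apply, map_add, opα_tmul, opγ_tmul, opL_tmul]
  rw [αγ_x x, βδ_x x]
  rw [← sub_eq_zero] at h ⊢
  refine Eq.trans ?_ h
  abel

theorem bd_op : (opβ * opδ : Module.End ℂ (FT q (F q))) = opL (cA q) * (opδ * opβ) := by
  refine end_ext fun x y => ?_
  have h := collapse x (gβ q * (gδ q * y)) (gδ q * (gβ q * y))
  rw [← βδ_x y, sub_self, FT.tmul_zero, zero_add] at h
  simp only [Module.End.mul_apply, map_add, opβ_tmul, opδ_tmul, opL_tmul]
  rw [αγ_x x, βδ_x x]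
  rw [← sub_eq_zero] at h ⊢
  refine Eq.trans ?_ h
  abel

theorem bc_op : (opβ * opγ : Module.End ℂ (FT q (F q))) =
    opL (cA q) * (opδ * opα) - opR (cA q) := by
  refine end_ext fun x y => ?_
  have h := collapse x (gβ q * (gγ q * y)) (gδ q * (gα q * y))
  have h2 : gβ q * (gγ q * y) - μl q (cA q) * (gδ q * (gα q * y)) = - (μr q (cA q) * y) := by
    rw [← mul_assoc, βγ_rel2, sub_mul, mul_assoc, mul_assoc]
    abel
  have h3 : FT.tmul x (-(μr q (cA q) * y)) = - FT.tmul x (μr q (cA q) * y) := by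
    rw [← zero_sub, FT.tmul_sub, FT.tmul_zero, zero_sub]
  rw [h2, h3] at h
  simp only [Module.End.mul_apply, LinearMap.sub_apply, map_add, opβ_tmul, opγ_tmul, opα_tmul,
    opδ_tmul, opL_tmul, opR_tmul]
  rw [αγ_x x, βδ_x x]
  rw [← sub_eq_zero] at h ⊢
  refine Eq.trans ?_ h
  abel

theorem key_x (y : F q) : μl q (cB q) * (gα q * (gδ q * y)) + gγ q * (gβ q * y) =
    μr q (cB q) * (μl q (cB q) * (gβ q * (gγ q * y))) + μr q (cB q) * (gδ q * (gα q * y)) := by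
  have h := congrArg (· * y) (key_rel (q := q))
  simpa only [add_mul, mul_add, mul_assoc] using h

theorem ab_op : (opα * opβ : Module.End ℂ (FT q (F q))) = opR (cB q) * (opβ * opα) := by
  refine end_ext fun x y => ?_
  have h := congrArg (FT.tmul (gβ q * (gα q * x))) (key_x y)
  rw [FT.tmul_add, FT.tmul_add] at h
  have c (f g : Mer) (z : F q) : μr q f * (μl q g * z) = μl q g * (μr q f * z) := by
    rw [← mul_assoc, ← μl_μr, mul_assoc]
  rw [c, ← tmul_mid, ← tmul_mid, ← αβ_x] at h
  simp only [Module.End.mul_apply, map_add, opα_tmul, opβ_tmul, opR_tmul]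
  rw [αβ_x y, γδ_x y]
  rw [← sub_eq_zero] at h ⊢
  refine Eq.trans ?_ h
  abel

theorem cd_op : (opγ * opδ : Module.End ℂ (FT q (F q))) = opR (cB q) * (opδ * opγ) := by
  refine end_ext fun x y => ?_
  have h := congrArg (FT.tmul (gδ q * (gγ q * x))) (key_x y)
  rw [FT.tmul_add, FT.tmul_add] at h
  have c (f g : Mer) (z : F q) : μr q f * (μl q g * z) = μl q g * (μr q f * z) := by
    rw [← mul_assoc, ← μl_μr, mul_assoc]
  rw [c, ← tmul_mid, ← tmul_mid, ← γδ_x] at h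
  simp only [Module.End.mul_apply, map_add, opγ_tmul, opδ_tmul, opR_tmul]
  rw [αβ_x y, γδ_x y]
  rw [← sub_eq_zero] at h ⊢
  refine Eq.trans ?_ h
  abel

variable (q)

/-- Data for the coproduct: generators act on `F ⊗_M F` as multiplication by
`Δ(α) = α ⊗ α + β ⊗ γ`, `Δ(β) = α ⊗ β + β ⊗ δ`, `Δ(γ) = γ ⊗ α + δ ⊗ γ`, `Δ(δ) = γ ⊗ β + δ ⊗ δ`,
`Δ(f(λ)) = f(λ) ⊗ 1`, `Δ(f(μ)) = 1 ⊗ f(μ)`. -/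
def coproductData : LiftData q (Module.End ℂ (FT q (F q))) where
  L := opL
  R := opR
  a := opα
  b := opβ
  c := opγ
  d := opδ
  LR f g := end_ext fun x y => by
    simp only [Module.End.mul_apply, opL_tmul, opR_tmul]
  La f := end_ext fun x y => by
    simp only [Module.End.mul_apply, map_add, opL_tmul, opα_tmul, ← mul_assoc, μl_α, μl_β]
  Ra f := end_ext fun x y => by
    simp only [Module.End.mul_apply, map_add, opR_tmul, opα_tmul, ← mul_assoc, μr_α, μr_γ]
  Lb f := end_ext fun x y => by
    simp only [Module.End.mul_apply, map_add, opL_tmul, opβ_tmul, ← mul_assoc, μl_α, μl_β]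
  Rb f := end_ext fun x y => by
    simp only [Module.End.mul_apply, map_add, opR_tmul, opβ_tmul, ← mul_assoc, μr_β, μr_δ]
  Lc f := end_ext fun x y => by
    simp only [Module.End.mul_apply, map_add, opL_tmul, opγ_tmul, ← mul_assoc, μl_γ, μl_δ]
  Rc f := end_ext fun x y => by
    simp only [Module.End.mul_apply, map_add, opR_tmul, opγ_tmul, ← mul_assoc, μr_α, μr_γ]
  Ld f := end_ext fun x y => by
    simp only [Module.End.mul_apply, map_add, opL_tmul, opδ_tmul, ← mul_assoc, μl_γ, μl_δ]
  Rd f := end_ext fun x y => by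
    simp only [Module.End.mul_apply, map_add, opR_tmul, opδ_tmul, ← mul_assoc, μr_β, μr_δ]
  ab := ab_op
  ac := ac_op
  bd := bd_op
  cd := cd_op
  ad := ad_op
  da := da_op
  bc := by
    rw [bc_op, da_op, mul_add, mul_one]
    abel

/-- The algebra homomorphism sending `a` to multiplication by `Δ(a)` on `F ⊗_M F`. -/
def mulCoproduct : F q →ₐ[ℂ] Module.End ℂ (FT q (F q)) := (coproductData q).lift

theorem mulCoproduct_μl (f : Mer) : mulCoproduct q (μl q f) = opL f :=
  LiftData.lift_proj (coproductData q) (.l f)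

theorem mulCoproduct_μr (f : Mer) : mulCoproduct q (μr q f) = opR f :=
  LiftData.lift_proj (coproductData q) (.r f)

theorem mulCoproduct_α : mulCoproduct q (gα q) = opα :=
  LiftData.lift_proj (coproductData q) .α

theorem mulCoproduct_β : mulCoproduct q (gβ q) = opβ :=
  LiftData.lift_proj (coproductData q) .β

theorem mulCoproduct_γ : mulCoproduct q (gγ q) = opγ :=
  LiftData.lift_proj (coproductData q) .γ

theorem mulCoproduct_δ : mulCoproduct q (gδ q) = opδ :=
  LiftData.lift_proj (coproductData q) .δ

/-- The coproduct `Δ : F → F ⊗̃ F ⊆ F ⊗_M F`. -/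
def coproduct : F q →ₗ[Mer] FT q (F q) where
  toFun a := mulCoproduct q a (FT.tmul 1 1)
  map_add' a b := by rw [map_add, LinearMap.add_apply]
  map_smul' f a := by
    rw [smul_def, map_mul, mulCoproduct_μl, Module.End.mul_apply]
    induction mulCoproduct q a (FT.tmul 1 1) using FT.induction with
    | zero => rw [map_zero, smul_zero]
    | tmul x y => rw [opL_tmul]; rfl
    | add x y hx hy => rw [map_add, smul_add, hx, hy]

/-- `Δ(ab) = Δ(a) Δ(b)`. -/
theorem coproduct_mul (a b : F q) : coproduct q (a * b) = mulCoproduct q a (coproduct q b) := by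
  change mulCoproduct q (a * b) _ = _
  rw [map_mul]; rfl

theorem coproduct_one : coproduct q 1 = FT.tmul 1 1 := by
  change mulCoproduct q 1 _ = _
  rw [map_one]; rfl

theorem coproduct_α :
    coproduct q (gα q) = FT.tmul (gα q) (gα q) + FT.tmul (gβ q) (gγ q) := by
  change mulCoproduct q (gα q) _ = _
  simp only [mulCoproduct_α, opα_tmul, mul_one]

theorem coproduct_β :
    coproduct q (gβ q) = FT.tmul (gα q) (gβ q) + FT.tmul (gβ q) (gδ q) := by
  change mulCoproduct q (gβ q) _ = _
  simp only [mulCoproduct_β, opβ_tmul, mul_one]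

theorem coproduct_γ :
    coproduct q (gγ q) = FT.tmul (gγ q) (gα q) + FT.tmul (gδ q) (gγ q) := by
  change mulCoproduct q (gγ q) _ = _
  simp only [mulCoproduct_γ, opγ_tmul, mul_one]

theorem coproduct_δ :
    coproduct q (gδ q) = FT.tmul (gγ q) (gβ q) + FT.tmul (gδ q) (gδ q) := by
  change mulCoproduct q (gδ q) _ = _
  simp only [mulCoproduct_δ, opδ_tmul, mul_one]

end coproduct

/-! ### Corepresentations -/

section corep

/-- An `𝔥`-space (a vector space over `M` with a grading by weights in `𝔥^* = ℂ`) together with a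
linear map `V → F ⊗_M V`, as carried by every corepresentation of `F = F_R(SL(2))`. The axioms
are in `IsCorep`. -/
structure Coaction (q : Set.Ioo (0 : ℝ) 1) (V : Type*) [AddCommGroup V] [Module Mer V] where
  /-- the weight spaces -/
  gr : ℂ → Submodule Mer V
  /-- the coaction -/
  toFun : V →ₗ[Mer] FT q V

variable {q}
variable {V W : Type*} [AddCommGroup V] [Module Mer V] [AddCommGroup W] [Module Mer W]

/-- `Δ ⊗ id : F ⊗_M V → F ⊗_M (F ⊗_M V)`. -/
def FT.coproductMap : FT q V →+ FT q (FT q V) :=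
  FT.lift
    { toFun := fun a =>
        { toFun := fun v => FT.map (FT.tmulRight v) (coproduct q a)
          map_zero' := by
            induction coproduct q a using FT.induction with
            | zero => rw [map_zero]
            | tmul x y => exact (congrArg (FT.tmul x) (FT.tmul_zero y)).trans (FT.tmul_zero x)
            | add x y hx hy => rw [map_add, hx, hy, add_zero]
          map_add' := fun v w => by
            induction coproduct q a using FT.induction with
            | zero => rw [map_zero, map_zero, map_zero, add_zero]
            | tmul x y => exact (congrArg (FT.tmul x) (FT.tmul_add y v w)).trans (FT.tmul_add x _ _)
            | add x y hx hy => rw [map_add, map_add, map_add, hx, hy]; abel }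
      map_zero' := by
        ext v
        change FT.map (FT.tmulRight v) (coproduct q 0) = 0
        rw [map_zero, map_zero]
      map_add' := fun a b => by
        ext v
        change FT.map (FT.tmulRight v) (coproduct q (a + b)) =
          FT.map (FT.tmulRight v) (coproduct q a) + FT.map (FT.tmulRight v) (coproduct q b)
        rw [map_add, map_add] }
    (by
      intro g a v
      change FT.map (FT.tmulRight v) (coproduct q (μr q g * a)) =
        FT.map (FT.tmulRight (g • v)) (coproduct q a)
      rw [coproduct_mul, mulCoproduct_μr]
      induction coproduct q a using FT.induction with
      | zero => rw [map_zero, map_zero, map_zero]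
      | tmul x y =>
        rw [opR_tmul, FT.map_tmul, FT.map_tmul]
        exact congrArg (FT.tmul x) (FT.tmul_smul g y v).symm
      | add x y hx hy => rw [map_add, map_add, map_add, hx, hy])

/-- The axioms of a corepresentation: `V` is the direct sum of its weight spaces, and
`π : V → F ⊗̃ V` is a morphism of `𝔥`-spaces satisfying `(Δ ⊗ id) π = (id ⊗ π) π` and
`(ε ⊗ id) π = id`. -/
structure Coaction.IsCorep (C : Coaction q V) : Prop where
  isInternal : DirectSum.IsInternal C.gr
  map_gr : ∀ (n : ℂ), ∀ v ∈ C.gr n, C.toFun v ∈ FT.grade C.gr n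
  coassoc : ∀ v, FT.coproductMap (C.toFun v) = FT.map C.toFun (C.toFun v)
  counit : ∀ v, FT.counitMap (C.toFun v) = v

/-- An isomorphism of corepresentations: a bijective intertwiner (an `M`-linear map that preserves
weights and commutes with the coactions). -/
structure Coaction.Iso (C : Coaction q V) (D : Coaction q W) where
  /-- the underlying linear bijection -/
  toEquiv : V ≃ₗ[Mer] W
  map_gr : ∀ (n : ℂ) (v : V), toEquiv v ∈ D.gr n ↔ v ∈ C.gr n
  map_coaction : ∀ v, D.toFun (toEquiv v) = FT.map toEquiv.toLinearMap (C.toFun v)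

/-- Irreducibility: `V ≠ 0`, and every invariant `𝔥`-subspace is `0` or `V`. A subspace `U` is an
`𝔥`-subspace if it is the sum of its intersections with the weight spaces, and is invariant if
`π(U)` lies in (the image of) `F ⊗_M U`. -/
def Coaction.IsIrreducible (C : Coaction q V) : Prop :=
  Nontrivial V ∧ ∀ U : Submodule Mer V, U = ⨆ n, U ⊓ C.gr n →
    (∀ u ∈ U, C.toFun u ∈ LinearMap.range (FT.map (q := q) U.subtype)) → U = ⊥ ∨ U = ⊤

/-- `V ⊗_ℂ W` for a vector space `W` over `ℂ` of multiplicities: `π(v ⊗ w) = π(v) ⊗ w`. -/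
def Coaction.tensor [Module ℂ V] [IsScalarTower ℂ Mer V] (C : Coaction q V)
    (W : Type*) [AddCommGroup W] [Module ℂ W] : Coaction q (V ⊗[ℂ] W) where
  gr n := Submodule.span Mer {x | ∃ v ∈ C.gr n, ∃ w : W, x = v ⊗ₜ[ℂ] w}
  toFun := TensorProduct.AlgebraTensorModule.lift
    { toFun := fun v =>
        { toFun := fun w => FT.map ((TensorProduct.AlgebraTensorModule.mk ℂ Mer V W).flip w)
            (C.toFun v)
          map_add' := fun w w' => by
            induction C.toFun v using FT.induction with
            | zero => rw [map_zero, map_zero, map_zero, add_zero]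
            | tmul x y =>
              exact (congrArg (FT.tmul x) (TensorProduct.tmul_add y w w')).trans
                (FT.tmul_add x _ _)
            | add x y hx hy =>
              rw [(FT.map _).map_add x y, (FT.map _).map_add x y, (FT.map _).map_add x y, hx, hy]
              abel
          map_smul' := fun z w => by
            induction C.toFun v using FT.induction with
            | zero => rw [map_zero, map_zero, smul_zero]
            | tmul x y =>
              have h : y ⊗ₜ[ℂ] (z • w) = algebraMap ℂ Mer z • (y ⊗ₜ[ℂ] w) := by
                rw [algebraMap_smul, TensorProduct.tmul_smul]
              refine (congrArg (FT.tmul x) h).trans ?_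
              rw [FT.tmul_smul, AlgHom.commutes, ← AlgHom.commutes (μl q)]
              rfl
            | add x y hx hy => rw [map_add, map_add, hx, hy, smul_add] }
      map_add' := fun v v' => by
        ext w
        change FT.map _ (C.toFun (v + v')) = FT.map _ (C.toFun v) + FT.map _ (C.toFun v')
        rw [map_add, map_add]
      map_smul' := fun f v => by
        ext w
        change FT.map _ (C.toFun (f • v)) = f • FT.map _ (C.toFun v)
        rw [map_smul, map_smul] }

/-- The direct sum of corepresentations. -/
def Coaction.directSum {ι : Type*} [DecidableEq ι] {X : ι → Type*} [∀ i, AddCommGroup (X i)]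
    [∀ i, Module Mer (X i)] (C : ∀ i, Coaction q (X i)) : Coaction q (DirectSum ι X) where
  gr n := ⨅ i, ((C i).gr n).comap (DirectSum.component Mer ι X i)
  toFun := DirectSum.toModule Mer ι _ fun i => FT.map (DirectSum.lof Mer ι X i) ∘ₗ (C i).toFun

variable (q)

/-- The weight spaces `F_m = ⨁_n F_{mn}` of `F`. -/
def regularGr (m : ℂ) : Submodule Mer (F q) :=
  Submodule.span Mer {a | ∃ n, HasBidegree q m n a}

/-- The regular corepresentation: `F` with the coproduct. -/
def regular : Coaction q (F q) where
  gr := regularGr q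
  toFun := coproduct q

variable {q}

/-- The restriction of `Δ` to a subspace `U` with `Δ(U) ⊆ F ⊗_M U`: the unique map whose composition
with `F ⊗_M U → F ⊗_M F` is `Δ`. -/
def subCoaction (U : Submodule Mer (F q))
    (hU : ∀ u ∈ U, coproduct q u ∈ LinearMap.range (FT.map (q := q) U.subtype)) :
    Coaction q U where
  gr n := (regularGr q n).comap U.subtype
  toFun := (LinearEquiv.ofInjective (FT.map (q := q) U.subtype)
    (FT.map_injective _ U.injective_subtype)).symm.toLinearMap ∘ₗ
    LinearMap.codRestrict _ (coproduct q ∘ₗ U.subtype) (fun u => hU u u.2)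

theorem subCoaction_spec (U : Submodule Mer (F q))
    (hU : ∀ u ∈ U, coproduct q u ∈ LinearMap.range (FT.map (q := q) U.subtype)) (u : U) :
    FT.map U.subtype ((subCoaction U hU).toFun u) = coproduct q u :=
  congrArg Subtype.val (LinearEquiv.apply_symm_apply (LinearEquiv.ofInjective
    (FT.map (q := q) U.subtype) (FT.map_injective _ U.injective_subtype))
    ⟨coproduct q u, hU u u.2⟩)

/-! ### The corepresentations `V_N` -/

variable (q)

/-- The element `γ^{N-k} α^k`. -/
def vecF (N : ℕ) (k : Fin (N + 1)) : F q := gγ q ^ (N - (k : ℕ)) * gα q ^ (k : ℕ)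

/-- `V_N`, the span of `γ^{N-k} α^k`, `0 ≤ k ≤ N`, over `μ_l(M)`. -/
def VN (N : ℕ) : Submodule Mer (F q) := Submodule.span Mer (Set.range (vecF q N))

/-- The element `γ^{N-k} α^k` of `V_N`. -/
def vec (N : ℕ) (k : Fin (N + 1)) : VN q N := ⟨vecF q N k, Submodule.subset_span ⟨k, rfl⟩⟩

variable {q}

theorem γα_mem (m k : ℕ) : gγ q ^ m * gα q ^ k ∈ VN q (m + k) := by
  have h : gγ q ^ m * gα q ^ k = vecF q (m + k) ⟨k, by omega⟩ := by
    rw [vecF]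
    simp
  rw [h]
  exact Submodule.subset_span ⟨_, rfl⟩

theorem α_γ_pow (m : ℕ) : ∃ f : Mer, gα q * gγ q ^ m = μl q f * (gγ q ^ m * gα q) := by
  induction m with
  | zero => exact ⟨1, by simp⟩
  | succ m ih =>
    obtain ⟨f, hf⟩ := ih
    have h : gγ q * μl q f = μl q (shift 1 f) * gγ q := by
      rw [μl_γ, shift_shift, neg_add_cancel, shift_zero]
    refine ⟨cA q * shift 1 f, ?_⟩
    rw [pow_succ', αγ_x, hf, ← mul_assoc (gγ q), h, map_mul]
    simp only [mul_assoc]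

theorem γ_mul_mem (N : ℕ) {a : F q} (ha : a ∈ VN q N) : gγ q * a ∈ VN q (N + 1) := by
  induction ha using Submodule.span_induction with
  | mem x hx =>
    obtain ⟨k, rfl⟩ := hx
    have h := γα_mem (q := q) (N - (k : ℕ) + 1) (k : ℕ)
    rw [show N - (k : ℕ) + 1 + (k : ℕ) = N + 1 by omega, pow_succ', mul_assoc] at h
    exact h
  | zero => rw [mul_zero]; exact zero_mem _
  | add x y _ _ hx hy => rw [mul_add]; exact add_mem hx hy
  | smul f x _ hx =>
    have h : gγ q * f • x = shift 1 f • (gγ q * x) := by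
      rw [smul_def, smul_def, ← mul_assoc, ← mul_assoc, μl_γ, shift_shift, neg_add_cancel,
        shift_zero]
    rw [h]
    exact Submodule.smul_mem _ _ hx

theorem α_mul_mem (N : ℕ) {a : F q} (ha : a ∈ VN q N) : gα q * a ∈ VN q (N + 1) := by
  induction ha using Submodule.span_induction with
  | mem x hx =>
    obtain ⟨k, rfl⟩ := hx
    obtain ⟨f, hf⟩ := α_γ_pow (q := q) (N - (k : ℕ))
    have h := γα_mem (q := q) (N - (k : ℕ)) ((k : ℕ) + 1)
    rw [show N - (k : ℕ) + ((k : ℕ) + 1) = N + 1 by omega, pow_succ', ← mul_assoc] at h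
    rw [vecF, ← mul_assoc, hf, mul_assoc, ← smul_def]
    exact Submodule.smul_mem _ _ h
  | zero => rw [mul_zero]; exact zero_mem _
  | add x y _ _ hx hy => rw [mul_add]; exact add_mem hx hy
  | smul f x _ hx =>
    have h : gα q * f • x = shift (-1) f • (gα q * x) := by
      rw [smul_def, smul_def, ← mul_assoc, ← mul_assoc, μl_α, shift_shift, add_neg_cancel,
        shift_zero]
    rw [h]
    exact Submodule.smul_mem _ _ hx

/-- If an operator is a sum of `x ⊗ y ↦ a x ⊗ α y` and `x ⊗ y ↦ b x ⊗ γ y`, it maps `F ⊗_M V_N` to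
`F ⊗_M V_{N+1}`. -/
theorem op_mem (N : ℕ) (a b : F q) (φ : Module.End ℂ (FT q (F q)))
    (hφ : ∀ x y, φ (FT.tmul x y) = FT.tmul (a * x) (gα q * y) + FT.tmul (b * x) (gγ q * y))
    {t : FT q (F q)} (ht : t ∈ LinearMap.range (FT.map (q := q) (VN q N).subtype)) :
    φ t ∈ LinearMap.range (FT.map (q := q) (VN q (N + 1)).subtype) := by
  obtain ⟨s, rfl⟩ := ht
  induction s using FT.induction with
  | zero => rw [map_zero, map_zero]; exact zero_mem _
  | tmul x y =>
    rw [FT.map_tmul, hφ]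
    refine add_mem ⟨FT.tmul (a * x) ⟨_, α_mul_mem N y.2⟩, rfl⟩
      ⟨FT.tmul (b * x) ⟨_, γ_mul_mem N y.2⟩, rfl⟩
  | add x y hx hy => rw [map_add, map_add]; exact add_mem hx hy

theorem coproduct_mem_aux (m k : ℕ) : coproduct q (gγ q ^ m * gα q ^ k) ∈
    LinearMap.range (FT.map (q := q) (VN q (m + k)).subtype) := by
  induction m with
  | zero =>
    rw [pow_zero, one_mul, zero_add]
    induction k with
    | zero =>
      have h1 : (1 : F q) ∈ VN q 0 := by simpa using γα_mem (q := q) 0 0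
      rw [pow_zero, coproduct_one]
      exact ⟨FT.tmul 1 ⟨1, h1⟩, rfl⟩
    | succ k ih =>
      rw [pow_succ', coproduct_mul, mulCoproduct_α]
      exact op_mem k _ _ opα opα_tmul ih
  | succ m ih =>
    rw [pow_succ', mul_assoc, coproduct_mul, mulCoproduct_γ,
      show m + 1 + k = m + k + 1 by omega]
    exact op_mem (m + k) _ _ opγ opγ_tmul ih

theorem coproduct_mem (N : ℕ) : ∀ u ∈ VN q N, coproduct q u ∈
    LinearMap.range (FT.map (q := q) (VN q N).subtype) := by
  intro u hu
  induction hu using Submodule.span_induction with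
  | mem x hx =>
    obtain ⟨k, rfl⟩ := hx
    have h := coproduct_mem_aux (q := q) (N - (k : ℕ)) (k : ℕ)
    rwa [show N - (k : ℕ) + (k : ℕ) = N by omega] at h
  | zero => rw [map_zero]; exact zero_mem _
  | add x y _ _ hx hy => rw [map_add]; exact add_mem hx hy
  | smul f x _ hx => rw [map_smul]; exact Submodule.smul_mem _ _ hx

variable (q)

/-- The corepresentation `V_N`: the restriction of `Δ`. -/
def corepV (N : ℕ) : Coaction q (VN q N) := subCoaction (VN q N) (coproduct_mem N)

/-- `t N k j` are the matrix elements of the corepresentations `V_N` in the bases `γ^{N-k} α^k`: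
`Δ(γ^{N-k} α^k) = ∑_j t^N_{kj} ⊗ γ^{N-j} α^j`. -/
def IsMatrixElements (t : (N : ℕ) → Fin (N + 1) → Fin (N + 1) → F q) : Prop :=
  ∀ (N : ℕ) (k : Fin (N + 1)),
    (corepV q N).toFun (vec q N k) = ∑ j, FT.tmul (t N k j) (vec q N j)

/-- The corepresentation `⨁_N V_N ⊗_ℂ M^{N+1}`. -/
def sumV :=
  Coaction.directSum fun N => (corepV q N).tensor (Fin (N + 1) → Mer)

end corep

end

end DynSL2

open scoped TensorProduct
open DynSL2

/-!
The Peter–Weyl decomposition of `F = F_R(SL(2))` rests on explicit recursions for the matrix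
elements `t^N_{kj}`, on lowering operators, and on a faithful enough model of `F`.

*Corepresentations.* That `Δ` is coassociative and counital is checked on generators, by comparing
operators of multiplication (`coassoc_aux`, `counitMap_mulCoproduct`), and the grading is obtained
from homomorphisms `F → F[G]` (`gradeHom`). The axioms for `V_N` follow by embedding `V_N` in `F`.
All structure functions are quotients of `sn n = q^{x+n+1} - q^{-(x+n+1)}`, and all identities
between them reduce to the addition formula `nu_mul_sn`.

*Spanning.* Writing `Δ(γ a) = Δ(γ) Δ(a)` and `Δ(α a) = Δ(α) Δ(a)` in the bases `γ^{N-k} α^k` gives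
two raising recursions from row `N` to row `N + 1`, of the form
`x ↦ (g_j(μ) a x_{j-1} + b x_j)_j` with `(a, b) = (γ, δ)` or `(α, β)`. There are companion lowering
operators `x ↦ (ν_{i+1} b x_{i+1} - h_i(μ) a x_i)_i`. By the defining relations a lowering operator
commutes with the raising operators up to factors depending on `λ` and multiples of the row
(`lower_raise_same`, `lower_raise_αβ_γδ`, `lower_raise_γδ_αβ`), whence by induction it maps rows of
matrix elements to multiples of rows of matrix elements (`exists_lower_αβ`, `exists_lower_γδ`).
Raising and lowering together determine `a x_{j-1}` and `b x_j`, so the span of the matrix elements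
over `μ_l(M) μ_r(M)` is a left ideal; it contains `1 = t^0_{00}` and is therefore all of `F`.

*Independence.* `F` acts by difference operators on `(M ⊗_ℂ M)[X]` (`modelData`), where
`f(λ)`, `f(μ)` act by multiplication and `X` stands for the central element
`(q^{λ+2} - q^{-λ-2}) (q^μ - q^{-μ}) γβ - q^{μ-λ-1} - q^{λ-μ+1}`. Evaluation at `1` is linear over
`M ⊗ M`, which gives the injectivity of `M ⊗ M → F`. It sends `t^N_{kj}` to a polynomial of degree
`N - k` whose leading coefficient is an invertible pure tensor: a `q`-binomial coefficient times
products of functions `(sn n)^{±1}` of `λ` and of `μ` (`hasLead_matZ`, `muLead_mul`). As `t^N_{kj}`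
has bidegree `(2k - N, 2j - N)`, matrix elements of the same bidegree have different degrees `N - k`,
and so the matrix elements are linearly independent over `μ_l(M) μ_r(M)`.

*Decomposition.* A vector `g ∈ M^{N+1}` is a linear form on `V_N`, and `v ⊗ g` is sent to the matrix
coefficient `(id ⊗ g) π(v)`; this is an intertwiner by coassociativity (`coproduct_peterWeyl`), and
bijective since the matrix elements are a basis. Irreducibility follows from the injectivity: if `U`
is invariant, `u ∈ U` and the linear form `g` vanishes on `U`, then the matrix coefficient of `u` and
`g` is zero, so that `u = 0` or `g = 0` (`corepV_isIrreducible`).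
-/

open scoped TensorProduct

namespace DynSL2

noncomputable section

/-! ### Trigonometric functions in the field `M` -/

theorem qx_eq_sq (q : Set.Ioo (0 : ℝ) 1) (x : ℂ) : qx q x = qc q ^ (x + 1) * qc q ^ (x + 1) := by
  rw [qx, two_mul, Complex.cpow_add _ _ (q_ne_zero q)]

theorem cpow_meromorphic (q : Set.Ioo (0 : ℝ) 1) : Meromorphic (fun x : ℂ => qc q ^ (x + 1)) := by
  have h : Differentiable ℂ (fun x : ℂ => qc q ^ (x + 1)) := by
    intro x
    exact DifferentiableAt.const_cpow (by fun_prop) (Or.inl (q_ne_zero q))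
  intro x
  exact (h.analyticAt x).meromorphicAt

variable (q : Set.Ioo (0 : ℝ) 1)

/-- The entire function `x ↦ q^{x+1}`. -/
def expM : Mer := Mer.of (fun x => qc q ^ (x + 1)) (cpow_meromorphic q)

theorem shift_expM (n : ℤ) : shift n (expM q) = (qc q ^ n) • expM q := by
  rw [expM, shift_of]
  change _ = Mer.of (fun x => qc q ^ n * qc q ^ (x + 1)) ((Meromorphic.const _).fun_mul
    (cpow_meromorphic q))
  congr 1
  funext x
  rw [← Complex.cpow_intCast, ← Complex.cpow_add _ _ (q_ne_zero q)]
  congr 1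
  ring

theorem expM_ne_zero : expM q ≠ 0 := by
  intro h
  have h1 : expM q * Mer.of (fun x => (qc q ^ (x + 1))⁻¹) (cpow_meromorphic q).inv = 1 := by
    change Mer.of (fun x => qc q ^ (x + 1) * (qc q ^ (x + 1))⁻¹) ((cpow_meromorphic q).fun_mul
      (cpow_meromorphic q).inv) = Mer.of (fun _ => 1) (Meromorphic.const 1)
    congr 1
    funext x
    exact mul_inv_cancel₀ (by simp [Complex.cpow_eq_zero_iff, q_ne_zero q])
  rw [h, zero_mul] at h1
  exact zero_ne_one h1

/-- The constant `q` in `M`. -/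
abbrev qM : Mer := algebraMap ℂ Mer (qc q)

theorem qM_ne_zero : qM q ≠ 0 := by
  simpa [qM] using q_ne_zero q

theorem qM_zpow (n : ℤ) : algebraMap ℂ Mer (qc q ^ n) = qM q ^ n := map_zpow₀ _ _ _

/-- The constant `q^n - q^{-n}`. -/
def nu (n : ℤ) : Mer := qM q ^ n - qM q ^ (-n)

/-- The function `x ↦ q^{x+n+1} - q^{-(x+n+1)}`. -/
def sn (n : ℤ) : Mer := qM q ^ n * expM q - qM q ^ (-n) * (expM q)⁻¹

theorem shift_algebraMap (z w : ℂ) : shift z (algebraMap ℂ Mer w) = algebraMap ℂ Mer w :=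
  AlgHom.commutes _ _

theorem shift_nu (z : ℂ) (n : ℤ) : shift z (nu q n) = nu q n := by
  rw [nu, map_sub, map_zpow₀, map_zpow₀, shift_algebraMap]

theorem shift_sn (m n : ℤ) : shift m (sn q n) = sn q (n + m) := by
  have h := qM_ne_zero q
  have hE := expM_ne_zero q
  rw [sn, sn, map_sub, map_mul, map_mul, map_inv₀, map_zpow₀, map_zpow₀, shift_algebraMap,
    shift_expM, Algebra.smul_def, qM_zpow, neg_add, zpow_add₀ h, zpow_add₀ h, zpow_neg _ m]
  field_simp

theorem shift_one_sn (n : ℤ) : shift 1 (sn q n) = sn q (n + 1) := by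
  simpa using shift_sn q 1 n

theorem shift_neg_one_sn (n : ℤ) : shift (-1) (sn q n) = sn q (n - 1) := by
  simpa [sub_eq_add_neg] using shift_sn q (-1) n

theorem nu_zero : nu q 0 = 0 := by simp [nu]

theorem nu_ne_zero {n : ℤ} (hn : n ≠ 0) : nu q n ≠ 0 := by
  have h0 := q.2.1
  have h1 := q.2.2
  intro h
  rw [nu, sub_eq_zero, ← qM_zpow, ← qM_zpow] at h
  have h2 := (algebraMap ℂ Mer).injective h
  have h3 : (q : ℝ) ^ n = (q : ℝ) ^ (-n) := by exact_mod_cast h2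
  have h4 := zpow_right_injective₀ h0 h1.ne h3
  omega

theorem sn_ne_zero (n : ℤ) : sn q n ≠ 0 := by
  have h := qM_ne_zero q
  have hE := expM_ne_zero q
  intro h0
  have h1 : sn q (n + 1) = 0 := by rw [← shift_one_sn, h0, map_zero]
  have h2 : nu q 1 * (qM q ^ (-n) * (expM q)⁻¹) = sn q (n + 1) - qM q * sn q n := by
    simp only [nu, sn, neg_add, zpow_add₀ h, zpow_neg, zpow_one]
    field_simp
    ring
  rw [h0, h1, mul_zero, sub_zero] at h2
  exact mul_ne_zero (nu_ne_zero q one_ne_zero) (mul_ne_zero (zpow_ne_zero _ h) (inv_ne_zero hE)) h2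

/-- The addition formula underlying every identity for the matrix elements. -/
theorem nu_mul_sn (a b x : ℤ) :
    nu q b * sn q (x - a) + nu q a * sn q (x + b) = nu q (a + b) * sn q x := by
  have h := qM_ne_zero q
  have hE := expM_ne_zero q
  simp only [nu, sn, neg_add, sub_eq_add_neg, neg_neg, zpow_add₀ h, zpow_neg]
  field_simp
  ring

theorem expM_sq_eq : Mer.of (qx q) (qx_meromorphic q) = expM q * expM q := by
  change _ = Mer.of (fun x => qc q ^ (x + 1) * qc q ^ (x + 1)) _
  congr 1
  funext x
  exact qx_eq_sq q x

theorem fW_mul : fW q * (expM q * expM q - 1) = 1 := by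
  rw [← expM_sq_eq]
  change Mer.of (fun x => 1 / (qx q x - 1) * (qx q x - 1)) (by fun_prop) =
    Mer.of (fun _ => 1) (Meromorphic.const 1)
  apply Mer.of_eq
  filter_upwards [qx_sub_ne q 0] with x hx
  rw [add_zero] at hx
  field_simp

theorem cA_mul_sn : cA q * sn q 0 = sn q 1 := by
  have h := qM_ne_zero q
  have hE := expM_ne_zero q
  have hW := fW_mul q
  have h2 : cA q = qM q * (1 + (1 - (qM q)⁻¹ ^ 2) * fW q) := by
    rw [cA, fF_eq, Algebra.smul_def, Algebra.smul_def, map_sub, map_pow, map_inv₀, map_one]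
  have h3 : sn q 0 = (expM q)⁻¹ * (expM q * expM q - 1) := by
    simp only [sn, zpow_zero, neg_zero]
    field_simp
  have h4 : cA q * sn q 0 = qM q * (expM q)⁻¹ *
      ((expM q * expM q - 1) + (1 - (qM q)⁻¹ ^ 2) * (fW q * (expM q * expM q - 1))) := by
    rw [h2, h3]; ring
  rw [h4, hW]
  simp only [sn, zpow_one, zpow_neg]
  field_simp
  ring

theorem cA_eq : cA q = sn q 1 / sn q 0 := by
  rw [eq_div_iff (sn_ne_zero q 0), cA_mul_sn]

theorem cB_eq : cB q = sn q 0 / sn q (-1) := by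
  have h : cB q = shift (-1) (cA q) := by rw [cB, cA, map_smul]
  rw [h, cA_eq, map_div₀, shift_neg_one_sn, shift_neg_one_sn]
  simp

theorem fK_eq_div : fK q = sn q (-1) / sn q 0 := by
  have h := cB_mul_fK q
  have h0 := sn_ne_zero q 0
  have h1 := sn_ne_zero q (-1)
  rw [cB_eq] at h
  field_simp at h ⊢
  exact h

/-- `M` is infinite-dimensional over `ℂ`: otherwise it would be `ℂ`, and translations would act
trivially. -/
theorem not_finite_mer : ¬ Module.Finite ℂ Mer := by
  intro hfin
  have := hfin
  let q : Set.Ioo (0 : ℝ) 1 := ⟨1 / 2, by norm_num, by norm_num⟩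
  obtain ⟨c, hc⟩ := (IsAlgClosed.algebraMap_bijective_of_isIntegral (k := ℂ) (K := Mer)).2 (expM q)
  have h1 : qM q * expM q = expM q := by
    have h := shift_expM q 1
    rw [← hc, shift_algebraMap, hc, zpow_one, Algebra.smul_def] at h
    exact h.symm
  have h2 : qM q = 1 := by
    apply mul_right_cancel₀ (expM_ne_zero q)
    rw [h1, one_mul]
  apply nu_ne_zero q one_ne_zero
  simp [nu, h2]

theorem not_finite_fun (N : ℕ) : ¬ Module.Finite ℂ (Fin (N + 1) → Mer) := by
  intro h
  exact not_finite_mer (Module.Finite.of_surjective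
    (LinearMap.proj (R := ℂ) (φ := fun _ : Fin (N + 1) => Mer) 0) (Function.surjective_eval 0))

end

noncomputable section

variable {q : Set.Ioo (0 : ℝ) 1}

/-! ### Induction principles and the bigrading -/

/-- Elements of `F_R(SL(2))` are built from the generators by sums and products. -/
theorem F_induction {p : F q → Prop} (hl : ∀ f, p (μl q f)) (hr : ∀ f, p (μr q f))
    (hα : p (gα q)) (hβ : p (gβ q)) (hγ : p (gγ q)) (hδ : p (gδ q))
    (hmul : ∀ a b, p a → p b → p (a * b)) (hadd : ∀ a b, p a → p b → p (a + b)) (a : F q) :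
    p a := by
  obtain ⟨x, rfl⟩ := RingQuot.mkAlgHom_surjective ℂ (Rel q) a
  change p (proj q x)
  induction x using FreeAlgebra.induction with
  | grade0 z =>
    have h : proj q (algebraMap ℂ Free z) = μl q (algebraMap ℂ Mer z) := by
      rw [AlgHom.commutes, AlgHom.commutes]
    rw [h]
    exact hl _
  | grade1 x =>
    cases x with
    | l f => exact hl f
    | r f => exact hr f
    | α => exact hα
    | β => exact hβ
    | γ => exact hγ
    | δ => exact hδ
  | mul a b ha hb => rw [map_mul]; exact hmul _ _ ha hb
  | add a b ha hb => rw [map_add]; exact hadd _ _ ha hb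

theorem sum_homogeneous (a : F q) :
    a ∈ AddSubmonoid.closure {a : F q | ∃ m n, HasBidegree q m n a} := by
  induction a using F_induction with
  | hl f => exact AddSubmonoid.subset_closure ⟨_, _, .left f⟩
  | hr f => exact AddSubmonoid.subset_closure ⟨_, _, .right f⟩
  | hα => exact AddSubmonoid.subset_closure ⟨_, _, .α⟩
  | hβ => exact AddSubmonoid.subset_closure ⟨_, _, .β⟩
  | hγ => exact AddSubmonoid.subset_closure ⟨_, _, .γ⟩
  | hδ => exact AddSubmonoid.subset_closure ⟨_, _, .δ⟩
  | hadd a b ha hb => exact add_mem ha hb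
  | hmul a b ha hb =>
    induction ha using AddSubmonoid.closure_induction with
    | zero => rw [zero_mul]; exact zero_mem _
    | add x y _ _ hx hy => rw [add_mul]; exact add_mem hx hy
    | mem x hx =>
      obtain ⟨m, n, hx⟩ := hx
      induction hb using AddSubmonoid.closure_induction with
      | zero => rw [mul_zero]; exact zero_mem _
      | add y z _ _ hy hz => rw [mul_add]; exact add_mem hy hz
      | mem y hy =>
        obtain ⟨m', n', hy⟩ := hy
        exact AddSubmonoid.subset_closure ⟨_, _, hx.mul hy⟩

/-- Every element of `F_R(SL(2))` is a sum of bihomogeneous ones. -/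
theorem homogeneous_induction {p : F q → Prop} (zero : p 0)
    (hom : ∀ m n a, HasBidegree q m n a → p a) (add : ∀ a b, p a → p b → p (a + b)) (a : F q) :
    p a := by
  induction sum_homogeneous a using AddSubmonoid.closure_induction with
  | zero => exact zero
  | mem x hx => obtain ⟨m, n, hx⟩ := hx; exact hom m n x hx
  | add x y _ _ hx hy => exact add _ _ hx hy

variable {G : Type*} [AddCommGroup G]

/-- Data for the homomorphism `F → F[G]`, `a ↦ a t^d` for `a` of degree `d`, attached to a grading
in which `α, β, γ, δ` have degrees `x + y, x - y, y - x, -x - y`. -/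
def gradeData (q : Set.Ioo (0 : ℝ) 1) (x y : G) : LiftData q (AddMonoidAlgebra (F q) G) where
  L := AddMonoidAlgebra.singleZeroAlgHom.comp (μl q)
  R := AddMonoidAlgebra.singleZeroAlgHom.comp (μr q)
  a := .single (x + y) (gα q)
  b := .single (x - y) (gβ q)
  c := .single (y - x) (gγ q)
  d := .single (-x - y) (gδ q)
  LR f g := by simp [AddMonoidAlgebra.single_mul_single, μl_μr]
  La f := by simp [AddMonoidAlgebra.single_mul_single, μl_α]
  Ra f := by simp [AddMonoidAlgebra.single_mul_single, μr_α]
  Lb f := by simp [AddMonoidAlgebra.single_mul_single, μl_β]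
  Rb f := by simp [AddMonoidAlgebra.single_mul_single, μr_β]
  Lc f := by simp [AddMonoidAlgebra.single_mul_single, μl_γ]
  Rc f := by simp [AddMonoidAlgebra.single_mul_single, μr_γ]
  Ld f := by simp [AddMonoidAlgebra.single_mul_single, μl_δ]
  Rd f := by simp [AddMonoidAlgebra.single_mul_single, μr_δ]
  ab := by
    simp [AddMonoidAlgebra.single_mul_single, αβ_rel]
  ac := by
    simp [AddMonoidAlgebra.single_mul_single, αγ_rel]
    congr 1; abel
  bd := by
    simp [AddMonoidAlgebra.single_mul_single, βδ_rel]
    congr 1; abel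
  cd := by
    simp [AddMonoidAlgebra.single_mul_single, γδ_rel]
  ad := by
    simp [AddMonoidAlgebra.single_mul_single, det_rel, AddMonoidAlgebra.one_def]
  da := by
    simp [AddMonoidAlgebra.single_mul_single, δα_rel, AddMonoidAlgebra.one_def]
  bc := by
    simp [AddMonoidAlgebra.single_mul_single, βγ_rel]

/-- The homomorphism `F → F[G]`, `a ↦ a t^{φ(m,n)}` for `a ∈ F_{mn}`. -/
def gradeHom (q : Set.Ioo (0 : ℝ) 1) (φ : ℂ × ℂ →+ G) : F q →ₐ[ℂ] AddMonoidAlgebra (F q) G :=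
  (gradeData q (φ (1, 0)) (φ (0, 1))).lift

theorem gradeHom_apply (φ : ℂ × ℂ →+ G) {m n : ℂ} {a : F q} (h : HasBidegree q m n a) :
    gradeHom q φ a = .single (φ (m, n)) a := by
  induction h with
  | left f =>
    refine (LiftData.lift_proj _ (.l f)).trans ?_
    rw [show ((0 : ℂ), (0 : ℂ)) = 0 from rfl, map_zero]; rfl
  | right f =>
    refine (LiftData.lift_proj _ (.r f)).trans ?_
    rw [show ((0 : ℂ), (0 : ℂ)) = 0 from rfl, map_zero]; rfl
  | α =>
    refine (LiftData.lift_proj _ .α).trans ?_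
    rw [show ((1 : ℂ), (1 : ℂ)) = (1, 0) + (0, 1) by simp, map_add]; rfl
  | β =>
    refine (LiftData.lift_proj _ .β).trans ?_
    rw [show ((1 : ℂ), (-1 : ℂ)) = (1, 0) - (0, 1) by simp, map_sub]; rfl
  | γ =>
    refine (LiftData.lift_proj _ .γ).trans ?_
    rw [show ((-1 : ℂ), (1 : ℂ)) = (0, 1) - (1, 0) by simp, map_sub]; rfl
  | δ =>
    refine (LiftData.lift_proj _ .δ).trans ?_
    rw [show ((-1 : ℂ), (-1 : ℂ)) = -(1, 0) - (0, 1) by simp, map_sub, map_neg]; rfl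
  | mul ha hb iha ihb =>
    rw [map_mul, iha, ihb, AddMonoidAlgebra.single_mul_single, ← map_add]; rfl
  | zero m n => simp
  | add ha hb iha ihb => rw [map_add, iha, ihb, AddMonoidAlgebra.single_add]

/-- The projection of `F` to the sum of the components `F_{mn}` with `φ(m,n) = g`. -/
def gradeProj (φ : ℂ × ℂ →+ G) (g : G) : F q →ₗ[Mer] F q where
  toFun a := (gradeHom q φ a).coeff g
  map_add' a b := by simp
  map_smul' f a := by
    rw [smul_def, map_mul, gradeHom_apply φ (.left f), show ((0 : ℂ), (0 : ℂ)) = 0 from rfl,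
      map_zero, AddMonoidAlgebra.coeff_single_zero_mul]
    rfl

theorem gradeProj_same (φ : ℂ × ℂ →+ G) {m n : ℂ} {a : F q} (h : HasBidegree q m n a) :
    gradeProj φ (φ (m, n)) a = a := by
  change (gradeHom q φ a).coeff _ = a
  rw [gradeHom_apply φ h]
  simp

theorem gradeProj_ne (φ : ℂ × ℂ →+ G) {m n : ℂ} {a : F q} (h : HasBidegree q m n a) {g : G}
    (hg : φ (m, n) ≠ g) : gradeProj φ g a = 0 := by
  change (gradeHom q φ a).coeff _ = 0
  rw [gradeHom_apply φ h]
  simp [hg]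

theorem moment_tmul (f g : Mer) : moment q (f ⊗ₜ[ℂ] g) = μl q f * μr q g :=
  Algebra.TensorProduct.lift_tmul ..

theorem hasBidegree_moment (x : Mer ⊗[ℂ] Mer) : HasBidegree q 0 0 (moment q x) := by
  induction x using TensorProduct.induction_on with
  | zero => rw [map_zero]; exact .zero 0 0
  | tmul f g =>
    have h := (HasBidegree.left (q := q) f).mul (.right g)
    rw [add_zero] at h
    rw [moment_tmul]
    exact h
  | add x y hx hy => rw [map_add]; exact hx.add hy

theorem HasBidegree.moment_mul {m n : ℂ} {a : F q} (h : HasBidegree q m n a)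
    (x : Mer ⊗[ℂ] Mer) : HasBidegree q m n (moment q x * a) := by
  simpa using (hasBidegree_moment x).mul h

/-- The projection of `F` to `F_m = ⨁_n F_{mn}`. -/
abbrev leftProj (m : ℂ) : F q →ₗ[Mer] F q := gradeProj (AddMonoidHom.fst ℂ ℂ) m

theorem leftProj_mem (m : ℂ) (a : F q) : leftProj m a ∈ regularGr q m := by
  induction a using homogeneous_induction with
  | zero => rw [map_zero]; exact zero_mem _
  | add a b ha hb => rw [map_add]; exact add_mem ha hb
  | hom m' n' a h =>
    by_cases hm : m' = m
    · subst hm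
      rw [show leftProj m' a = a from gradeProj_same (AddMonoidHom.fst ℂ ℂ) h]
      exact Submodule.subset_span ⟨n', h⟩
    · rw [show leftProj m a = 0 from gradeProj_ne (AddMonoidHom.fst ℂ ℂ) h hm]
      exact zero_mem _

theorem leftProj_same {m : ℂ} {a : F q} (h : a ∈ regularGr q m) : leftProj m a = a := by
  induction h using Submodule.span_induction with
  | mem x hx => obtain ⟨n, hx⟩ := hx; exact gradeProj_same (AddMonoidHom.fst ℂ ℂ) hx
  | zero => rw [map_zero]
  | add x y _ _ hx hy => rw [map_add, hx, hy]
  | smul f x _ hx => rw [map_smul, hx]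

theorem leftProj_ne {m m' : ℂ} {a : F q} (h : a ∈ regularGr q m) (hm : m ≠ m') :
    leftProj m' a = 0 := by
  induction h using Submodule.span_induction with
  | mem x hx => obtain ⟨n, hx⟩ := hx; exact gradeProj_ne (AddMonoidHom.fst ℂ ℂ) hx hm
  | zero => rw [map_zero]
  | add x y _ _ hx hy => rw [map_add, hx, hy, add_zero]
  | smul f x _ hx => rw [map_smul, hx, smul_zero]

theorem regularGr_iSupIndep : iSupIndep (regularGr q) := by
  rw [iSupIndep_def]
  intro m
  rw [Submodule.disjoint_def]
  intro x hx hx'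
  have h : (⨆ (j) (_ : j ≠ m), regularGr q j) ≤ LinearMap.ker (leftProj (q := q) m) :=
    iSup₂_le fun j hj y hy => leftProj_ne hy hj
  rw [← leftProj_same hx]
  exact h hx'

theorem regularGr_iSup : ⨆ m, regularGr q m = ⊤ := by
  rw [eq_top_iff]
  intro a _
  induction a using homogeneous_induction with
  | zero => exact zero_mem _
  | add a b ha hb => exact add_mem (ha trivial) (hb trivial)
  | hom m n a h => exact Submodule.mem_iSup_of_mem m (Submodule.subset_span ⟨n, h⟩)

/-! ### The regular corepresentation -/

theorem mulCoproduct_μl_apply (f : Mer) (t : FT q (F q)) : mulCoproduct q (μl q f) t = f • t := by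
  rw [mulCoproduct_μl]
  induction t using FT.induction with
  | zero => rw [map_zero, smul_zero]
  | tmul x y => rw [opL_tmul, FT.smul_tmul]
  | add x y hx hy => rw [map_add, smul_add, hx, hy]

theorem counit_μl (f : Mer) : counit q (μl q f) = Algebra.lmul ℂ Mer f :=
  LiftData.lift_proj (counitData q) (.l f)

theorem counit_α : counit q (gα q) = (shift (-1)).toLinearMap :=
  LiftData.lift_proj (counitData q) .α

theorem counit_β : counit q (gβ q) = 0 := LiftData.lift_proj (counitData q) .β

theorem counit_γ : counit q (gγ q) = 0 := LiftData.lift_proj (counitData q) .γ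

theorem counit_δ : counit q (gδ q) = (shift 1).toLinearMap :=
  LiftData.lift_proj (counitData q) .δ

section

variable {V : Type*} [AddCommGroup V] [Module Mer V]

theorem FT.counitMap_tmul (a : F q) (v : V) : FT.counitMap (FT.tmul a v) = counit q a 1 • v := rfl

end

theorem α_smul (f : Mer) (x : F q) : gα q * f • x = shift (-1) f • (gα q * x) := by
  rw [smul_def, smul_def, ← mul_assoc, ← mul_assoc, μl_α, shift_shift, add_neg_cancel, shift_zero]

theorem β_smul (f : Mer) (x : F q) : gβ q * f • x = shift (-1) f • (gβ q * x) := by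
  rw [smul_def, smul_def, ← mul_assoc, ← mul_assoc, μl_β, shift_shift, add_neg_cancel, shift_zero]

theorem γ_smul (f : Mer) (x : F q) : gγ q * f • x = shift 1 f • (gγ q * x) := by
  rw [smul_def, smul_def, ← mul_assoc, ← mul_assoc, μl_γ, shift_shift, neg_add_cancel, shift_zero]

theorem δ_smul (f : Mer) (x : F q) : gδ q * f • x = shift 1 f • (gδ q * x) := by
  rw [smul_def, smul_def, ← mul_assoc, ← mul_assoc, μl_δ, shift_shift, neg_add_cancel, shift_zero]

theorem μr_smul (f g : Mer) (x : F q) : μr q f * g • x = g • (μr q f * x) := by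
  rw [smul_def, smul_def, ← mul_assoc, ← μl_μr, mul_assoc]

/-- `(ε ⊗ id)(Δ(a) t) = a (ε ⊗ id)(t)`. -/
theorem counitMap_mulCoproduct (a : F q) :
    ∀ t, FT.counitMap (mulCoproduct q a t) = a * FT.counitMap t := by
  have key (a : F q) (h : ∀ x y, FT.counitMap (mulCoproduct q a (FT.tmul x y)) =
      a * FT.counitMap (FT.tmul x y)) (t) :
      FT.counitMap (mulCoproduct q a t) = a * FT.counitMap t := by
    induction t using FT.induction with
    | zero => rw [map_zero, map_zero, mul_zero]
    | tmul x y => exact h x y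
    | add x y hx hy => rw [map_add, map_add, map_add, mul_add, hx, hy]
  induction a using F_induction with
  | hl f =>
    refine key _ fun x y => ?_
    rw [mulCoproduct_μl, opL_tmul, FT.counitMap_tmul, FT.counitMap_tmul, map_mul, counit_μl,
      ← smul_def, ← mul_smul]
    rfl
  | hr f =>
    refine key _ fun x y => ?_
    rw [mulCoproduct_μr, opR_tmul, FT.counitMap_tmul, FT.counitMap_tmul, μr_smul]
  | hα =>
    refine key _ fun x y => ?_
    simp only [mulCoproduct_α, opα_tmul, map_add, FT.counitMap_tmul, map_mul, counit_α, counit_β,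
      α_smul, Module.End.mul_apply, LinearMap.zero_apply, zero_smul, add_zero]
    rfl
  | hβ =>
    refine key _ fun x y => ?_
    simp only [mulCoproduct_β, opβ_tmul, map_add, FT.counitMap_tmul, map_mul, counit_α, counit_β,
      β_smul, Module.End.mul_apply, LinearMap.zero_apply, zero_smul, add_zero]
    rfl
  | hγ =>
    refine key _ fun x y => ?_
    simp only [mulCoproduct_γ, opγ_tmul, map_add, FT.counitMap_tmul, map_mul, counit_γ, counit_δ,
      γ_smul, Module.End.mul_apply, LinearMap.zero_apply, zero_smul, zero_add]
    rfl
  | hδ =>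
    refine key _ fun x y => ?_
    simp only [mulCoproduct_δ, opδ_tmul, map_add, FT.counitMap_tmul, map_mul, counit_γ, counit_δ,
      δ_smul, Module.End.mul_apply, LinearMap.zero_apply, zero_smul, zero_add]
    rfl
  | hmul a b ha hb => intro t; rw [map_mul, Module.End.mul_apply, ha, hb, mul_assoc]
  | hadd a b ha hb => intro t; rw [map_add, LinearMap.add_apply, map_add, ha, hb, add_mul]

theorem coproduct_counit (a : F q) : FT.counitMap (coproduct q a) = a := by
  change FT.counitMap (mulCoproduct q a (FT.tmul 1 1)) = a
  rw [counitMap_mulCoproduct, FT.counitMap_tmul, map_one (counit q), Module.End.one_apply, one_smul,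
    mul_one]

section semi

variable {V : Type*} [AddCommGroup V] [Module Mer V]

/-- The operator `x ⊗ v ↦ a x ⊗ φ v` on `F ⊗_M V`, for `a ∈ F_{mk}` and `φ` semilinear with respect to
the translation by `-k`. -/
def semiOp (k : ℂ) (a : F q) (φ : V →+ V) (ha : ∀ f, μr q f * a = a * μr q (shift k f))
    (hφ : ∀ (f : Mer) v, φ (f • v) = shift (-k) f • φ v) : FT q V →+ FT q V :=
  FT.lift
    { toFun := fun x =>
        { toFun := fun v => FT.tmul (a * x) (φ v)
          map_zero' := by rw [map_zero, FT.tmul_zero]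
          map_add' := fun v w => by rw [map_add, FT.tmul_add] }
      map_zero' := by
        ext v
        exact (congrArg (FT.tmul · (φ v)) (mul_zero a)).trans (FT.zero_tmul _)
      map_add' := fun x x' => by
        ext v
        exact (congrArg (FT.tmul · (φ v)) (mul_add a x x')).trans (FT.add_tmul _ _ _) }
    (by
      intro g x v
      have h1 : a * (μr q g * x) = μr q (shift (-k) g) * (a * x) := by
        rw [← mul_assoc, ← mul_assoc, ha, shift_shift, add_neg_cancel, shift_zero]
      change FT.tmul (a * (μr q g * x)) (φ v) = FT.tmul (a * x) (φ (g • v))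
      rw [h1, hφ, ← FT.tmul_smul])

end semi

theorem mulCoproduct_smul {k : ℂ} {a : F q} (ha : ∀ f, μl q f * a = a * μl q (shift k f))
    (f : Mer) (t : FT q (F q)) :
    mulCoproduct q a (f • t) = shift (-k) f • mulCoproduct q a t := by
  have h : a * μl q f = μl q (shift (-k) f) * a := by
    rw [ha, shift_shift, add_neg_cancel, shift_zero]
  rw [← mulCoproduct_μl_apply, ← mulCoproduct_μl_apply, ← Module.End.mul_apply,
    ← Module.End.mul_apply, ← map_mul, ← map_mul, h]

theorem FT.coproductMap_tmul {V : Type*} [AddCommGroup V] [Module Mer V] (a : F q) (v : V) :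
    FT.coproductMap (FT.tmul a v) = FT.map (FT.tmulRight v) (coproduct q a) := rfl

theorem mulCoproduct_α_tmul (x y : F q) : mulCoproduct q (gα q) (FT.tmul x y) =
    FT.tmul (gα q * x) (gα q * y) + FT.tmul (gβ q * x) (gγ q * y) := by
  rw [mulCoproduct_α, opα_tmul]

theorem mulCoproduct_β_tmul (x y : F q) : mulCoproduct q (gβ q) (FT.tmul x y) =
    FT.tmul (gα q * x) (gβ q * y) + FT.tmul (gβ q * x) (gδ q * y) := by
  rw [mulCoproduct_β, opβ_tmul]

theorem mulCoproduct_γ_tmul (x y : F q) : mulCoproduct q (gγ q) (FT.tmul x y) =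
    FT.tmul (gγ q * x) (gα q * y) + FT.tmul (gδ q * x) (gγ q * y) := by
  rw [mulCoproduct_γ, opγ_tmul]

theorem mulCoproduct_δ_tmul (x y : F q) : mulCoproduct q (gδ q) (FT.tmul x y) =
    FT.tmul (gγ q * x) (gβ q * y) + FT.tmul (gδ q * x) (gδ q * y) := by
  rw [mulCoproduct_δ, opδ_tmul]

theorem mulCoproduct_μr_tmul (f : Mer) (x y : F q) :
    mulCoproduct q (μr q f) (FT.tmul x y) = FT.tmul x (μr q f * y) := by
  rw [mulCoproduct_μr, opR_tmul]

/-- The operator `x ⊗ t ↦ a x ⊗ Δ(b) t` on `F ⊗_M (F ⊗_M F)`, for `a ∈ F_{mk}`, `b ∈ F_{kn}`. -/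
def tensorOp (k : ℂ) (a b : F q) (ha : ∀ f, μr q f * a = a * μr q (shift k f))
    (hb : ∀ f, μl q f * b = b * μl q (shift k f)) : FT q (FT q (F q)) →+ FT q (FT q (F q)) :=
  semiOp k a (mulCoproduct q b).toAddMonoidHom ha fun f t => mulCoproduct_smul hb f t

theorem tensorOp_tmul (k : ℂ) (a b : F q) (ha : ∀ f, μr q f * a = a * μr q (shift k f))
    (hb : ∀ f, μl q f * b = b * μl q (shift k f)) (x : F q) (t : FT q (F q)) :
    tensorOp k a b ha hb (FT.tmul x t) = FT.tmul (a * x) (mulCoproduct q b t) := rfl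

theorem FT.tmulRight_apply {V : Type*} [AddCommGroup V] [Module Mer V] (v : V) (a : F q) :
    FT.tmulRight v a = FT.tmul a v := rfl

/-- Multiplication by `(Δ ⊗ id)Δ(a)` and by `(id ⊗ Δ)Δ(a)` is the same operator. -/
theorem coassoc_aux (a : F q) : ∃ O : FT q (FT q (F q)) →+ FT q (FT q (F q)), ∀ t,
    FT.coproductMap (mulCoproduct q a t) = O (FT.coproductMap t) ∧
    FT.map (coproduct q) (mulCoproduct q a t) = O (FT.map (coproduct q) t) := by
  have key (a : F q) (O : FT q (FT q (F q)) →+ FT q (FT q (F q)))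
      (h : ∀ x y, FT.coproductMap (mulCoproduct q a (FT.tmul x y)) =
          O (FT.coproductMap (FT.tmul x y)) ∧
        FT.map (coproduct q) (mulCoproduct q a (FT.tmul x y)) =
          O (FT.map (coproduct q) (FT.tmul x y))) :
      ∃ O : FT q (FT q (F q)) →+ FT q (FT q (F q)), ∀ t,
      FT.coproductMap (mulCoproduct q a t) = O (FT.coproductMap t) ∧
      FT.map (coproduct q) (mulCoproduct q a t) = O (FT.map (coproduct q) t) := by
    refine ⟨O, fun t => ?_⟩
    induction t using FT.induction with
    | zero => simp only [map_zero, and_self]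
    | tmul x y => exact h x y
    | add x y hx hy => simp only [map_add, hx.1, hx.2, hy.1, hy.2, and_self]
  induction a using F_induction with
  | hl f =>
    refine key _ (DistribSMul.toAddMonoidHom _ f) fun x y => ⟨?_, ?_⟩
    · rw [mulCoproduct_μl, opL_tmul, FT.coproductMap_tmul, FT.coproductMap_tmul, ← smul_def,
        map_smul, map_smul]
      rfl
    · rw [mulCoproduct_μl_apply, map_smul]
      rfl
  | hr f =>
    refine key _ (tensorOp 0 1 (μr q f) (fun g => by rw [shift_zero, mul_one, one_mul])
      fun g => by rw [shift_zero, μl_μr]) fun x y => ⟨?_, ?_⟩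
    · rw [mulCoproduct_μr_tmul, FT.coproductMap_tmul, FT.coproductMap_tmul]
      induction coproduct q x using FT.induction with
      | zero => simp only [map_zero]
      | tmul u v =>
        simp only [FT.map_tmul, FT.tmulRight_apply, tensorOp_tmul, one_mul, mulCoproduct_μr_tmul]
      | add u v hu hv => simp only [map_add, hu, hv]
    · rw [mulCoproduct_μr_tmul, FT.map_tmul, FT.map_tmul, tensorOp_tmul, coproduct_mul,
        one_mul]
  | hα =>
    refine key _ (tensorOp 1 (gα q) (gα q) μr_α μl_α +
      tensorOp (-1) (gβ q) (gγ q) μr_β μl_γ) fun x y => ⟨?_, ?_⟩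
    · rw [mulCoproduct_α_tmul, map_add, FT.coproductMap_tmul, FT.coproductMap_tmul,
        FT.coproductMap_tmul, coproduct_mul, coproduct_mul]
      induction coproduct q x using FT.induction with
      | zero => simp only [map_zero, add_zero]
      | tmul u v =>
        simp only [mulCoproduct_α_tmul, mulCoproduct_β_tmul, map_add, FT.map_tmul,
          AddMonoidHom.add_apply, tensorOp_tmul, FT.tmulRight_apply,
          mulCoproduct_α_tmul, mulCoproduct_γ_tmul, FT.tmul_add]
        abel
      | add u v hu hv => simp only [map_add, ← hu, ← hv]; abel
    · simp only [mulCoproduct_α_tmul, map_add, FT.map_tmul,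
        AddMonoidHom.add_apply, tensorOp_tmul, coproduct_mul]
  | hβ =>
    refine key _ (tensorOp 1 (gα q) (gβ q) μr_α μl_β +
      tensorOp (-1) (gβ q) (gδ q) μr_β μl_δ) fun x y => ⟨?_, ?_⟩
    · rw [mulCoproduct_β_tmul, map_add, FT.coproductMap_tmul, FT.coproductMap_tmul,
        FT.coproductMap_tmul, coproduct_mul, coproduct_mul]
      induction coproduct q x using FT.induction with
      | zero => simp only [map_zero, add_zero]
      | tmul u v =>
        simp only [mulCoproduct_α_tmul, mulCoproduct_β_tmul, map_add, FT.map_tmul,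
          AddMonoidHom.add_apply, tensorOp_tmul, FT.tmulRight_apply,
          mulCoproduct_β_tmul, mulCoproduct_δ_tmul, FT.tmul_add]
        abel
      | add u v hu hv => simp only [map_add, ← hu, ← hv]; abel
    · simp only [mulCoproduct_β_tmul, map_add, FT.map_tmul,
        AddMonoidHom.add_apply, tensorOp_tmul, coproduct_mul]
  | hγ =>
    refine key _ (tensorOp 1 (gγ q) (gα q) μr_γ μl_α +
      tensorOp (-1) (gδ q) (gγ q) μr_δ μl_γ) fun x y => ⟨?_, ?_⟩
    · rw [mulCoproduct_γ_tmul, map_add, FT.coproductMap_tmul, FT.coproductMap_tmul,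
        FT.coproductMap_tmul, coproduct_mul, coproduct_mul]
      induction coproduct q x using FT.induction with
      | zero => simp only [map_zero, add_zero]
      | tmul u v =>
        simp only [mulCoproduct_γ_tmul, mulCoproduct_δ_tmul, map_add, FT.map_tmul,
          AddMonoidHom.add_apply, tensorOp_tmul, FT.tmulRight_apply,
          mulCoproduct_α_tmul, mulCoproduct_γ_tmul, FT.tmul_add]
        abel
      | add u v hu hv => simp only [map_add, ← hu, ← hv]; abel
    · simp only [mulCoproduct_γ_tmul, map_add, FT.map_tmul,
        AddMonoidHom.add_apply, tensorOp_tmul, coproduct_mul]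
  | hδ =>
    refine key _ (tensorOp 1 (gγ q) (gβ q) μr_γ μl_β +
      tensorOp (-1) (gδ q) (gδ q) μr_δ μl_δ) fun x y => ⟨?_, ?_⟩
    · rw [mulCoproduct_δ_tmul, map_add, FT.coproductMap_tmul, FT.coproductMap_tmul,
        FT.coproductMap_tmul, coproduct_mul, coproduct_mul]
      induction coproduct q x using FT.induction with
      | zero => simp only [map_zero, add_zero]
      | tmul u v =>
        simp only [mulCoproduct_γ_tmul, mulCoproduct_δ_tmul, map_add, FT.map_tmul,
          AddMonoidHom.add_apply, tensorOp_tmul, FT.tmulRight_apply,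
          mulCoproduct_β_tmul, mulCoproduct_δ_tmul, FT.tmul_add]
        abel
      | add u v hu hv => simp only [map_add, ← hu, ← hv]; abel
    · simp only [mulCoproduct_δ_tmul, map_add, FT.map_tmul,
        AddMonoidHom.add_apply, tensorOp_tmul, coproduct_mul]
  | hmul a b ha hb =>
    obtain ⟨O, hO⟩ := ha
    obtain ⟨P, hP⟩ := hb
    refine ⟨O.comp P, fun t => ?_⟩
    simp only [map_mul, Module.End.mul_apply, (hO _).1, (hO _).2, (hP _).1, (hP _).2,
      AddMonoidHom.comp_apply, and_self]
  | hadd a b ha hb =>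
    obtain ⟨O, hO⟩ := ha
    obtain ⟨P, hP⟩ := hb
    refine ⟨O + P, fun t => ?_⟩
    simp only [map_add, LinearMap.add_apply, (hO _).1, (hO _).2, (hP _).1, (hP _).2,
      AddMonoidHom.add_apply, and_self]

theorem coproduct_coassoc (a : F q) :
    FT.coproductMap (coproduct q a) = FT.map (coproduct q) (coproduct q a) := by
  obtain ⟨O, hO⟩ := coassoc_aux a
  have h := hO (FT.tmul 1 1)
  change FT.coproductMap (mulCoproduct q a (FT.tmul 1 1)) =
    FT.map (coproduct q) (mulCoproduct q a (FT.tmul 1 1))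
  rw [h.1, h.2, FT.coproductMap_tmul, FT.map_tmul, coproduct_one]
  rfl

theorem mul_mem_regularGr {m n m' : ℂ} {a b : F q} (ha : HasBidegree q m n a)
    (hb : b ∈ regularGr q m') : a * b ∈ regularGr q (m + m') := by
  have h : (gradeHom q (AddMonoidHom.fst ℂ ℂ) b) = .single m' b := by
    induction hb using Submodule.span_induction with
    | mem x hx => obtain ⟨n, hx⟩ := hx; exact gradeHom_apply (AddMonoidHom.fst ℂ ℂ) hx
    | zero => simp
    | add x y _ _ hx hy => rw [map_add, hx, hy, AddMonoidAlgebra.single_add]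
    | smul f x _ hx =>
      rw [smul_def, map_mul, hx, gradeHom_apply _ (.left f), AddMonoidAlgebra.single_mul_single]
      simp
  have h2 : leftProj (m + m') (a * b) = a * b := by
    change (gradeHom q (AddMonoidHom.fst ℂ ℂ) (a * b)).coeff _ = _
    rw [map_mul, h, gradeHom_apply _ ha, AddMonoidAlgebra.single_mul_single]
    simp
  rw [← h2]
  exact leftProj_mem _ _

/-- Multiplication by `Δ(a)`, `a ∈ F_{mn}`, raises degrees by `m`. -/
theorem mulCoproduct_mem_grade {m n : ℂ} {a : F q} (ha : HasBidegree q m n a) :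
    ∀ (p : ℂ), ∀ t ∈ FT.grade (regularGr q) p,
      mulCoproduct q a t ∈ FT.grade (regularGr q) (m + p) := by
  have key {m k : ℂ} (a : F q) (hk : ∀ f, μl q f * a = a * μl q (shift k f))
      (h : ∀ (p n : ℂ) (x y : F q), HasBidegree q p n x → y ∈ regularGr q n →
        mulCoproduct q a (FT.tmul x y) ∈ FT.grade (regularGr q) (m + p)) (p : ℂ) :
      ∀ t ∈ FT.grade (regularGr q) p, mulCoproduct q a t ∈ FT.grade (regularGr q) (m + p) := by
    intro t ht
    induction ht using Submodule.span_induction with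
    | mem x hx => obtain ⟨n, x, y, hx, hy, rfl⟩ := hx; exact h p n x y hx hy
    | zero => rw [map_zero]; exact zero_mem _
    | add x y _ _ hx hy => rw [map_add]; exact add_mem hx hy
    | smul f x _ hx => rw [mulCoproduct_smul hk]; exact Submodule.smul_mem _ _ hx
  have mem {p n : ℂ} {x y : F q} (hx : HasBidegree q p n x) (hy : y ∈ regularGr q n) :
      FT.tmul x y ∈ FT.grade (regularGr q) p := Submodule.subset_span ⟨n, x, y, hx, hy, rfl⟩
  induction ha with
  | left f =>
    refine key (k := 0) _ (fun g => comm_zero_left g f) fun p n x y hx hy => ?_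
    rw [mulCoproduct_μl_apply, zero_add]
    exact Submodule.smul_mem _ _ (mem hx hy)
  | right f =>
    refine key (k := 0) _ (fun g => by rw [shift_zero, μl_μr]) fun p n x y hx hy => ?_
    rw [mulCoproduct_μr_tmul, zero_add]
    have := mul_mem_regularGr (.right f) hy
    rw [zero_add] at this
    exact mem hx this
  | α =>
    refine key _ μl_α fun p n x y hx hy => ?_
    rw [mulCoproduct_α_tmul]
    exact add_mem (mem (HasBidegree.α.mul hx) (mul_mem_regularGr .α hy))
      (mem (HasBidegree.β.mul hx) (mul_mem_regularGr .γ hy))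
  | β =>
    refine key _ μl_β fun p n x y hx hy => ?_
    rw [mulCoproduct_β_tmul]
    exact add_mem (mem (HasBidegree.α.mul hx) (mul_mem_regularGr .β hy))
      (mem (HasBidegree.β.mul hx) (mul_mem_regularGr .δ hy))
  | γ =>
    refine key _ μl_γ fun p n x y hx hy => ?_
    rw [mulCoproduct_γ_tmul]
    exact add_mem (mem (HasBidegree.γ.mul hx) (mul_mem_regularGr .α hy))
      (mem (HasBidegree.δ.mul hx) (mul_mem_regularGr .γ hy))
  | δ =>
    refine key _ μl_δ fun p n x y hx hy => ?_
    rw [mulCoproduct_δ_tmul]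
    exact add_mem (mem (HasBidegree.γ.mul hx) (mul_mem_regularGr .β hy))
      (mem (HasBidegree.δ.mul hx) (mul_mem_regularGr .δ hy))
  | mul ha hb iha ihb =>
    intro p t ht
    rw [map_mul, Module.End.mul_apply, add_assoc]
    exact iha _ _ (ihb _ _ ht)
  | zero m n => intro p t _; rw [map_zero]; exact zero_mem _
  | add ha hb iha ihb =>
    intro p t ht
    rw [map_add, LinearMap.add_apply]
    exact add_mem (iha _ _ ht) (ihb _ _ ht)

theorem hasBidegree_one : HasBidegree q 0 0 (1 : F q) := by
  simpa using HasBidegree.left (q := q) 1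

theorem coproduct_mem_grade {m : ℂ} {a : F q} (ha : a ∈ regularGr q m) :
    coproduct q a ∈ FT.grade (regularGr q) m := by
  induction ha using Submodule.span_induction with
  | mem x hx =>
    obtain ⟨n, hx⟩ := hx
    have h := mulCoproduct_mem_grade hx 0 (FT.tmul 1 1)
      (Submodule.subset_span ⟨0, 1, 1, hasBidegree_one, Submodule.subset_span ⟨0, hasBidegree_one⟩,
        rfl⟩)
    rwa [add_zero] at h
  | zero => rw [map_zero]; exact zero_mem _
  | add x y _ _ hx hy => rw [map_add]; exact add_mem hx hy
  | smul f x _ hx => rw [map_smul]; exact Submodule.smul_mem _ _ hx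

theorem regular_isCorep : (regular q).IsCorep where
  isInternal := (DirectSum.isInternal_submodule_iff_iSupIndep_and_iSup_eq_top _).2
    ⟨regularGr_iSupIndep, regularGr_iSup⟩
  map_gr _ _ h := coproduct_mem_grade h
  coassoc := coproduct_coassoc
  counit := coproduct_counit

end

noncomputable section

variable (q : Set.Ioo (0 : ℝ) 1)

/-! ### A representation on polynomials over `M ⊗ M` -/

/-- The polynomial ring `(M ⊗ M)[X]` on which `F_R(SL(2))` acts by difference operators; the
variable `X` is the value of a central element. -/
abbrev Model : Type := Polynomial (Mer ⊗[ℂ] Mer)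

/-- `f(λ)` in `(M ⊗ M)[X]`. -/
def lA : Mer →ₐ[ℂ] Model := Polynomial.CAlgHom.comp Algebra.TensorProduct.includeLeft

/-- `f(μ)` in `(M ⊗ M)[X]`. -/
def rA : Mer →ₐ[ℂ] Model := Polynomial.CAlgHom.comp Algebra.TensorProduct.includeRight

/-- The substitution `λ ↦ λ + a`, `μ ↦ μ + b` on `M ⊗ M`. -/
def tauR (a b : ℂ) : Mer ⊗[ℂ] Mer →ₐ[ℂ] Mer ⊗[ℂ] Mer :=
  Algebra.TensorProduct.map (shift a) (shift b)

/-- The substitution `λ ↦ λ + a`, `μ ↦ μ + b` on `(M ⊗ M)[X]`. -/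
def tau (a b : ℂ) : Model →ₐ[ℂ] Model := Polynomial.mapAlgHom (tauR a b)

theorem tau_lA (a b : ℂ) (f : Mer) : tau a b (lA f) = lA (shift a f) := by
  simp [tau, lA, tauR, Polynomial.CAlgHom]

theorem tau_rA (a b : ℂ) (f : Mer) : tau a b (rA f) = rA (shift b f) := by
  simp [tau, rA, tauR, Polynomial.CAlgHom]

theorem tau_X (a b : ℂ) : tau a b Polynomial.X = Polynomial.X := by
  simp [tau]

theorem tau_tau (a b a' b' : ℂ) (p : Model) :
    tau a b (tau a' b' p) = tau (a + a') (b + b') p := by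
  have h : (tauR a b).comp (tauR a' b') = tauR (a + a') (b + b') := by
    ext f <;> simp [tauR, shift_shift]
  rw [tau, tau, tau, ← h]
  exact Polynomial.map_map _ _ p

theorem tau_zero (p : Model) : tau 0 0 p = p := by
  have h : tauR 0 0 = AlgHom.id ℂ _ := by
    ext f <;> simp [tauR, shift_zero]
  rw [tau, h, Polynomial.mapAlgHom_id, AlgHom.id_apply]

/-- The element `-(q⁻¹ q^{μ-λ} + q q^{λ-μ})` of `M ⊗ M`. It is chosen such that in the representation
below `(q^{λ+2} - q^{-λ-2}) (q^μ - q^{-μ}) γβ` acts as `X - casimir`, with a central `X`. -/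
def casimir : Model :=
  -((qc q)⁻¹ • (lA (expM q)⁻¹ * rA (expM q)) + qc q • (lA (expM q) * rA (expM q)⁻¹))

theorem shift_expM_inv (n : ℤ) : shift n (expM q)⁻¹ = (qc q ^ (-n)) • (expM q)⁻¹ := by
  rw [map_inv₀, shift_expM, Algebra.smul_def, Algebra.smul_def, mul_inv, ← map_inv₀, zpow_neg]

theorem tau_casimir (a b : ℤ) : tau a b (casimir q) =
    -((qc q ^ (b - a - 1)) • (lA (expM q)⁻¹ * rA (expM q)) +
      (qc q ^ (a - b + 1)) • (lA (expM q) * rA (expM q)⁻¹)) := by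
  have h := q_ne_zero q
  simp only [casimir, map_neg, map_add, map_smul, map_mul, tau_lA, tau_rA, shift_expM,
    shift_expM_inv, smul_mul_smul_comm, smul_smul]
  congr 3
  · rw [← zpow_neg_one, ← zpow_add₀ h, ← zpow_add₀ h]; congr 1; ring
  · rw [← zpow_add₀ h, ← zpow_one_add₀ h]; congr 1; ring

theorem sn_eq_smul (n : ℤ) : sn q n = qc q ^ n • expM q - qc q ^ (-n) • (expM q)⁻¹ := by
  rw [sn, Algebra.smul_def, Algebra.smul_def, qM_zpow, qM_zpow]

theorem tau_casimir_same (a : ℤ) : tau a a (casimir q) = casimir q := by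
  rw [tau_casimir, casimir]
  simp

theorem tau_casimir_left : tau (-1) 1 (casimir q) =
    casimir q - lA (sn q 1) * rA (sn q 0) + lA (sn q 0) * rA (sn q 1) := by
  have h := q_ne_zero q
  have e := tau_casimir q (-1) 1
  rw [Int.cast_neg, Int.cast_one] at e
  rw [e]
  simp only [casimir, sn_eq_smul, map_sub, map_smul, sub_mul, mul_sub, smul_mul_smul_comm]
  match_scalars <;> norm_num

theorem tau_casimir_right : tau 1 (-1) (casimir q) =
    casimir q + lA (sn q 2) * rA (sn q (-1)) - lA (sn q 1) * rA (sn q 0) := by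
  have h := q_ne_zero q
  have e := tau_casimir q 1 (-1)
  rw [Int.cast_neg, Int.cast_one] at e
  rw [e]
  simp only [casimir, sn_eq_smul, map_sub, map_smul, sub_mul, mul_sub, smul_mul_smul_comm]
  match_scalars <;> norm_num <;> field_simp <;> ring

theorem lA_sn_mul_inv (n : ℤ) : lA (sn q n) * lA (sn q n)⁻¹ = 1 := by
  rw [← map_mul, mul_inv_cancel₀ (sn_ne_zero q n), map_one]

theorem rA_sn_mul_inv (n : ℤ) : rA (sn q n) * rA (sn q n)⁻¹ = 1 := by
  rw [← map_mul, mul_inv_cancel₀ (sn_ne_zero q n), map_one]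

/-- The difference operator `p ↦ c p(λ + a, μ + b)`. -/
def diffOp (c : Model) (a b : ℂ) : Module.End ℂ Model :=
  Algebra.lmul ℂ Model c * (tau a b).toLinearMap

theorem diffOp_apply (c : Model) (a b : ℂ) (p : Model) : diffOp c a b p = c * tau a b p := rfl

theorem diffOp_mul (c c' : Model) (a b a' b' : ℂ) :
    diffOp c a b * diffOp c' a' b' = diffOp (c * tau a b c') (a + a') (b + b') := by
  ext1 p
  simp only [Module.End.mul_apply, diffOp_apply, map_mul, tau_tau, mul_assoc]

theorem lmul_eq_diffOp (c : Model) : Algebra.lmul ℂ Model c = diffOp c 0 0 := by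
  ext1 p
  rw [diffOp_apply, tau_zero]
  rfl

theorem one_eq_diffOp : (1 : Module.End ℂ Model) = diffOp 1 0 0 := by
  rw [← lmul_eq_diffOp, map_one]

theorem diffOp_add (c c' : Model) (a b : ℂ) :
    diffOp c a b + diffOp c' a b = diffOp (c + c') a b := by
  ext1 p
  simp only [LinearMap.add_apply, diffOp_apply, add_mul]

theorem diffOp_sub (c c' : Model) (a b : ℂ) :
    diffOp c a b - diffOp c' a b = diffOp (c - c') a b := by
  ext1 p
  simp only [LinearMap.sub_apply, diffOp_apply, sub_mul]

theorem diffOp_congr {c c' : Model} {a b a' b' : ℂ} (hc : c = c') (ha : a = a') (hb : b = b') :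
    diffOp c a b = diffOp c' a' b' := by rw [hc, ha, hb]

theorem tau_casimir_one : tau 1 1 (casimir q) = casimir q := by
  simpa using tau_casimir_same q 1

theorem tau_casimir_neg_one : tau (-1) (-1) (casimir q) = casimir q := by
  simpa using tau_casimir_same q (-1)

/-- The action of `F_R(SL(2))` on `(M ⊗ M)[X]` by difference operators. -/
def modelData : LiftData q (Module.End ℂ Model) := by
  refine {
    L := (Algebra.lmul ℂ Model).comp lA
    R := (Algebra.lmul ℂ Model).comp rA
    a := diffOp 1 (-1) (-1)
    b := diffOp (rA (sn q 0)⁻¹) (-1) 1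
    c := diffOp ((Polynomial.X - casimir q) * lA (sn q 1)⁻¹) 1 (-1)
    d := diffOp (1 + (Polynomial.X - casimir q) * lA (sn q 1)⁻¹ * rA (sn q 0)⁻¹) 1 1
    LR := ?LR, La := ?La, Ra := ?Ra, Lb := ?Lb, Rb := ?Rb, Lc := ?Lc, Rc := ?Rc, Ld := ?Ld, Rd := ?Rd
    ab := ?ab, ac := ?ac, bd := ?bd, cd := ?cd, ad := ?ad, da := ?da, bc := ?bc }
  -- the two copies of `M`: both sides are difference operators with the same coefficient
  case LR | La | Ra | Lb | Rb | Lc | Rc | Ld | Rd =>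
    intros
    simp only [AlgHom.comp_apply, lmul_eq_diffOp, diffOp_mul, tau_zero, tau_lA, tau_rA, shift_shift]
    refine diffOp_congr ?_ (by ring) (by ring)
    norm_num [shift_zero]
    try ring
  -- the relations between the generators, as polynomial identities in `lA (sn q n)`, `rA (sn q n)`
  -- and their inverses
  case ab | ac | bd | cd | ad | da | bc =>
    simp only [AlgHom.comp_apply, lmul_eq_diffOp, one_eq_diffOp, diffOp_mul, tau_lA,
      tau_rA, map_mul, map_add, map_sub, map_one, map_inv₀, tau_X, tau_casimir_one,
      tau_casimir_neg_one, tau_casimir_left, tau_casimir_right, shift_one_sn, shift_neg_one_sn,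
      cA_eq, cB_eq, fK_eq_div, div_eq_mul_inv]
    norm_num [diffOp_add, diffOp_sub, shift_zero, tau_zero]
    have := lA_sn_mul_inv q 0
    have := lA_sn_mul_inv q 1
    have := lA_sn_mul_inv q 2
    have := lA_sn_mul_inv q (-1)
    have := rA_sn_mul_inv q 0
    have := rA_sn_mul_inv q 1
    have := rA_sn_mul_inv q (-1)
    refine diffOp_congr ?_ rfl rfl
    grind

/-- The representation of `F_R(SL(2))` by difference operators on `(M ⊗ M)[X]`. -/
def model : F q →ₐ[ℂ] Module.End ℂ Model := (modelData q).lift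

/-- The value at `1` of the difference operator attached to `a`; it is linear for the left
multiplications by `f(λ)` and `f(μ)`. -/
def symb : F q →ₗ[ℂ] Model where
  toFun a := model q a 1
  map_add' a b := by rw [map_add, LinearMap.add_apply]
  map_smul' z a := by rw [map_smul, LinearMap.smul_apply, RingHom.id_apply]

variable {q}

theorem symb_mul (a b : F q) : symb q (a * b) = model q a (symb q b) := by
  change model q (a * b) 1 = _
  rw [map_mul]
  rfl

theorem symb_one : symb q 1 = 1 := by
  change model q 1 1 = 1
  rw [map_one (model q), Module.End.one_apply]

theorem symb_μl_mul (f : Mer) (a : F q) : symb q (μl q f * a) = lA f * symb q a := by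
  rw [symb_mul, show model q (μl q f) = _ from LiftData.lift_proj (modelData q) (.l f)]
  rfl

theorem symb_μr_mul (f : Mer) (a : F q) : symb q (μr q f * a) = rA f * symb q a := by
  rw [symb_mul, show model q (μr q f) = _ from LiftData.lift_proj (modelData q) (.r f)]
  rfl

theorem symb_α_mul (a : F q) : symb q (gα q * a) = tau (-1) (-1) (symb q a) := by
  rw [symb_mul, show model q (gα q) = _ from LiftData.lift_proj (modelData q) .α]
  exact one_mul _

theorem symb_β_mul (a : F q) :
    symb q (gβ q * a) = rA (sn q 0)⁻¹ * tau (-1) 1 (symb q a) := by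
  rw [symb_mul, show model q (gβ q) = _ from LiftData.lift_proj (modelData q) .β]
  rfl

theorem symb_γ_mul (a : F q) : symb q (gγ q * a) =
    (Polynomial.X - casimir q) * lA (sn q 1)⁻¹ * tau 1 (-1) (symb q a) := by
  rw [symb_mul, show model q (gγ q) = _ from LiftData.lift_proj (modelData q) .γ]
  rfl

theorem symb_δ_mul (a : F q) : symb q (gδ q * a) =
    (1 + (Polynomial.X - casimir q) * lA (sn q 1)⁻¹ * rA (sn q 0)⁻¹) * tau 1 1 (symb q a) := by
  rw [symb_mul, show model q (gδ q) = _ from LiftData.lift_proj (modelData q) .δ]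
  rfl

theorem symb_moment_mul (x : Mer ⊗[ℂ] Mer) (a : F q) :
    symb q (moment q x * a) = Polynomial.C x * symb q a := by
  induction x using TensorProduct.induction_on with
  | zero => simp only [map_zero, zero_mul]
  | tmul f g =>
    have h : f ⊗ₜ[ℂ] g = (f ⊗ₜ 1) * (1 ⊗ₜ g) := by
      rw [Algebra.TensorProduct.tmul_mul_tmul, one_mul, mul_one]
    rw [moment_tmul, mul_assoc, symb_μl_mul, symb_μr_mul, h, Polynomial.C_mul, mul_assoc]
    rfl
  | add x y hx hy => simp only [map_add, add_mul, hx, hy]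

/-- The representation on `(M ⊗ M)[X]` recovers `x` from `moment q x`, as the value at `1`. -/
theorem moment_injective : Function.Injective (moment q) := by
  intro x y h
  have h1 (x : Mer ⊗[ℂ] Mer) : symb q (moment q x) = Polynomial.C x := by
    rw [← mul_one (moment q x), symb_moment_mul, symb_one, mul_one]
  apply Polynomial.C_injective
  rw [← h1, ← h1, h]

end

noncomputable section

variable (q : Set.Ioo (0 : ℝ) 1)

/-! ### Leading coefficients in the model -/

/-- The polynomial `p` has degree at most `n` and `n`-th coefficient `c`. -/
def HasLead (n : ℕ) (c : Mer ⊗[ℂ] Mer) (p : Model) : Prop := p.natDegree ≤ n ∧ p.coeff n = c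

theorem exists_casimir_eq_C : ∃ c, casimir q = Polynomial.C c := by
  refine ⟨-((qc q)⁻¹ • ((expM q)⁻¹ ⊗ₜ 1 * 1 ⊗ₜ expM q) + qc q • (expM q ⊗ₜ 1 * 1 ⊗ₜ (expM q)⁻¹)), ?_⟩
  rw [Polynomial.C_neg, Polynomial.C_add, ← Polynomial.smul_C, ← Polynomial.smul_C, Polynomial.C_mul,
    Polynomial.C_mul]
  rfl

variable {q}

theorem HasLead.X_sub_mul {n : ℕ} {c : Mer ⊗[ℂ] Mer} {p : Model} (h : HasLead n c p) :
    HasLead (n + 1) c ((Polynomial.X - casimir q) * p) := by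
  obtain ⟨c0, hc0⟩ := exists_casimir_eq_C q
  rw [hc0]
  refine ⟨?_, ?_⟩
  · refine Polynomial.natDegree_mul_le.trans ?_
    have := Polynomial.natDegree_X_sub_C_le c0
    have := h.1
    omega
  · rw [sub_mul, Polynomial.coeff_sub, Polynomial.coeff_X_mul, Polynomial.coeff_C_mul,
      Polynomial.coeff_eq_zero_of_natDegree_lt (n := n + 1) (Nat.lt_succ_of_le h.1), mul_zero,
      sub_zero, h.2]

theorem HasLead.C_mul {n : ℕ} {c : Mer ⊗[ℂ] Mer} {p : Model} (h : HasLead n c p)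
    (d : Mer ⊗[ℂ] Mer) : HasLead n (d * c) (Polynomial.C d * p) :=
  ⟨(Polynomial.natDegree_C_mul_le d p).trans h.1, by rw [Polynomial.coeff_C_mul, h.2]⟩

theorem HasLead.lA_mul {n : ℕ} {f g : Mer} {p : Model} (h : HasLead n (f ⊗ₜ g) p) (u : Mer) :
    HasLead n ((u * f) ⊗ₜ g) (lA u * p) := by
  have h1 := h.C_mul (u ⊗ₜ 1)
  rwa [Algebra.TensorProduct.tmul_mul_tmul, one_mul] at h1

theorem HasLead.rA_mul {n : ℕ} {f g : Mer} {p : Model} (h : HasLead n (f ⊗ₜ g) p) (u : Mer) :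
    HasLead n (f ⊗ₜ (u * g)) (rA u * p) := by
  have h1 := h.C_mul (1 ⊗ₜ u)
  rwa [Algebra.TensorProduct.tmul_mul_tmul, one_mul] at h1

theorem HasLead.tau {n : ℕ} {f g : Mer} {p : Model} (h : HasLead n (f ⊗ₜ g) p) (a b : ℂ) :
    HasLead n (shift a f ⊗ₜ shift b g) (tau a b p) := by
  refine ⟨(Polynomial.natDegree_map_le (f := (tauR a b).toRingHom)).trans h.1, ?_⟩
  change (Polynomial.map _ p).coeff n = _
  rw [Polynomial.coeff_map, h.2]
  rfl

theorem HasLead.add {n : ℕ} {f g g' : Mer} {p p' : Model} (h : HasLead n (f ⊗ₜ g) p)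
    (h' : HasLead n (f ⊗ₜ g') p') : HasLead n (f ⊗ₜ (g + g')) (p + p') :=
  ⟨Polynomial.natDegree_add_le_of_degree_le h.1 h'.1, by
    rw [Polynomial.coeff_add, h.2, h'.2, TensorProduct.tmul_add]⟩

theorem HasLead.zero (n : ℕ) (f : Mer) : HasLead n (f ⊗ₜ 0) 0 := by
  simp [HasLead]

theorem HasLead.symb_α {n : ℕ} {f g : Mer} {a : F q} (h : HasLead n (f ⊗ₜ g) (symb q a)) :
    HasLead n (shift (-1) f ⊗ₜ shift (-1) g) (symb q (gα q * a)) := by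
  rw [symb_α_mul]
  exact h.tau _ _

theorem HasLead.symb_β {n : ℕ} {f g : Mer} {a : F q} (h : HasLead n (f ⊗ₜ g) (symb q a)) :
    HasLead n (shift (-1) f ⊗ₜ ((sn q 0)⁻¹ * shift 1 g)) (symb q (gβ q * a)) := by
  rw [symb_β_mul]
  exact (h.tau _ _).rA_mul _

theorem HasLead.symb_γ {n : ℕ} {f g : Mer} {a : F q} (h : HasLead n (f ⊗ₜ g) (symb q a)) :
    HasLead (n + 1) (((sn q 1)⁻¹ * shift 1 f) ⊗ₜ shift (-1) g) (symb q (gγ q * a)) := by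
  rw [symb_γ_mul, mul_assoc]
  exact ((h.tau _ _).lA_mul _).X_sub_mul

theorem HasLead.symb_δ {n : ℕ} {f g : Mer} {a : F q} (h : HasLead n (f ⊗ₜ g) (symb q a)) :
    HasLead (n + 1) (((sn q 1)⁻¹ * shift 1 f) ⊗ₜ ((sn q 0)⁻¹ * shift 1 g)) (symb q (gδ q * a)) := by
  rw [symb_δ_mul, add_mul, one_mul, mul_assoc, mul_assoc]
  have h1 := (((h.tau 1 1).rA_mul (sn q 0)⁻¹).lA_mul (sn q 1)⁻¹).X_sub_mul (q := q)
  have h2 := h.tau 1 1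
  refine ⟨?_, ?_⟩
  · exact Polynomial.natDegree_add_le_of_degree_le (h2.1.trans (Nat.le_succ n)) h1.1
  · rw [Polynomial.coeff_add, h1.2, Polynomial.coeff_eq_zero_of_natDegree_lt
      (n := n + 1) (Nat.lt_succ_of_le h2.1), zero_add]

theorem HasLead.symb_one : HasLead 0 (1 ⊗ₜ 1) (symb q 1) := by
  rw [DynSL2.symb_one]
  refine ⟨by simp, ?_⟩
  rw [Polynomial.coeff_one_zero]
  rfl

theorem isUnit_tmul {f g : Mer} (hf : f ≠ 0) (hg : g ≠ 0) :
    IsUnit (f ⊗ₜ g : Mer ⊗[ℂ] Mer) := by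
  refine IsUnit.of_mul_eq_one (f⁻¹ ⊗ₜ g⁻¹) ?_
  rw [Algebra.TensorProduct.tmul_mul_tmul, mul_inv_cancel₀ hf, mul_inv_cancel₀ hg]
  rfl

instance : Nontrivial (Mer ⊗[ℂ] Mer) :=
  (Algebra.TensorProduct.includeLeft_injective (R := ℂ) (S := ℂ) (A := Mer) (B := Mer)
    (algebraMap ℂ Mer).injective).nontrivial

variable (q)

/-- The `λ`-part of the leading coefficients: the inverse of `∏_{i=1}^n (q^{λ+i+1} - q^{-λ-i-1})`. -/
def lam : ℕ → Mer
  | 0 => 1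
  | n + 1 => (sn q 1)⁻¹ * shift 1 (lam n)

theorem lam_ne_zero (n : ℕ) : lam q n ≠ 0 := by
  induction n with
  | zero => exact one_ne_zero
  | succ n ih => exact mul_ne_zero (inv_ne_zero (sn_ne_zero q 1)) ((map_ne_zero _).2 ih)

/-! ### The basis of `V_N` -/

variable {q}

/-- The symbol of `γ^m α^k` is nonzero of degree `m`; this detects that the monomials are nonzero. -/
theorem hasLead_γα (m k : ℕ) : ∃ g : Mer, g ≠ 0 ∧
    HasLead m (lam q m ⊗ₜ g) (symb q (gγ q ^ m * gα q ^ k)) := by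
  induction m with
  | zero =>
    refine ⟨1, one_ne_zero, ?_⟩
    rw [pow_zero, one_mul]
    induction k with
    | zero => rw [pow_zero]; exact HasLead.symb_one
    | succ k ih =>
      rw [pow_succ']
      have := ih.symb_α
      rw [map_one] at this
      rwa [show lam q 0 = 1 from rfl, map_one] at this
  | succ m ih =>
    obtain ⟨g, hg, h⟩ := ih
    refine ⟨shift (-1) g, (map_ne_zero _).2 hg, ?_⟩
    rw [pow_succ', mul_assoc]
    exact h.symb_γ

theorem smul_γα_eq_zero {m k : ℕ} {f : Mer} (h : f • (gγ q ^ m * gα q ^ k) = 0) : f = 0 := by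
  by_contra hf
  obtain ⟨g, hg, hl⟩ := hasLead_γα (q := q) m k
  have h1 := hl.lA_mul f
  rw [← symb_μl_mul, ← smul_def, h, map_zero] at h1
  have h2 := isUnit_tmul (mul_ne_zero hf (lam_ne_zero q m)) hg
  rw [← h1.2, Polynomial.coeff_zero] at h2
  exact not_isUnit_zero h2

theorem HasBidegree.pow {m n : ℂ} {a : F q} (h : HasBidegree q m n a) (k : ℕ) :
    HasBidegree q (k * m) (k * n) (a ^ k) := by
  induction k with
  | zero => simpa using hasBidegree_one
  | succ k ih =>
    rw [pow_succ]
    have := ih.mul h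
    rwa [show (k : ℂ) * m + m = ((k + 1 : ℕ) : ℂ) * m by push_cast; ring,
      show (k : ℂ) * n + n = ((k + 1 : ℕ) : ℂ) * n by push_cast; ring] at this

theorem hasBidegree_vecF (N : ℕ) (k : Fin (N + 1)) :
    HasBidegree q (2 * (k : ℕ) - N) N (vecF q N k) := by
  have h := (HasBidegree.γ.pow (q := q) (N - k)).mul (HasBidegree.α.pow (q := q) k)
  have hk : (k : ℕ) ≤ N := Nat.lt_succ_iff.1 k.2
  rw [Nat.cast_sub hk] at h
  rw [vecF]
  convert h using 1 <;> ring

theorem vecF_mem_regularGr (N : ℕ) (k : Fin (N + 1)) :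
    vecF q N k ∈ regularGr q (2 * (k : ℕ) - N) :=
  Submodule.subset_span ⟨_, hasBidegree_vecF N k⟩

theorem vec_degree_injective (N : ℕ) {j k : ℕ} (h : (2 * j - N : ℂ) = 2 * k - N) : j = k := by
  have h1 : (j : ℂ) = k := by linear_combination h / 2
  exact_mod_cast h1

theorem leftProj_sum_vecF (N : ℕ) (f : Fin (N + 1) → Mer) (k : Fin (N + 1)) :
    leftProj (2 * (k : ℕ) - N) (∑ j, f j • vecF q N j) = f k • vecF q N k := by
  rw [map_sum, Finset.sum_eq_single k]
  · rw [map_smul, leftProj_same (vecF_mem_regularGr N k)]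
  · intro j _ hj
    rw [map_smul, leftProj_ne (vecF_mem_regularGr N j), smul_zero]
    intro h
    exact hj (Fin.ext (vec_degree_injective N h))
  · simp

theorem linearIndependent_vecF (N : ℕ) : LinearIndependent Mer (vecF q N) := by
  rw [Fintype.linearIndependent_iff]
  intro f hf k
  have h := leftProj_sum_vecF (q := q) N f k
  rw [hf, map_zero] at h
  exact smul_γα_eq_zero h.symm

variable (q)

/-- The basis `γ^{N-k} α^k` of `V_N`. -/
def vecBasis (N : ℕ) : Module.Basis (Fin (N + 1)) Mer (VN q N) :=
  Module.Basis.span (linearIndependent_vecF N)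

theorem vecBasis_apply (N : ℕ) (k : Fin (N + 1)) : vecBasis q N k = vec q N k :=
  Module.Basis.span_apply (linearIndependent_vecF N) k

end

noncomputable section

/-! ### Coordinates in `F ⊗_M V` -/

section contract

variable {q : Set.Ioo (0 : ℝ) 1}
variable {V : Type*} [AddCommGroup V] [Module Mer V]

/-- The map `a ⊗ v ↦ φ(v)(μ) a`, for a linear form `φ` on `V`; it is linear for the left
`M`-structures. -/
def FT.contract (φ : V →ₗ[Mer] Mer) : FT q V →ₗ[Mer] F q :=
  let c : FT q V →+ F q := FT.lift
    { toFun := fun a =>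
        { toFun := fun v => μr q (φ v) * a
          map_zero' := by rw [map_zero, map_zero, zero_mul]
          map_add' := fun v w => by rw [map_add, map_add, add_mul] }
      map_zero' := by ext v; exact mul_zero (μr q (φ v))
      map_add' := fun a b => by ext v; exact mul_add (μr q (φ v)) a b }
    (by
      intro g a v
      change μr q (φ v) * (μr q g * a) = μr q (φ (g • v)) * a
      rw [map_smul, smul_eq_mul, mul_comm, map_mul, mul_assoc])
  { toFun := c
    map_add' := c.map_add
    map_smul' := fun f t => by
      induction t using FT.induction with
      | zero => rw [smul_zero, map_zero, smul_zero]
      | tmul a v =>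
        change μr q (φ v) * (μl q f * a) = μl q f * (μr q (φ v) * a)
        rw [← mul_assoc, ← μl_μr, mul_assoc]
      | add x y hx hy => rw [smul_add, map_add, map_add, smul_add, hx, hy] }

theorem FT.contract_tmul (φ : V →ₗ[Mer] Mer) (a : F q) (v : V) :
    FT.contract φ (FT.tmul a v) = μr q (φ v) * a := rfl

variable {ι : Type*} [Fintype ι] (b : Module.Basis ι Mer V)

theorem FT.tmul_sum {κ : Type*} (s : Finset κ) (a : F q) (v : κ → V) :
    FT.tmul a (∑ i ∈ s, v i) = ∑ i ∈ s, FT.tmul a (v i) :=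
  TensorProduct.tmul_sum (M := FR q) a s v

theorem FT.sum_contract (x : FT q V) : ∑ i, FT.tmul (FT.contract (b.coord i) x) (b i) = x := by
  induction x using FT.induction with
  | zero => simp only [map_zero, FT.zero_tmul, Finset.sum_const_zero]
  | tmul a v =>
    simp only [FT.contract_tmul, ← FT.tmul_smul]
    rw [← FT.tmul_sum]
    congr 1
    exact b.sum_repr v
  | add x y hx hy => simp only [map_add, FT.add_tmul, Finset.sum_add_distrib, hx, hy]

theorem FT.contract_sum [DecidableEq ι] (a : ι → F q) (i : ι) :
    FT.contract (b.coord i) (∑ j, FT.tmul (a j) (b j)) = a i := by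
  rw [map_sum, Finset.sum_eq_single i]
  · rw [FT.contract_tmul, b.coord_apply, b.repr_self, Finsupp.single_eq_same, map_one, one_mul]
  · intro j _ hj
    rw [FT.contract_tmul, b.coord_apply, b.repr_self, Finsupp.single_eq_of_ne hj.symm, map_zero,
      zero_mul]
  · simp

end contract

/-! ### Matrix elements -/

variable (q : Set.Ioo (0 : ℝ) 1)

/-- The matrix elements of `V_N` in the basis `γ^{N-k} α^k`. -/
def matElem (N : ℕ) (k j : Fin (N + 1)) : F q :=
  FT.contract ((vecBasis q N).coord j) ((corepV q N).toFun (vec q N k))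

theorem isMatrixElements_matElem : IsMatrixElements q (matElem q) := by
  intro N k
  have h := FT.sum_contract (vecBasis q N) ((corepV q N).toFun (vec q N k))
  simp only [vecBasis_apply] at h
  exact h.symm

variable {q}

theorem sum_vec_injective {N : ℕ} {x y : Fin (N + 1) → F q}
    (h : ∑ j, FT.tmul (x j) (vec q N j) = ∑ j, FT.tmul (y j) (vec q N j)) : x = y := by
  funext j
  simp only [← vecBasis_apply] at h
  rw [← FT.contract_sum (vecBasis q N) x j, h, FT.contract_sum]

theorem isMatrixElements_iff (t : (N : ℕ) → Fin (N + 1) → Fin (N + 1) → F q) :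
    IsMatrixElements q t ↔ t = matElem q := by
  refine ⟨fun h => ?_, fun h => h ▸ isMatrixElements_matElem q⟩
  funext N k
  exact sum_vec_injective ((h N k).symm.trans (isMatrixElements_matElem q N k))

theorem sum_vecF_injective {N : ℕ} {x y : Fin (N + 1) → F q}
    (h : ∑ j, FT.tmul (x j) (vecF q N j) = ∑ j, FT.tmul (y j) (vecF q N j)) : x = y := by
  apply sum_vec_injective
  apply FT.map_injective (VN q N).subtype (VN q N).injective_subtype
  rw [map_sum, map_sum]
  exact h

theorem coproduct_vecF (N : ℕ) (k : Fin (N + 1)) :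
    coproduct q (vecF q N k) = ∑ j, FT.tmul (matElem q N k j) (vecF q N j) := by
  have h := subCoaction_spec (VN q N) (coproduct_mem N) (vec q N k)
  refine h.symm.trans ?_
  change FT.map (VN q N).subtype ((corepV q N).toFun (vec q N k)) = _
  rw [isMatrixElements_matElem, map_sum]
  rfl

/-- Extension by zero of a vector indexed by `0, …, N` to all integers; it spares the recursions below
the boundary cases. -/
def extZ {N : ℕ} (x : Fin (N + 1) → F q) (j : ℤ) : F q :=
  if h : 0 ≤ j ∧ j ≤ N then x ⟨j.toNat, by omega⟩ else 0

theorem extZ_coe {N : ℕ} (x : Fin (N + 1) → F q) (j : Fin (N + 1)) : extZ x (j : ℕ) = x j := by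
  rw [extZ, dif_pos (by omega)]
  congr 1

theorem extZ_neg {N : ℕ} (x : Fin (N + 1) → F q) {j : ℤ} (h : j < 0) : extZ x j = 0 :=
  dif_neg (by omega)

theorem extZ_gt {N : ℕ} (x : Fin (N + 1) → F q) {j : ℤ} (h : (N : ℤ) < j) : extZ x j = 0 :=
  dif_neg (by omega)

/-- The raising operator attached to `(a, b) = (α, β)` or `(γ, δ)`: the coordinates of
`(a ⊗ α + b ⊗ γ) ∑_j x_j ⊗ γ^{N-j} α^j`. -/
def raise (a b : F q) (N : ℤ) (x : ℤ → F q) (j : ℤ) : F q :=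
  μr q (sn q (N + 1 - j) / sn q 0) * (a * x (j - 1)) + b * x j

theorem α_mul_γ_pow (m : ℕ) (x : F q) :
    gα q * (gγ q ^ m * x) = μl q (sn q m / sn q 0) * (gγ q ^ m * (gα q * x)) := by
  induction m generalizing x with
  | zero => simp [sn_ne_zero]
  | succ m ih =>
    have h : gγ q * μl q (sn q m / sn q 0) = μl q (sn q (m + 1) / sn q 1) * gγ q := by
      rw [μl_γ, map_div₀ (shift (-1)), shift_neg_one_sn, shift_neg_one_sn]
      simp
    have e : cA q * (sn q (m + 1) / sn q 1) = sn q ((m + 1 : ℕ) : ℤ) / sn q 0 := by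
      have h0 := sn_ne_zero q 0
      have h1 := sn_ne_zero q 1
      rw [cA_eq]
      push_cast
      field_simp
    rw [pow_succ', mul_assoc, αγ_x, ih, ← mul_assoc (gγ q), h, mul_assoc, ← mul_assoc (μl q _),
      ← map_mul, e, mul_assoc]

theorem α_mul_vecF (N : ℕ) (j : Fin (N + 1)) :
    gα q * vecF q N j = μl q (sn q (N - (j : ℕ)) / sn q 0) * vecF q (N + 1) j.succ := by
  rw [vecF, α_mul_γ_pow, vecF, Fin.val_succ, pow_succ', Nat.add_sub_add_right,
    Nat.cast_sub (Nat.lt_succ_iff.1 j.2)]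

theorem γ_mul_vecF (N : ℕ) (j : Fin (N + 1)) :
    gγ q * vecF q N j = vecF q (N + 1) j.castSucc := by
  rw [vecF, vecF, Fin.val_castSucc, ← mul_assoc, ← pow_succ']
  congr 2
  omega

/-- The operator `a ⊗ α + b ⊗ γ` maps `F ⊗_M V_N` to `F ⊗_M V_{N+1}`, with coordinates `raise`. -/
theorem raise_sum (a b : F q) (N : ℕ) (x : Fin (N + 1) → F q) :
    ∑ j, (FT.tmul (a * x j) (gα q * vecF q N j) + FT.tmul (b * x j) (gγ q * vecF q N j)) =
      ∑ j : Fin (N + 1 + 1), FT.tmul (raise a b N (extZ x) (j : ℕ)) (vecF q (N + 1) j) := by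
  have h (j : Fin (N + 1 + 1)) :
      FT.tmul (raise a b N (extZ x) (j : ℕ)) (vecF q (N + 1) j) =
        FT.tmul (μr q (sn q (N + 1 - (j : ℕ)) / sn q 0) * (a * extZ x ((j : ℕ) - 1)))
          (vecF q (N + 1) j) + FT.tmul (b * extZ x (j : ℕ)) (vecF q (N + 1) j) := FT.add_tmul _ _ _
  simp only [h, Finset.sum_add_distrib]
  congr 1
  · rw [Fin.sum_univ_succ (n := N + 1), extZ_neg x (by simp), mul_zero, mul_zero, FT.zero_tmul, zero_add]
    refine Finset.sum_congr rfl fun j _ => ?_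
    rw [α_mul_vecF, ← tmul_mid]
    congr 3
    · rw [Fin.val_succ]
      congr 2
      push_cast
      ring
    · rw [← extZ_coe x j, Fin.val_succ]
      congr 2
      push_cast
      ring
  · rw [Fin.sum_univ_castSucc (n := N + 1), extZ_gt x (by simp), mul_zero, FT.zero_tmul, add_zero]
    refine Finset.sum_congr rfl fun j _ => ?_
    rw [γ_mul_vecF, Fin.val_castSucc, extZ_coe]

theorem raise_extZ_eq {N : ℕ} (a b : F q) (x : Fin (N + 1) → F q) (y : Fin (N + 1 + 1) → F q)
    (h : ∑ j, FT.tmul (y j) (vecF q (N + 1) j) =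
      ∑ j, (FT.tmul (a * x j) (gα q * vecF q N j) + FT.tmul (b * x j) (gγ q * vecF q N j))) (j : ℤ) :
    extZ y j = raise a b N (extZ x) j := by
  rw [raise_sum] at h
  have h1 := sum_vecF_injective h
  by_cases hj : 0 ≤ j ∧ j ≤ (N + 1 : ℕ)
  · obtain ⟨hj0, hj1⟩ := hj
    obtain ⟨i, rfl⟩ : ∃ i : Fin (N + 1 + 1), j = ((i : ℕ) : ℤ) :=
      ⟨⟨j.toNat, by omega⟩, by simp [hj0]⟩
    rw [extZ_coe, h1]
  · have e : extZ y j = 0 := dif_neg hj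
    rw [e, raise, extZ, dif_neg (by omega), extZ, dif_neg (by omega)]
    simp

variable (q)

/-- The row `j ↦ t^N_{kj}`, extended by zero to all integers `j`; it is zero for `k > N`. -/
def matZ (N k : ℕ) : ℤ → F q :=
  if h : k < N + 1 then extZ (matElem q N ⟨k, h⟩) else 0

variable {q}

theorem matZ_of_le {N k : ℕ} (h : k ≤ N) :
    matZ q N k = extZ (matElem q N ⟨k, Nat.lt_succ_of_le h⟩) := dif_pos _

theorem matZ_coe {N : ℕ} (k j : Fin (N + 1)) : matZ q N k (j : ℕ) = matElem q N k j := by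
  rw [matZ_of_le (Nat.lt_succ_iff.1 k.2), extZ_coe]

theorem matZ_neg (N k : ℕ) {j : ℤ} (h : j < 0) : matZ q N k j = 0 := by
  rw [matZ]
  split_ifs
  · exact extZ_neg _ h
  · rfl

theorem matZ_gt (N k : ℕ) {j : ℤ} (h : (N : ℤ) < j) : matZ q N k j = 0 := by
  rw [matZ]
  split_ifs
  · exact extZ_gt _ h
  · rfl

/-- First recursion, from `Δ(γ γ^{N-k} α^k)`. -/
theorem matZ_raise_γδ {N k : ℕ} (h : k ≤ N) (j : ℤ) :
    matZ q (N + 1) k j = raise (gγ q) (gδ q) N (matZ q N k) j := by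
  rw [matZ_of_le h, matZ_of_le (h.trans (Nat.le_succ N))]
  apply raise_extZ_eq
  have h1 := coproduct_vecF (q := q) (N + 1) ⟨k, by omega⟩
  rw [← h1, show (⟨k, by omega⟩ : Fin (N + 1 + 1)) = (⟨k, by omega⟩ : Fin (N + 1)).castSucc from rfl,
    ← γ_mul_vecF, coproduct_mul, coproduct_vecF, map_sum]
  simp only [mulCoproduct_γ_tmul]

/-- Second recursion, from `Δ(α γ^{N-k} α^k)`. -/
theorem matZ_raise_αβ {N k : ℕ} (h : k ≤ N) (j : ℤ) :
    μl q (sn q (N - k) / sn q 0) * matZ q (N + 1) (k + 1) j =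
      raise (gα q) (gβ q) N (matZ q N k) j := by
  rw [matZ_of_le h, matZ_of_le (Nat.succ_le_succ h)]
  rw [← raise_extZ_eq (gα q) (gβ q) _
    (fun j => μl q (sn q (N - k) / sn q 0) * matElem q (N + 1) ⟨k + 1, by omega⟩ j)]
  · rw [extZ, extZ]
    split_ifs
    · rfl
    · rw [mul_zero]
  · have h1 := coproduct_vecF (q := q) (N + 1) ⟨k + 1, by omega⟩
    have h2 := α_mul_vecF (q := q) N ⟨k, by omega⟩
    have h3 := congrArg (coproduct q) h2
    rw [← smul_def, map_smul, coproduct_mul, coproduct_vecF, map_sum,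
      show Fin.succ (⟨k, by omega⟩ : Fin (N + 1)) = ⟨k + 1, by omega⟩ from rfl, h1,
      Finset.smul_sum] at h3
    simp only [mulCoproduct_α_tmul] at h3
    exact h3.symm

theorem matZ_zero (j : ℤ) : matZ q 0 0 j = if j = 0 then 1 else 0 := by
  split_ifs with h
  · subst h
    have h1 := matZ_coe (q := q) (N := 0) 0 0
    have h2 := coproduct_vecF (q := q) 0 0
    have h3 : vecF q 0 0 = 1 := by simp [vecF]
    have h4 : (fun _ : Fin (0 + 1) => (1 : F q)) = matElem q 0 0 := by
      apply sum_vecF_injective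
      rw [← h2, h3, coproduct_one]
      simp [h3]
    refine h1.trans ?_
    rw [← h4]
  · rcases lt_or_gt_of_ne h with h | h
    · exact matZ_neg _ _ h
    · exact matZ_gt _ _ (by simpa using h)

theorem matZ_top (N : ℕ) (j : ℤ) :
    matZ q (N + 1) (N + 1) j = raise (gα q) (gβ q) N (matZ q N N) j := by
  rw [← matZ_raise_αβ le_rfl, sub_self, div_self (sn_ne_zero q 0), map_one, one_mul]

/-- Induction on the matrix elements: along the two recursions. -/
theorem matZ_induction {p : ℕ → ℕ → (ℤ → F q) → Prop}
    (zero : p 0 0 (matZ q 0 0))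
    (top : ∀ N, p N N (matZ q N N) → p (N + 1) (N + 1) (raise (gα q) (gβ q) N (matZ q N N)))
    (step : ∀ N k, k ≤ N → p N k (matZ q N k) →
      p (N + 1) k (raise (gγ q) (gδ q) N (matZ q N k))) :
    ∀ N k, k ≤ N → p N k (matZ q N k) := by
  intro N
  induction N with
  | zero =>
    intro k hk
    obtain rfl : k = 0 := by omega
    exact zero
  | succ N ih =>
    intro k hk
    rcases Nat.lt_or_ge k (N + 1) with h | h
    · rw [funext (matZ_raise_γδ (q := q) (Nat.lt_succ_iff.1 h))]
      exact step N k (Nat.lt_succ_iff.1 h) (ih k (Nat.lt_succ_iff.1 h))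
    · obtain rfl : k = N + 1 := le_antisymm hk h
      rw [funext (matZ_top (q := q) N)]
      exact top N (ih N le_rfl)

theorem HasBidegree.raise {a b : F q} {m m' : ℂ} {N : ℕ} {x : ℤ → F q}
    (ha : HasBidegree q m 1 a) (hb : HasBidegree q m (-1) b)
    (hx : ∀ j : ℤ, HasBidegree q m' (2 * j - N) (x j)) (j : ℤ) :
    HasBidegree q (m + m') (2 * j - (N + 1 : ℕ)) (raise a b N x j) := by
  have h1 := (HasBidegree.right (sn q (N + 1 - j) / sn q 0)).mul (ha.mul (hx (j - 1)))
  have h2 := hb.mul (hx j)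
  rw [zero_add] at h1
  refine .add ?_ ?_
  · convert h1 using 1
    push_cast
    ring
  · convert h2 using 1
    push_cast
    ring

theorem hasBidegree_matZ (N k : ℕ) (hk : k ≤ N) :
    ∀ j : ℤ, HasBidegree q (2 * k - N) (2 * j - N) (matZ q N k j) := by
  refine matZ_induction (p := fun N k x => ∀ j : ℤ, HasBidegree q (2 * k - N) (2 * j - N) (x j))
    ?_ ?_ ?_ N k hk
  · intro j
    rw [matZ_zero]
    split_ifs with h
    · subst h
      simpa using hasBidegree_one
    · exact .zero _ _
  · intro N h j
    have := HasBidegree.α.raise .β h j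
    convert this using 1
    push_cast
    ring
  · intro N k _ h j
    have := HasBidegree.γ.raise .δ h j
    convert this using 1
    push_cast
    ring

end

noncomputable section

variable {q : Set.Ioo (0 : ℝ) 1}

/-! ### Lowering operators -/

/-- The lowering operator attached to `(a, b) = (α, β)` or `(γ, δ)`, mapping rows indexed by
`0, …, N` to rows indexed by `0, …, N - 1`. Its coefficients are chosen such that it commutes with
`raise a b` (`lower_raise_same`) and that `a x_{j-1}` and `b x_j` are combinations of the raised and
the lowered row. -/
def lower (a b : F q) (N : ℤ) (x : ℤ → F q) (i : ℤ) : F q :=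
  μr q (nu q (i + 1)) * (b * x (i + 1)) - μr q (nu q (N - i) * sn q (-i - 1) / sn q 0) * (a * x i)

/-- The identity of `lower_raise_same` in terms of `P = b a x_i`, `Q = b b x_{i+1}`,
`S = a a x_{i-1}`. -/
theorem lower_raise_aux {V : Type*} [AddCommGroup V] [Module Mer V] (N i : ℤ) (P Q S : V) :
    nu q (i + 1) • ((sn q (N + 1 - i) / sn q 1) • P + Q) -
      (nu q (N + 1 - i) * sn q (-i - 1) / sn q 0) • ((sn q (N - i) / sn q (-1)) • S +
        (sn q 0 / sn q (-1)) • P) =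
    (sn q (N - i) / sn q 0) • (nu q i • (sn q 0 / sn q (-1)) • P -
        (nu q (N + 1 - i) * sn q (-i - 1) / sn q (-1)) • S) +
      (nu q (i + 1) • Q - (nu q (N - i) * sn q (-i) / sn q 1) • P) := by
  have h0 := sn_ne_zero q 0
  have h1 := sn_ne_zero q 1
  have h2 := sn_ne_zero q (-1)
  have e1 := nu_mul_sn q (i + 1) (N - i) 1
  have e2 := nu_mul_sn q i (N + 1 - i) (-1)
  rw [show (1 : ℤ) - (i + 1) = -i by ring, show (1 : ℤ) + (N - i) = N + 1 - i by ring,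
    show i + 1 + (N - i) = N + 1 by ring] at e1
  rw [show (-1 : ℤ) - i = -i - 1 by ring, show (-1 : ℤ) + (N + 1 - i) = N - i by ring,
    show i + (N + 1 - i) = N + 1 by ring] at e2
  match_scalars <;> grind

/-- The identity of `lower_raise_αβ_γδ` in terms of `X = x_i`, `Yc = f γ β x_i`, `Xc = f x_i`,
`Dc = f δ β x_{i+1}`, `Ac = f γ α x_{i-1}`, where `f = cA(λ)`. -/
theorem lower_raise_aux₁ {V : Type*} [AddCommGroup V] [Module Mer V] (N i : ℤ)
    (X Xc Yc Ac Dc : V) :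
    nu q (i + 1) • ((sn q (N + 1 - i) / sn q 1) •
          (Xc - (sn q 1 / sn q 0) • X + (sn q (-1) / sn q 0) • Yc) + Dc) -
        (nu q (N + 1 - i) * sn q (-i - 1) / sn q 0) • ((sn q (N - i) / sn q (-1)) • Ac + (X + Yc)) =
      ((sn q (N - i) / sn q 0) • (nu q i • Yc -
          (nu q (N + 1 - i) * sn q (-i - 1) / sn q (-1)) • Ac) +
        (nu q (i + 1) • Dc - (nu q (N - i) * sn q (-i) / sn q 1) •
          (Xc + (sn q (-1) / sn q 0) • Yc))) + (nu q (N + 1) • Xc - nu q (N + 2) • X) := by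
  have h0 := sn_ne_zero q 0
  have h1 := sn_ne_zero q 1
  have h2 := sn_ne_zero q (-1)
  have e1 := nu_mul_sn q (i + 1) (N - i) 1
  have e2 := nu_mul_sn q i (N + 1 - i) (-1)
  have e3 := nu_mul_sn q (i + 1) (N + 1 - i) 0
  rw [show (1 : ℤ) - (i + 1) = -i by ring, show (1 : ℤ) + (N - i) = N + 1 - i by ring,
    show i + 1 + (N - i) = N + 1 by ring] at e1
  rw [show (-1 : ℤ) - i = -i - 1 by ring, show (-1 : ℤ) + (N + 1 - i) = N - i by ring,
    show i + (N + 1 - i) = N + 1 by ring] at e2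
  rw [show (0 : ℤ) - (i + 1) = -i - 1 by ring, show (0 : ℤ) + (N + 1 - i) = N + 1 - i by ring,
    show i + 1 + (N + 1 - i) = N + 2 by ring] at e3
  match_scalars <;> grind

/-- The identity of `lower_raise_γδ_αβ`, in the same notation as `lower_raise_aux₁`. -/
theorem lower_raise_aux₂ {V : Type*} [AddCommGroup V] [Module Mer V] (N i : ℤ)
    (X Xc Yc Ac Dc : V) :
    nu q (i + 1) • ((sn q (N + 1 - i) / sn q 1) • (Xc + (sn q (-1) / sn q 0) • Yc) + Dc) -
        (nu q (N + 1 - i) * sn q (-i - 1) / sn q 0) • ((sn q (N - i) / sn q (-1)) • Ac + Yc) =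
      ((sn q (N - i) / sn q 0) • (nu q i • (X + Yc) -
          (nu q (N + 1 - i) * sn q (-i - 1) / sn q (-1)) • Ac) +
        (nu q (i + 1) • Dc - (nu q (N - i) * sn q (-i) / sn q 1) •
          (Xc - (sn q 1 / sn q 0) • X + (sn q (-1) / sn q 0) • Yc))) +
        (nu q (N + 1) • Xc - nu q N • X) := by
  have h0 := sn_ne_zero q 0
  have h1 := sn_ne_zero q 1
  have h2 := sn_ne_zero q (-1)
  have e1 := nu_mul_sn q (i + 1) (N - i) 1
  have e2 := nu_mul_sn q i (N + 1 - i) (-1)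
  have e3 := nu_mul_sn q i (N - i) 0
  rw [show (1 : ℤ) - (i + 1) = -i by ring, show (1 : ℤ) + (N - i) = N + 1 - i by ring,
    show i + 1 + (N - i) = N + 1 by ring] at e1
  rw [show (-1 : ℤ) - i = -i - 1 by ring, show (-1 : ℤ) + (N + 1 - i) = N - i by ring,
    show i + (N + 1 - i) = N + 1 by ring] at e2
  rw [show (0 : ℤ) - i = -i by ring, show (0 : ℤ) + (N - i) = N - i by ring,
    show i + (N - i) = N by ring] at e3
  match_scalars <;> grind

theorem α_μr_mul (f : Mer) (x : F q) : gα q * (μr q f * x) = μr q (shift (-1) f) * (gα q * x) := by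
  rw [← mul_assoc, ← mul_assoc, μr_α, shift_shift, add_neg_cancel, shift_zero]

theorem β_μr_mul (f : Mer) (x : F q) : gβ q * (μr q f * x) = μr q (shift 1 f) * (gβ q * x) := by
  rw [← mul_assoc, ← mul_assoc, μr_β, shift_shift, neg_add_cancel, shift_zero]

theorem γ_μr_mul (f : Mer) (x : F q) : gγ q * (μr q f * x) = μr q (shift (-1) f) * (gγ q * x) := by
  rw [← mul_assoc, ← mul_assoc, μr_γ, shift_shift, add_neg_cancel, shift_zero]

theorem δ_μr_mul (f : Mer) (x : F q) : gδ q * (μr q f * x) = μr q (shift 1 f) * (gδ q * x) := by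
  rw [← mul_assoc, ← mul_assoc, μr_δ, shift_shift, neg_add_cancel, shift_zero]

theorem mul_raise_right {b : F q}
    (hb : ∀ f x, b * (μr q f * x) = μr q (shift 1 f) * (b * x))
    (c d : F q) (N : ℤ) (x : ℤ → F q) (i : ℤ) :
    b * raise c d N x (i + 1) =
      μr q (sn q (N + 1 - i) / sn q 1) * (b * (c * x i)) + b * (d * x (i + 1)) := by
  rw [raise, mul_add, hb, map_div₀ (shift 1), shift_one_sn, shift_one_sn, add_sub_cancel_right,
    zero_add, show N + 1 - (i + 1) + 1 = N + 1 - i by ring]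

theorem mul_raise_left {a : F q}
    (ha : ∀ f x, a * (μr q f * x) = μr q (shift (-1) f) * (a * x))
    (c d : F q) (N : ℤ) (x : ℤ → F q) (i : ℤ) :
    a * raise c d N x i =
      μr q (sn q (N - i) / sn q (-1)) * (a * (c * x (i - 1))) + a * (d * x i) := by
  rw [raise, mul_add, ha, map_div₀ (shift (-1)), shift_neg_one_sn, shift_neg_one_sn,
    zero_sub, show N + 1 - i - 1 = N - i by ring]

theorem mul_lower_right {b : F q}
    (hb : ∀ f x, b * (μr q f * x) = μr q (shift 1 f) * (b * x))
    (c d : F q) (N : ℤ) (x : ℤ → F q) (i : ℤ) :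
    b * lower c d N x i = μr q (nu q (i + 1)) * (b * (d * x (i + 1))) -
      μr q (nu q (N - i) * sn q (-i) / sn q 1) * (b * (c * x i)) := by
  rw [lower, mul_sub, hb, hb, map_div₀ (shift 1), map_mul (shift 1), shift_one_sn, shift_one_sn,
    shift_nu, shift_nu, zero_add, show -i - 1 + 1 = -i by ring]

theorem mul_lower_left {a : F q}
    (ha : ∀ f x, a * (μr q f * x) = μr q (shift (-1) f) * (a * x))
    (c d : F q) (N : ℤ) (x : ℤ → F q) (i : ℤ) :
    a * lower c d N x (i - 1) = μr q (nu q i) * (a * (d * x i)) -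
      μr q (nu q (N + 1 - i) * sn q (-i - 1) / sn q (-1)) * (a * (c * x (i - 1))) := by
  rw [lower, mul_sub, ha, ha, map_div₀ (shift (-1)), map_mul (shift (-1)), shift_neg_one_sn,
    shift_neg_one_sn, shift_nu, shift_nu, zero_sub, show i - 1 + 1 = i by ring,
    show N - (i - 1) = N + 1 - i by ring, show -(i - 1) - 1 - 1 = -i - 1 by ring]

/-- The lowering operator commutes with the raising operator of the same pair. -/
theorem lower_raise_same {a b : F q}
    (ha : ∀ f x, a * (μr q f * x) = μr q (shift (-1) f) * (a * x))
    (hb : ∀ f x, b * (μr q f * x) = μr q (shift 1 f) * (b * x))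
    (hab : ∀ x, a * (b * x) = μr q (cB q) * (b * (a * x)))
    (N : ℤ) (x : ℤ → F q) (i : ℤ) :
    lower a b (N + 1) (raise a b N x) i = raise a b (N - 1) (lower a b N x) i := by
  rw [lower, mul_raise_right hb, mul_raise_left ha, raise, mul_lower_right hb, mul_lower_left ha,
    hab, cB_eq, sub_add_cancel]
  exact lower_raise_aux (V := FR q) N i _ _ _

theorem μr_μl_mul (f g : Mer) (x : F q) : μr q f * (μl q g * x) = μl q g * (μr q f * x) := by
  rw [← mul_assoc, ← μl_μr, mul_assoc]

/-- Constants are the same element under both embeddings of `M`. -/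
theorem μl_nu (n : ℤ) : μl q (nu q n) = μr q (nu q n) := by
  rw [nu, ← qM_zpow, ← qM_zpow, ← map_sub, AlgHom.commutes, AlgHom.commutes]

theorem αδ_x (x : F q) : gα q * (gδ q * x) = x + μl q (cA q) * (gγ q * (gβ q * x)) := by
  rw [← mul_assoc, det_rel, add_mul, one_mul, mul_assoc, mul_assoc]

theorem δα_x (x : F q) : gδ q * (gα q * x) = x + μr q (fK q) * (gγ q * (gβ q * x)) := by
  rw [← mul_assoc, δα_rel, add_mul, one_mul, mul_assoc, mul_assoc]

theorem βγ_x (x : F q) : gβ q * (gγ q * x) = μl q (cA q) * x - μr q (cA q) * x +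
    μr q (fK q) * (μl q (cA q) * (gγ q * (gβ q * x))) := by
  rw [← mul_assoc, βγ_rel, add_mul, sub_mul, μr_μl_mul]
  simp only [mul_assoc]

/-- Lowering by `(α, β)` commutes with raising by `(γ, δ)` up to factors depending on `λ` only and a
multiple of the row itself. -/
theorem lower_raise_αβ_γδ (N : ℤ) (x : ℤ → F q) (i : ℤ) :
    lower (gα q) (gβ q) (N + 1) (raise (gγ q) (gδ q) N x) i =
      μl q (cA q) * raise (gγ q) (gδ q) (N - 1) (lower (gα q) (gβ q) N x) i +
        μl q (cA q * nu q (N + 1) - nu q (N + 2)) * x i := by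
  have e : μl q (cA q * nu q (N + 1) - nu q (N + 2)) * x i =
      μr q (nu q (N + 1)) * (μl q (cA q) * x i) - μr q (nu q (N + 2)) * x i := by
    rw [map_sub, map_mul, sub_mul, μl_nu, μl_nu, mul_assoc, μr_μl_mul]
  rw [lower, mul_raise_right β_μr_mul, mul_raise_left α_μr_mul, raise, mul_lower_right δ_μr_mul,
    mul_lower_left γ_μr_mul, sub_add_cancel, βγ_x, βδ_x, αγ_x, αδ_x, δα_x, e]
  simp only [mul_add (μl q (cA q)), mul_sub (μl q (cA q)), ← μr_μl_mul]
  simp only [mul_add, mul_sub]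
  simp only [← mul_add, ← mul_sub]
  rw [cA_eq q, fK_eq_div]
  exact lower_raise_aux₁ (V := FR q) N i _ _ _ _ _

/-- Lowering by `(γ, δ)` commutes with raising by `(α, β)` up to factors depending on `λ` only and a
multiple of the row itself. -/
theorem lower_raise_γδ_αβ (N : ℤ) (x : ℤ → F q) (i : ℤ) :
    μl q (cA q) * lower (gγ q) (gδ q) (N + 1) (raise (gα q) (gβ q) N x) i =
      raise (gα q) (gβ q) (N - 1) (lower (gγ q) (gδ q) N x) i +
        μl q (cA q * nu q (N + 1) - nu q N) * x i := by
  have e : μl q (cA q * nu q (N + 1) - nu q N) * x i =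
      μr q (nu q (N + 1)) * (μl q (cA q) * x i) - μr q (nu q N) * x i := by
    rw [map_sub, map_mul, sub_mul, μl_nu, μl_nu, mul_assoc, μr_μl_mul]
  rw [lower, mul_raise_right δ_μr_mul, mul_raise_left γ_μr_mul, raise, mul_lower_right β_μr_mul,
    mul_lower_left α_μr_mul, sub_add_cancel, βγ_x, βδ_x, αγ_x, αδ_x, δα_x, e]
  simp only [mul_add (μl q (cA q)), mul_sub (μl q (cA q)), ← μr_μl_mul]
  rw [cA_eq q, fK_eq_div]
  exact lower_raise_aux₂ (V := FR q) N i _ _ _ _ _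

end

noncomputable section

variable {q : Set.Ioo (0 : ℝ) 1}

/-! ### The matrix elements span `F` -/

theorem raise_μl_mul {a b : F q} {k : ℂ} (ha : ∀ (f : Mer) x, a * f • x = shift k f • (a * x))
    (hb : ∀ (f : Mer) x, b * f • x = shift k f • (b * x)) (N : ℤ) (f : Mer) (x : ℤ → F q) (j : ℤ) :
    raise a b N (fun i => μl q f * x i) j = μl q (shift k f) * raise a b N x j := by
  simp only [raise, ← smul_def, ha, hb, μr_smul, smul_add]

theorem raise_zero (a b : F q) (N j : ℤ) : raise a b N (fun _ => 0) j = 0 := by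
  simp [raise]

theorem lower_matZ_zero (a b : F q) (i : ℤ) : lower a b 0 (matZ q 0 0) i = 0 := by
  rw [lower, matZ_zero, matZ_zero]
  by_cases h : i = 0
  · subst h
    simp [nu_zero]
  · by_cases h' : i + 1 = 0
    · rw [h', nu_zero, if_neg h]
      simp
    · rw [if_neg h, if_neg h']
      simp

/-- Lowering by `(α, β)` maps the row `t^N_{k}` to a multiple of the row `t^{N-1}_k`. -/
theorem exists_lower_αβ (N k : ℕ) (hk : k ≤ N) : ∃ ζ : Mer, (k = N → ζ = 0) ∧
    ∀ i, lower (gα q) (gβ q) N (matZ q N k) i = μl q ζ * matZ q (N - 1) k i := by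
  refine matZ_induction (p := fun N k x => ∃ ζ : Mer, (k = N → ζ = 0) ∧
    ∀ i, lower (gα q) (gβ q) N x i = μl q ζ * matZ q (N - 1) k i) ?_ ?_ ?_ N k hk
  · refine ⟨0, fun _ => rfl, fun i => ?_⟩
    rw [map_zero, zero_mul]
    exact lower_matZ_zero _ _ i
  · rintro N ⟨ζ, hζ, h⟩
    obtain rfl := hζ rfl
    refine ⟨0, fun _ => rfl, fun i => ?_⟩
    push_cast
    rw [lower_raise_same α_μr_mul β_μr_mul αβ_x, funext h]
    simp only [map_zero, zero_mul, raise_zero]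
  · rintro N k hk ⟨ζ, hζ, h⟩
    refine ⟨cA q * shift 1 ζ + (cA q * nu q (N + 1) - nu q (N + 2)), by omega, fun i => ?_⟩
    push_cast
    rw [lower_raise_αβ_γδ, funext h, raise_μl_mul γ_smul δ_smul, map_add, add_mul, map_mul,
      mul_assoc]
    congr 2
    rcases hk.lt_or_eq with hk | rfl
    · obtain ⟨M, rfl⟩ : ∃ M, N = M + 1 := ⟨N - 1, by omega⟩
      rw [Nat.add_sub_cancel, matZ_raise_γδ (Nat.lt_succ_iff.1 hk)]
      push_cast
      rw [add_sub_cancel_right]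
    · rw [hζ rfl, map_zero, map_zero, zero_mul, zero_mul]

/-- Lowering by `(γ, δ)` maps the row `t^N_{k}` to a multiple of the row `t^{N-1}_{k-1}`. -/
theorem exists_lower_γδ (N k : ℕ) (hk : k ≤ N) : ∃ ζ : Mer, (k = 0 → ζ = 0) ∧
    ∀ i, lower (gγ q) (gδ q) N (matZ q N k) i = μl q ζ * matZ q (N - 1) (k - 1) i := by
  refine matZ_induction (p := fun N k x => ∃ ζ : Mer, (k = 0 → ζ = 0) ∧
    ∀ i, lower (gγ q) (gδ q) N x i = μl q ζ * matZ q (N - 1) (k - 1) i) ?_ ?_ ?_ N k hk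
  · refine ⟨0, fun _ => rfl, fun i => ?_⟩
    rw [map_zero, zero_mul]
    exact lower_matZ_zero _ _ i
  · rintro N ⟨ζ, hζ, h⟩
    have hc : cA q ≠ 0 := by
      rw [cA_eq]
      exact div_ne_zero (sn_ne_zero q 1) (sn_ne_zero q 0)
    refine ⟨(cA q)⁻¹ * (shift (-1) ζ + (cA q * nu q (N + 1) - nu q N)), by omega, fun i => ?_⟩
    have h1 := lower_raise_γδ_αβ (N : ℤ) (matZ q N N) i
    rw [funext h, raise_μl_mul α_smul β_smul] at h1
    have h2 : μl q (shift (-1) ζ) * raise (gα q) (gβ q) (N - 1) (matZ q (N - 1) (N - 1)) i =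
        μl q (shift (-1) ζ) * matZ q N N i := by
      cases N with
      | zero => rw [hζ rfl, map_zero, map_zero, zero_mul, zero_mul]
      | succ N =>
        rw [Nat.add_sub_cancel, matZ_top]
        push_cast
        rw [add_sub_cancel_right]
    rw [h2, ← add_mul, ← map_add] at h1
    push_cast
    rw [map_mul, mul_assoc, ← h1, ← mul_assoc, ← map_mul, inv_mul_cancel₀ hc, map_one, one_mul]
  · rintro N k hk ⟨ζ, hζ, h⟩
    refine ⟨shift 1 ζ, fun hk0 => by rw [hζ hk0, map_zero], fun i => ?_⟩
    push_cast
    rw [lower_raise_same γ_μr_mul δ_μr_mul γδ_x, funext h, raise_μl_mul γ_smul δ_smul]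
    rcases Nat.eq_zero_or_pos k with rfl | hk0
    · rw [hζ rfl, map_zero, map_zero, zero_mul, zero_mul]
    · obtain ⟨M, rfl⟩ : ∃ M, N = M + 1 := ⟨N - 1, by omega⟩
      rw [Nat.add_sub_cancel, matZ_raise_γδ (by omega)]
      push_cast
      rw [add_sub_cancel_right]

theorem left_of_raise_lower_aux {V : Type*} [AddCommGroup V] [Module Mer V] (N j : ℤ)
    (hN : N + 1 ≠ 0) (A B : V) : A = (nu q (N + 1))⁻¹ •
      (nu q j • ((sn q (N + 1 - j) / sn q 0) • A + B) -
        (nu q j • B - (nu q (N + 1 - j) * sn q (-j) / sn q 0) • A)) := by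
  have h0 := sn_ne_zero q 0
  have h1 := nu_ne_zero q hN
  have e := nu_mul_sn q j (N + 1 - j) 0
  rw [zero_sub, zero_add, add_sub_cancel] at e
  match_scalars <;> grind

theorem right_of_raise_lower_aux {V : Type*} [AddCommGroup V] [Module Mer V] (N j : ℤ)
    (hN : N + 1 ≠ 0) (A B : V) : B = (nu q (N + 1))⁻¹ •
      ((nu q (N + 1 - j) * sn q (-j) / sn q 0) • ((sn q (N + 1 - j) / sn q 0) • A + B) +
        (sn q (N + 1 - j) / sn q 0) •
          (nu q j • B - (nu q (N + 1 - j) * sn q (-j) / sn q 0) • A)) := by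
  have h0 := sn_ne_zero q 0
  have h1 := nu_ne_zero q hN
  have e := nu_mul_sn q j (N + 1 - j) 0
  rw [zero_sub, zero_add, add_sub_cancel] at e
  match_scalars <;> grind

theorem lower_sub_one (a b : F q) (N : ℤ) (x : ℤ → F q) (j : ℤ) : lower a b N x (j - 1) =
    μr q (nu q j) * (b * x j) - μr q (nu q (N + 1 - j) * sn q (-j) / sn q 0) * (a * x (j - 1)) := by
  rw [lower, sub_add_cancel, show N - (j - 1) = N + 1 - j by ring,
    show -(j - 1) - 1 = -j by ring]

/-- The raising and lowering operators of a pair `(a, b)` determine multiplication by `a`. -/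
theorem left_of_raise_lower (a b : F q) {N : ℤ} (hN : N + 1 ≠ 0) (x : ℤ → F q) (j : ℤ) :
    a * x (j - 1) = μr q (nu q (N + 1))⁻¹ *
      (μr q (nu q j) * raise a b N x j - lower a b N x (j - 1)) := by
  rw [raise, lower_sub_one]
  exact left_of_raise_lower_aux (V := FR q) N j hN _ _

/-- The raising and lowering operators of a pair `(a, b)` determine multiplication by `b`. -/
theorem right_of_raise_lower (a b : F q) {N : ℤ} (hN : N + 1 ≠ 0) (x : ℤ → F q) (j : ℤ) :
    b * x j = μr q (nu q (N + 1))⁻¹ *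
      (μr q (nu q (N + 1 - j) * sn q (-j) / sn q 0) * raise a b N x j +
        μr q (sn q (N + 1 - j) / sn q 0) * lower a b N x (j - 1)) := by
  rw [raise, lower_sub_one]
  exact right_of_raise_lower_aux (V := FR q) N j hN _ _

variable (q)

/-- All matrix elements, as one family. -/
def matFam (i : Σ N : ℕ, Fin (N + 1) × Fin (N + 1)) : F q := matElem q i.1 i.2.1 i.2.2

/-- The span of the matrix elements over `μ_l(M) μ_r(M)`. -/
abbrev matSpan : Submodule (base q) (F q) := Submodule.span (base q) (Set.range (matFam q))

variable {q}

theorem matZ_mem (N k : ℕ) (j : ℤ) : matZ q N k j ∈ matSpan q := by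
  by_cases hk : k ≤ N
  · rw [matZ_of_le hk, extZ]
    split_ifs with h
    · exact Submodule.subset_span ⟨⟨N, _, _⟩, rfl⟩
    · exact zero_mem _
  · rw [matZ, dif_neg (by omega)]
    exact zero_mem _

theorem moment_mul_mem {a : F q} (ha : a ∈ matSpan q) (x : Mer ⊗[ℂ] Mer) :
    moment q x * a ∈ matSpan q :=
  Submodule.smul_mem (matSpan q) (⟨moment q x, x, rfl⟩ : base q) ha

theorem μl_mul_mem {a : F q} (ha : a ∈ matSpan q) (f : Mer) : μl q f * a ∈ matSpan q := by
  have h := moment_mul_mem ha (f ⊗ₜ 1)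
  rwa [moment_tmul, map_one, mul_one] at h

theorem μr_mul_mem {a : F q} (ha : a ∈ matSpan q) (f : Mer) : μr q f * a ∈ matSpan q := by
  have h := moment_mul_mem ha (1 ⊗ₜ f)
  rwa [moment_tmul, map_one, one_mul] at h

/-- If a pair `(a, b)` raises and lowers the row `t^N_k` within the span of the matrix elements, then
`a` and `b` multiply that row into the span. -/
theorem mul_matZ_mem {a b : F q} (N k : ℕ) (hr : ∀ j, raise a b N (matZ q N k) j ∈ matSpan q)
    (hl : ∀ j, lower a b N (matZ q N k) j ∈ matSpan q) (j : ℤ) :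
    a * matZ q N k j ∈ matSpan q ∧ b * matZ q N k j ∈ matSpan q := by
  constructor
  · have h := left_of_raise_lower a b (N := N) (by omega) (matZ q N k) (j + 1)
    rw [add_sub_cancel_right] at h
    rw [h]
    exact μr_mul_mem (sub_mem (μr_mul_mem (hr _) _) (hl _)) _
  · rw [right_of_raise_lower a b (N := N) (by omega) (matZ q N k) j]
    exact μr_mul_mem (add_mem (μr_mul_mem (hr _) _) (μr_mul_mem (hl _) _)) _

/-- Multiplication by a bihomogeneous `a` is semilinear over `μ_l(M) μ_r(M)`, so that the matrix
elements are the only elements to be checked. -/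
theorem mul_mem_matSpan {a : F q} {k l : ℂ}
    (hl : ∀ (f : Mer) x, a * f • x = shift k f • (a * x))
    (hr : ∀ f x, a * (μr q f * x) = μr q (shift l f) * (a * x))
    (h : ∀ N k j, k ≤ N → a * matZ q N k j ∈ matSpan q) {x : F q} (hx : x ∈ matSpan q) :
    a * x ∈ matSpan q := by
  induction hx using Submodule.span_induction with
  | mem x hx =>
    obtain ⟨⟨N, k, j⟩, rfl⟩ := hx
    rw [matFam, ← matZ_coe]
    exact h N k j (by omega)
  | zero => rw [mul_zero]; exact zero_mem _
  | add x y _ _ hx hy => rw [mul_add]; exact add_mem hx hy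
  | smul c x _ hx =>
    obtain ⟨_, m, rfl⟩ := c
    change a * (moment q m * x) ∈ matSpan q
    induction m using TensorProduct.induction_on with
    | zero => rw [map_zero, zero_mul, mul_zero]; exact zero_mem _
    | add m m' h h' => rw [map_add, add_mul, mul_add]; exact add_mem h h'
    | tmul f g =>
      rw [moment_tmul, mul_assoc, ← smul_def, hl, hr]
      exact μl_mul_mem (μr_mul_mem hx _) _

theorem αβ_matZ_mem (N k : ℕ) (j : ℤ) (hk : k ≤ N) :
    gα q * matZ q N k j ∈ matSpan q ∧ gβ q * matZ q N k j ∈ matSpan q := by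
  refine mul_matZ_mem N k (fun j => ?_) (fun j => ?_) j
  · rw [← matZ_raise_αβ hk]
    exact μl_mul_mem (matZ_mem _ _ _) _
  · obtain ⟨ζ, -, h⟩ := exists_lower_αβ (q := q) N k hk
    rw [h]
    exact μl_mul_mem (matZ_mem _ _ _) _

theorem γδ_matZ_mem (N k : ℕ) (j : ℤ) (hk : k ≤ N) :
    gγ q * matZ q N k j ∈ matSpan q ∧ gδ q * matZ q N k j ∈ matSpan q := by
  refine mul_matZ_mem N k (fun j => ?_) (fun j => ?_) j
  · rw [← matZ_raise_γδ hk]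
    exact matZ_mem _ _ _
  · obtain ⟨ζ, -, h⟩ := exists_lower_γδ (q := q) N k hk
    rw [h]
    exact μl_mul_mem (matZ_mem _ _ _) _

/-- The span of the matrix elements is a left ideal. -/
theorem left_mul_mem_matSpan (a : F q) : ∀ x ∈ matSpan q, a * x ∈ matSpan q := by
  induction a using F_induction with
  | hl f => exact fun x hx => μl_mul_mem hx f
  | hr f => exact fun x hx => μr_mul_mem hx f
  | hα => exact fun x => mul_mem_matSpan α_smul α_μr_mul fun N k j h => (αβ_matZ_mem N k j h).1
  | hβ => exact fun x => mul_mem_matSpan β_smul β_μr_mul fun N k j h => (αβ_matZ_mem N k j h).2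
  | hγ => exact fun x => mul_mem_matSpan γ_smul γ_μr_mul fun N k j h => (γδ_matZ_mem N k j h).1
  | hδ => exact fun x => mul_mem_matSpan δ_smul δ_μr_mul fun N k j h => (γδ_matZ_mem N k j h).2
  | hmul a b ha hb =>
    intro x hx
    rw [mul_assoc]
    exact ha _ (hb _ hx)
  | hadd a b ha hb =>
    intro x hx
    rw [add_mul]
    exact add_mem (ha _ hx) (hb _ hx)

theorem matSpan_eq_top : matSpan q = ⊤ := by
  rw [eq_top_iff]
  intro a _
  have h : (1 : F q) ∈ matSpan q := by
    have h := matZ_mem (q := q) 0 0 0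
    rwa [matZ_zero, if_pos rfl] at h
  simpa using left_mul_mem_matSpan a 1 h

/-! ### Leading coefficients of the matrix elements -/

variable (q)

/-- The `μ`-part of the leading coefficient of `t^N_{kj}`; it does not depend on `k`. -/
def muLead : ℕ → ℤ → Mer
  | 0, j => if j = 0 then 1 else 0
  | N + 1, j => sn q (N + 1 - j) / sn q 0 * shift (-1) (muLead N (j - 1)) +
      (sn q 0)⁻¹ * shift 1 (muLead N j)

variable {q}

theorem hasLead_raise {a b : F q} {n : ℕ} {f : Mer} {N : ℕ} {x : ℤ → F q} {j : ℤ}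
    (ha : HasLead n (f ⊗ₜ shift (-1) (muLead q N (j - 1))) (symb q (a * x (j - 1))))
    (hb : HasLead n (f ⊗ₜ ((sn q 0)⁻¹ * shift 1 (muLead q N j))) (symb q (b * x j))) :
    HasLead n (f ⊗ₜ muLead q (N + 1) j) (symb q (raise a b N x j)) := by
  have h := (ha.rA_mul (sn q (N + 1 - j) / sn q 0)).add hb
  rwa [← symb_μr_mul, ← map_add] at h

/-- The symbol of `t^N_{kj}` has degree at most `N - k`, with a pure tensor as leading coefficient. -/
theorem hasLead_matZ (N k : ℕ) (hk : k ≤ N) : ∀ j : ℤ,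
    HasLead (N - k) (lam q (N - k) ⊗ₜ muLead q N j) (symb q (matZ q N k j)) := by
  refine matZ_induction (p := fun N k x => ∀ j : ℤ,
    HasLead (N - k) (lam q (N - k) ⊗ₜ muLead q N j) (symb q (x j))) ?_ ?_ ?_ N k hk
  · intro j
    rw [matZ_zero, muLead]
    split_ifs with h
    · exact HasLead.symb_one
    · rw [map_zero]
      exact HasLead.zero _ _
  · intro N h j
    rw [Nat.sub_self] at h ⊢
    have h1 := (h (j - 1)).symb_α
    have h2 := (h j).symb_β
    rw [lam, map_one] at h1 h2
    exact hasLead_raise h1 h2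
  · intro N k hk h j
    rw [Nat.succ_sub hk]
    exact hasLead_raise (h (j - 1)).symb_γ (h j).symb_δ

theorem muLead_eq_zero (N : ℕ) : ∀ j : ℤ, j < 0 ∨ (N : ℤ) < j → muLead q N j = 0 := by
  induction N with
  | zero =>
    intro j hj
    rw [muLead, if_neg (by omega)]
  | succ N ih =>
    intro j hj
    rw [muLead, ih _ (by omega), ih _ (by omega), map_zero, map_zero, mul_zero, mul_zero, add_zero]

variable (q)

/-- `∏_{i=1}^n (q^i - q^{-i})`. -/
def nuFact : ℕ → Mer
  | 0 => 1
  | n + 1 => nu q (n + 1) * nuFact n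

/-- The function `∏_{i=0}^{m-1} (q^{x+i-j+1} - q^{-(x+i-j+1)})`. -/
def snProd : ℕ → ℤ → Mer
  | 0, _ => 1
  | m + 1, j => sn q (-j) * snProd m (j - 1)

variable {q}

theorem nuFact_ne_zero (n : ℕ) : nuFact q n ≠ 0 := by
  induction n with
  | zero => exact one_ne_zero
  | succ n ih => exact mul_ne_zero (nu_ne_zero q (by omega)) ih

theorem shift_nuFact (z : ℂ) (n : ℕ) : shift z (nuFact q n) = nuFact q n := by
  induction n with
  | zero => exact map_one _
  | succ n ih => rw [nuFact, map_mul, shift_nu, ih]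

theorem shift_one_snProd (m : ℕ) (j : ℤ) : shift 1 (snProd q m j) = snProd q m (j - 1) := by
  induction m generalizing j with
  | zero => exact map_one _
  | succ m ih => rw [snProd, snProd, map_mul, shift_one_sn, ih, show -j + 1 = -(j - 1) by ring]

theorem shift_neg_one_snProd (m : ℕ) (j : ℤ) : shift (-1) (snProd q m j) = snProd q m (j + 1) := by
  induction m generalizing j with
  | zero => exact map_one _
  | succ m ih =>
    rw [snProd, snProd, map_mul, shift_neg_one_sn, ih, show -j - 1 = -(j + 1) by ring,
      sub_add_cancel, add_sub_cancel_right]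

/-- The `μ`-part of the leading coefficient is a `q`-binomial coefficient divided by a product of
functions `q^{μ+n+1} - q^{-(μ+n+1)}`. -/
theorem muLead_mul (N : ℕ) : ∀ m j : ℕ, m + j = N →
    muLead q N j * (nuFact q j * nuFact q m * snProd q m j) = nuFact q N := by
  have h0 := sn_ne_zero q 0
  induction N with
  | zero =>
    intro m j h
    obtain ⟨rfl, rfl⟩ : m = 0 ∧ j = 0 := by omega
    simp [muLead, nuFact, snProd]
  | succ N ih =>
    intro m j h
    -- the two terms of the recursion, up to the factor `sn q 0`
    have e1 : shift (-1) (muLead q N ((j : ℤ) - 1)) * (nuFact q j * nuFact q m * snProd q m j) =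
        nu q j * nuFact q N := by
      cases j with
      | zero => rw [muLead_eq_zero N _ (by simp)]; simp [nu_zero]
      | succ j =>
        have := congrArg (shift (-1)) (ih m j (by omega))
        rw [map_mul, map_mul, map_mul, shift_nuFact, shift_nuFact, shift_nuFact,
          shift_neg_one_snProd] at this
        push_cast
        rw [add_sub_cancel_right, nuFact, ← this]
        ring
    have e2 : shift 1 (muLead q N j) * (nuFact q j * nuFact q m * snProd q m j) =
        nu q m * sn q (-j) * nuFact q N := by
      cases m with
      | zero => rw [muLead_eq_zero N _ (by omega)]; simp [nu_zero]
      | succ m =>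
        have := congrArg (shift 1) (ih m j (by omega))
        rw [map_mul, map_mul, map_mul, shift_nuFact, shift_nuFact, shift_nuFact,
          shift_one_snProd] at this
        push_cast
        rw [nuFact, snProd, ← this]
        ring
    have e3 := nu_mul_sn q j m 0
    have hm : (N : ℤ) + 1 - j = m := by omega
    have hN : (j : ℤ) + m = N + 1 := by omega
    rw [hN, zero_sub, zero_add] at e3
    rw [muLead, hm, nuFact]
    calc _ = (sn q 0)⁻¹ * (sn q m * (shift (-1) (muLead q N ((j : ℤ) - 1)) *
          (nuFact q j * nuFact q m * snProd q m j)) +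
          shift 1 (muLead q N j) * (nuFact q j * nuFact q m * snProd q m j)) := by ring
      _ = (sn q 0)⁻¹ * (nu q m * sn q (-j) + nu q j * sn q m) * nuFact q N := by
        rw [e1, e2]; ring
      _ = _ := by
        rw [e3]
        field_simp

theorem muLead_ne_zero {N j : ℕ} (h : j ≤ N) : muLead q N j ≠ 0 := by
  intro h0
  have h1 := muLead_mul (q := q) N (N - j) j (by omega)
  rw [h0, zero_mul] at h1
  exact nuFact_ne_zero N h1.symm

/-! ### The matrix elements are linearly independent -/

theorem matElem_bidegree (N : ℕ) (k j : Fin (N + 1)) :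
    HasBidegree q (2 * (k : ℕ) - N) (2 * (j : ℕ) - N) (matElem q N k j) := by
  have h := hasBidegree_matZ (q := q) N k (by omega) (j : ℕ)
  rw [matZ_coe] at h
  simpa using h

theorem hasLead_matElem (N : ℕ) (k j : Fin (N + 1)) :
    HasLead (N - k) (lam q (N - k) ⊗ₜ muLead q N (j : ℕ)) (symb q (matElem q N k j)) := by
  have h := hasLead_matZ (q := q) N k (by omega) (j : ℕ)
  rwa [matZ_coe] at h

/-- Elements `t^N_{kj}` of the same bidegree have different values of `N - k`, that is, symbols of
different degrees, and the leading coefficients of the symbols are units of `M ⊗ M`. -/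
theorem linearIndependent_matFam : LinearIndependent (base q) (matFam q) := by
  classical
  rw [linearIndependent_iff']
  intro s g hs
  by_contra! hne
  obtain ⟨i₀, hi₀, hg₀⟩ := hne
  -- a term of the relation with nonzero coefficient and maximal `N`
  obtain ⟨⟨N, k, j⟩, hi, hmax⟩ := (s.filter (fun i => g i ≠ 0)).exists_max_image (fun i => i.1)
    ⟨i₀, Finset.mem_filter.2 ⟨hi₀, hg₀⟩⟩
  rw [Finset.mem_filter] at hi
  have hs' := congrArg (fun a => (symb q (gradeProj (AddMonoidHom.id (ℂ × ℂ))
    (2 * (k : ℕ) - N, 2 * (j : ℕ) - N) a)).coeff (N - k)) hs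
  simp only [map_sum, map_zero, Polynomial.finsetSum_coeff, Polynomial.coeff_zero] at hs'
  rw [Finset.sum_eq_single_of_mem ⟨N, k, j⟩ hi.1] at hs'
  · obtain ⟨m, hm⟩ := (g ⟨N, k, j⟩).2
    have h1 : g ⟨N, k, j⟩ • matFam q ⟨N, k, j⟩ = moment q m * matElem q N k j :=
      congrArg (· * matElem q N k j) hm.symm
    have h2 := gradeProj_same (AddMonoidHom.id (ℂ × ℂ)) ((matElem_bidegree (q := q) N k j).moment_mul m)
    rw [AddMonoidHom.id_apply] at h2
    rw [h1, h2, symb_moment_mul, ((hasLead_matElem N k j).C_mul m).2] at hs'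
    have hu := isUnit_tmul (lam_ne_zero q (N - k))
      (muLead_ne_zero (q := q) (N := N) (j := j) (by omega))
    rw [hu.mul_left_eq_zero] at hs'
    rw [hs', map_zero] at hm
    exact hi.2 (Subtype.ext hm.symm)
  · rintro ⟨N', k', j'⟩ hi' hne
    by_cases hg : g ⟨N', k', j'⟩ = 0
    · rw [hg, zero_smul, map_zero, map_zero, Polynomial.coeff_zero]
    have hN : N' ≤ N := hmax _ (Finset.mem_filter.2 ⟨hi', hg⟩)
    obtain ⟨m, hm⟩ := (g ⟨N', k', j'⟩).2
    have h1 : g ⟨N', k', j'⟩ • matFam q ⟨N', k', j'⟩ = moment q m * matElem q N' k' j' :=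
      congrArg (· * matElem q N' k' j') hm.symm
    have hb := (matElem_bidegree (q := q) N' k' j').moment_mul m
    rw [h1]
    by_cases hd : ((2 * (k' : ℕ) - N' : ℂ), (2 * (j' : ℕ) - N' : ℂ)) =
        ((2 * (k : ℕ) - N : ℂ), (2 * (j : ℕ) - N : ℂ))
    · have h2 := gradeProj_same (AddMonoidHom.id (ℂ × ℂ)) hb
      rw [AddMonoidHom.id_apply, hd] at h2
      rw [h2, symb_moment_mul]
      -- equal bidegrees: a smaller `N` gives a smaller degree of the symbol
      obtain ⟨hd1, hd2⟩ := Prod.mk.inj hd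
      have hd1' : 2 * (k' : ℤ) - N' = 2 * k - N := by exact_mod_cast hd1
      have hd2' : 2 * (j' : ℤ) - N' = 2 * j - N := by exact_mod_cast hd2
      have hlt : N' < N := by
        refine lt_of_le_of_ne hN fun h => hne ?_
        subst h
        have e1 : k' = k := Fin.ext (by omega)
        have e2 : j' = j := Fin.ext (by omega)
        rw [e1, e2]
      apply Polynomial.coeff_eq_zero_of_natDegree_lt
      refine lt_of_le_of_lt ((hasLead_matElem N' k' j').C_mul m).1 ?_
      omega
    · rw [gradeProj_ne (AddMonoidHom.id (ℂ × ℂ)) hb hd, map_zero, Polynomial.coeff_zero]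

variable (q)

/-- The basis of `F` over `μ_l(M) μ_r(M)` given by the matrix elements. -/
def matBasis : Module.Basis (Σ N : ℕ, Fin (N + 1) × Fin (N + 1)) (base q) (F q) :=
  Module.Basis.mk linearIndependent_matFam matSpan_eq_top.ge

theorem matBasis_apply (N : ℕ) (k j : Fin (N + 1)) : matBasis q ⟨N, k, j⟩ = matElem q N k j :=
  Module.Basis.mk_apply ..

end

noncomputable section

variable {q : Set.Ioo (0 : ℝ) 1}

/-! ### The corepresentations `V_N` -/

section naturality

variable {V W P : Type*} [AddCommGroup V] [Module Mer V] [AddCommGroup W] [Module Mer W]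
  [AddCommGroup P] [Module Mer P]

theorem FT.map_map (φ : W →ₗ[Mer] P) (ψ : V →ₗ[Mer] W) (t : FT q V) :
    FT.map φ (FT.map ψ t) = FT.map (φ ∘ₗ ψ) t := by
  induction t using FT.induction with
  | zero => simp only [map_zero]
  | tmul a v => rfl
  | add x y hx hy => simp only [map_add, hx, hy]

theorem FT.map_coproductMap (φ : V →ₗ[Mer] W) (t : FT q V) :
    FT.map (FT.map φ) (FT.coproductMap t) = FT.coproductMap (FT.map φ t) := by
  induction t using FT.induction with
  | zero => simp only [map_zero]
  | tmul a v =>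
    rw [FT.coproductMap_tmul, FT.map_map, FT.map_tmul, FT.coproductMap_tmul]
    rfl
  | add x y hx hy => simp only [map_add, hx, hy]

theorem FT.counitMap_map (φ : V →ₗ[Mer] W) (t : FT q V) :
    FT.counitMap (FT.map φ t) = φ (FT.counitMap t) := by
  induction t using FT.induction with
  | zero => simp only [map_zero]
  | tmul a v => rw [FT.map_tmul, FT.counitMap_tmul, FT.counitMap_tmul, map_smul]
  | add x y hx hy => simp only [map_add, hx, hy]

theorem FT.contract_map (φ : W →ₗ[Mer] Mer) (ψ : V →ₗ[Mer] W) (t : FT q V) :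
    FT.contract φ (FT.map ψ t) = FT.contract (φ ∘ₗ ψ) t := by
  induction t using FT.induction with
  | zero => simp only [map_zero]
  | tmul a v => rfl
  | add x y hx hy => simp only [map_add, hx, hy]

theorem FT.contract_zero (t : FT q V) : FT.contract (0 : V →ₗ[Mer] Mer) t = 0 := by
  induction t using FT.induction with
  | zero => rw [map_zero]
  | tmul a v => rw [FT.contract_tmul, LinearMap.zero_apply, map_zero, zero_mul]
  | add x y hx hy => rw [map_add, hx, hy, add_zero]

theorem FT.contract_add (φ ψ : V →ₗ[Mer] Mer) (t : FT q V) :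
    FT.contract (φ + ψ) t = FT.contract φ t + FT.contract ψ t := by
  induction t using FT.induction with
  | zero => simp only [map_zero, add_zero]
  | tmul a v =>
    simp only [FT.contract_tmul, LinearMap.add_apply, map_add, add_mul]
  | add x y hx hy =>
    simp only [map_add, hx, hy]
    abel

theorem FT.contract_smul (z : ℂ) (φ : V →ₗ[Mer] Mer) (t : FT q V) :
    FT.contract (z • φ) t = z • FT.contract φ t := by
  induction t using FT.induction with
  | zero => simp only [map_zero, smul_zero]
  | tmul a v =>
    simp only [FT.contract_tmul, LinearMap.smul_apply, map_smul, smul_mul_assoc]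
  | add x y hx hy => simp only [map_add, hx, hy, smul_add]

/-- The coproduct of a matrix coefficient. -/
theorem coproduct_contract (φ : V →ₗ[Mer] Mer) (t : FT q V) :
    coproduct q (FT.contract φ t) = FT.map (FT.contract φ) (FT.coproductMap t) := by
  induction t using FT.induction with
  | zero => simp only [map_zero]
  | tmul a v =>
    rw [FT.contract_tmul, coproduct_mul, FT.coproductMap_tmul, FT.map_map]
    induction coproduct q a using FT.induction with
    | zero => simp only [map_zero]
    | tmul x y => exact mulCoproduct_μr_tmul (φ v) x y
    | add x y hx hy => simp only [map_add, hx, hy]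
  | add x y hx hy => simp only [map_add, hx, hy]

theorem FT.contract_mem_regularGr (φ : V →ₗ[Mer] Mer) (gr : ℂ → Submodule Mer V) {n : ℂ}
    {t : FT q V} (ht : t ∈ FT.grade gr n) : FT.contract φ t ∈ regularGr q n := by
  induction ht using Submodule.span_induction with
  | mem x hx =>
    obtain ⟨m, a, v, ha, -, rfl⟩ := hx
    have h := (HasBidegree.right (φ v)).mul ha
    rw [zero_add, zero_add] at h
    exact Submodule.subset_span ⟨m, h⟩
  | zero => rw [map_zero]; exact zero_mem _
  | add x y _ _ hx hy => rw [map_add]; exact add_mem hx hy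
  | smul f x _ hx => rw [map_smul]; exact Submodule.smul_mem _ _ hx

end naturality

/-- The inclusion of `V_N` in `F` intertwines the coactions. -/
theorem corepV_spec (N : ℕ) : FT.map (VN q N).subtype ∘ₗ (corepV q N).toFun =
    coproduct q ∘ₗ (VN q N).subtype :=
  LinearMap.ext fun u => subCoaction_spec (VN q N) (coproduct_mem N) u

theorem vec_mem_gr (N : ℕ) (k : Fin (N + 1)) : vec q N k ∈ (corepV q N).gr (2 * (k : ℕ) - N) :=
  vecF_mem_regularGr N k

/-- The weight spaces of `V_N` are spanned by the `γ^{N-k} α^k`, which have different weights. -/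
theorem repr_eq_zero {N : ℕ} {n : ℂ} {v : VN q N} (hv : v ∈ (corepV q N).gr n)
    (k : Fin (N + 1)) (hk : n ≠ 2 * (k : ℕ) - N) : (vecBasis q N).repr v k = 0 := by
  have h1 : (v : F q) = ∑ j, (vecBasis q N).repr v j • vecF q N j := by
    conv_lhs => rw [← (vecBasis q N).sum_repr v]
    simp only [vecBasis_apply]
    exact map_sum (VN q N).subtype _ _
  have h2 := leftProj_ne (show (v : F q) ∈ regularGr q n from hv) hk
  rw [h1, leftProj_sum_vecF] at h2
  exact smul_γα_eq_zero h2

theorem iSup_corepV_gr (N : ℕ) : ⨆ n, (corepV q N).gr n = ⊤ := by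
  rw [eq_top_iff, ← (vecBasis q N).span_eq, Submodule.span_le]
  rintro _ ⟨k, rfl⟩
  rw [vecBasis_apply]
  exact Submodule.mem_iSup_of_mem _ (vec_mem_gr N k)

theorem corepV_isCorep (N : ℕ) : (corepV q N).IsCorep where
  isInternal := by
    refine (DirectSum.isInternal_submodule_iff_iSupIndep_and_iSup_eq_top _).2
      ⟨?_, iSup_corepV_gr N⟩
    rw [iSupIndep_def]
    intro m
    rw [Submodule.disjoint_def]
    intro x hx hx'
    have h : (⨆ (j) (_ : j ≠ m), (corepV q N).gr j) ≤
        (⨆ (j) (_ : j ≠ m), regularGr q j).comap (VN q N).subtype :=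
      iSup₂_le fun j hj => Submodule.comap_mono (le_iSup₂_of_le j hj le_rfl)
    exact Subtype.ext (Submodule.disjoint_def.1 ((iSupIndep_def.1 regularGr_iSupIndep) m) (x : F q)
      hx (h hx'))
  map_gr n v hv := by
    rw [← (vecBasis q N).sum_repr v, map_sum]
    refine sum_mem fun k _ => ?_
    by_cases hk : n = 2 * (k : ℕ) - N
    · rw [map_smul, vecBasis_apply, isMatrixElements_matElem]
      refine Submodule.smul_mem _ _ (sum_mem fun j _ => Submodule.subset_span
        ⟨2 * (j : ℕ) - N, _, _, ?_, vec_mem_gr N j, rfl⟩)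
      rw [hk]
      exact matElem_bidegree N k j
    · rw [repr_eq_zero hv k hk, zero_smul, map_zero]
      exact zero_mem _
  coassoc v := by
    apply FT.map_injective _ (FT.map_injective _ (VN q N).injective_subtype)
    have h := LinearMap.congr_fun (corepV_spec (q := q) N) v
    rw [FT.map_coproductMap, FT.map_map, corepV_spec, ← FT.map_map]
    exact (congrArg FT.coproductMap h).trans
      ((coproduct_coassoc _).trans (congrArg (FT.map (coproduct q)) h.symm))
  counit v := by
    apply (VN q N).injective_subtype
    have h := LinearMap.congr_fun (corepV_spec (q := q) N) v
    rw [← FT.counitMap_map]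
    exact (congrArg FT.counitMap h).trans (coproduct_counit _)

/-! ### The decomposition of the regular corepresentation -/

/-- The space `V_N ⊗_ℂ M^{N+1}`. -/
abbrev TensV (q : Set.Ioo (0 : ℝ) 1) (N : ℕ) : Type := VN q N ⊗[ℂ] (Fin (N + 1) → Mer)

/-- The underlying space of `⨁_N V_N ⊗_ℂ M^{N+1}`. The additive structure of the summands is spelled
out in the form in which it occurs in `sumV`. -/
abbrev SumV (q : Set.Ioo (0 : ℝ) 1) : Type :=
  @DirectSum ℕ (TensV q) fun _ => AddCommGroup.toAddCommMonoid

/-- The matrix coefficient map `V_N ⊗_ℂ M^{N+1} → F`: here `g` stands for the linear form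
`γ^{N-j} α^j ↦ g_j` on `V_N`. -/
def coeffMap (N : ℕ) : VN q N ⊗[ℂ] (Fin (N + 1) → Mer) →ₗ[Mer] F q :=
  TensorProduct.AlgebraTensorModule.lift
    { toFun := fun v =>
        { toFun := fun g => FT.contract ((vecBasis q N).constr ℂ g) ((corepV q N).toFun v)
          map_add' := fun g g' => by rw [map_add, FT.contract_add]
          map_smul' := fun z g => by rw [map_smul, FT.contract_smul, RingHom.id_apply] }
      map_add' := fun v v' => by
        ext g
        change FT.contract _ ((corepV q N).toFun (v + v')) = FT.contract _ _ + FT.contract _ _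
        rw [map_add, map_add]
      map_smul' := fun f v => by
        ext g
        change FT.contract _ ((corepV q N).toFun (f • v)) = f • FT.contract _ _
        rw [map_smul, map_smul] }

theorem coeffMap_tmul (N : ℕ) (v : VN q N) (g : Fin (N + 1) → Mer) : coeffMap N (v ⊗ₜ[ℂ] g) =
    FT.contract ((vecBasis q N).constr ℂ g) ((corepV q N).toFun v) := rfl

theorem coeffMap_vec (N : ℕ) (k : Fin (N + 1)) (g : Fin (N + 1) → Mer) :
    coeffMap N (vec q N k ⊗ₜ[ℂ] g) = ∑ j, μr q (g j) * matElem q N k j := by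
  rw [coeffMap_tmul, isMatrixElements_matElem, map_sum]
  refine Finset.sum_congr rfl fun j _ => ?_
  rw [FT.contract_tmul, ← vecBasis_apply, Module.Basis.constr_basis]

variable (q)

/-- The map `⨁_N V_N ⊗_ℂ M^{N+1} → F`. -/
def peterWeyl : SumV q →ₗ[Mer] F q := DirectSum.toModule Mer ℕ _ coeffMap

variable {q}

theorem peterWeyl_of (N : ℕ) (x : VN q N ⊗[ℂ] (Fin (N + 1) → Mer)) :
    peterWeyl q (DirectSum.of (TensV q) N x) = coeffMap N x := by
  rw [peterWeyl]
  exact DirectSum.toModule_lof Mer (φ := coeffMap) N x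

theorem sumV_induction {p : SumV q → Prop} (zero : p 0)
    (tmul : ∀ (N : ℕ) (f : Mer) (k : Fin (N + 1)) (g : Fin (N + 1) → Mer),
      p (DirectSum.of (TensV q) N ((f • vec q N k) ⊗ₜ[ℂ] g)))
    (add : ∀ x y, p x → p y → p (x + y)) (x : SumV q) : p x := by
  induction x using DirectSum.induction_on with
  | zero => exact zero
  | add x y hx hy => exact add x y hx hy
  | of N x =>
    induction x using TensorProduct.induction_on with
    | zero => rw [map_zero]; exact zero
    | add x y hx hy => rw [map_add]; exact add _ _ hx hy
    | tmul v g =>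
      rw [← (vecBasis q N).sum_repr v, TensorProduct.sum_tmul, map_sum]
      refine Finset.sum_induction _ p add zero fun k _ => ?_
      rw [vecBasis_apply]
      exact tmul N _ k g

theorem peterWeyl_smul_vec (N : ℕ) (f : Mer) (k : Fin (N + 1)) (g : Fin (N + 1) → Mer) :
    peterWeyl q (DirectSum.of (TensV q) N ((f • vec q N k) ⊗ₜ[ℂ] g)) =
      ∑ j, moment q (f ⊗ₜ g j) * matElem q N k j := by
  rw [peterWeyl_of, ← TensorProduct.smul_tmul', map_smul, coeffMap_vec, Finset.smul_sum]
  simp only [moment_tmul, smul_def, mul_assoc]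

/-- The map `f ⊗ g ↦ f γ^{N-k} α^k ⊗ g e_j` to the summand of index `N`. -/
def invAux (i : Σ N : ℕ, Fin (N + 1) × Fin (N + 1)) : Mer ⊗[ℂ] Mer →+ SumV q :=
  AddMonoidHom.comp (DirectSum.of (TensV q) i.1)
    (TensorProduct.map ((LinearMap.toSpanSingleton Mer (VN q i.1) (vec q i.1 i.2.1)).restrictScalars ℂ)
      (LinearMap.single ℂ (fun _ => Mer) i.2.2)).toAddMonoidHom

theorem invAux_tmul (N : ℕ) (k j : Fin (N + 1)) (f g : Mer) : invAux ⟨N, k, j⟩ (f ⊗ₜ g) =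
    DirectSum.of (TensV q) N
      ((f • vec q N k) ⊗ₜ[ℂ] Pi.single j g) := rfl

variable (q)

/-- The inverse of `peterWeyl`, defined on the basis of matrix elements. -/
def peterWeylInv : F q →+ SumV q :=
  (Finsupp.liftAddHom fun i => (invAux i).comp
    ((AlgEquiv.ofInjective (moment q) moment_injective).symm : base q →+ Mer ⊗[ℂ] Mer)).comp
    ((matBasis q).repr : F q →+ _)

variable {q}

theorem peterWeylInv_moment_mul (N : ℕ) (k j : Fin (N + 1)) (m : Mer ⊗[ℂ] Mer) :
    peterWeylInv q (moment q m * matElem q N k j) = invAux ⟨N, k, j⟩ m := by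
  have h : moment q m * matElem q N k j =
      (AlgEquiv.ofInjective (moment q) moment_injective m) • matBasis q ⟨N, k, j⟩ := by
    rw [matBasis_apply]
    rfl
  have h2 : (matBasis q).repr (moment q m * matElem q N k j) =
      .single ⟨N, k, j⟩ (AlgEquiv.ofInjective (moment q) moment_injective m) := by
    rw [h, map_smul, Module.Basis.repr_self, Finsupp.smul_single, smul_eq_mul, mul_one]
  change Finsupp.liftAddHom _ ((matBasis q).repr (moment q m * matElem q N k j)) = _
  rw [h2, Finsupp.liftAddHom_apply_single]
  exact congrArg (invAux _) (AlgEquiv.symm_apply_apply _ m)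

theorem peterWeylInv_peterWeyl (x : SumV q) : peterWeylInv q (peterWeyl q x) = x := by
  induction x using sumV_induction with
  | zero => rw [map_zero, map_zero]
  | add x y hx hy => rw [map_add, map_add, hx, hy]
  | tmul N f k g =>
    rw [peterWeyl_smul_vec, map_sum]
    simp only [peterWeylInv_moment_mul, invAux_tmul]
    rw [← map_sum, ← TensorProduct.tmul_sum, Finset.univ_sum_single]

theorem peterWeyl_surjective : Function.Surjective (peterWeyl q) := by
  intro a
  change a ∈ (LinearMap.range (peterWeyl q))
  rw [← (matBasis q).linearCombination_repr a, Finsupp.linearCombination_apply]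
  refine sum_mem fun ⟨N, k, j⟩ _ => ?_
  obtain ⟨m, hm⟩ := ((matBasis q).repr a ⟨N, k, j⟩).2
  have h : (matBasis q).repr a ⟨N, k, j⟩ • matBasis q ⟨N, k, j⟩ = moment q m * matElem q N k j := by
    rw [matBasis_apply]
    exact congrArg (· * matElem q N k j) hm.symm
  change (matBasis q).repr a ⟨N, k, j⟩ • matBasis q ⟨N, k, j⟩ ∈ _
  rw [h]
  clear h hm
  induction m using TensorProduct.induction_on with
  | zero => rw [map_zero, zero_mul]; exact zero_mem _
  | add m m' h h' => rw [map_add, add_mul]; exact add_mem h h'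
  | tmul f g =>
    refine ⟨DirectSum.of (TensV q) N ((f • vec q N k) ⊗ₜ[ℂ] Pi.single j g), ?_⟩
    rw [peterWeyl_smul_vec, Finset.sum_eq_single j]
    · rw [Pi.single_eq_same]
    · intro i _ hi
      rw [Pi.single_eq_of_ne hi, TensorProduct.tmul_zero, map_zero, zero_mul]
    · simp

variable (q)

/-- The map `⨁_N V_N ⊗_ℂ M^{N+1} → F` as a linear bijection. -/
def peterWeylEquiv : SumV q ≃ₗ[Mer] F q :=
  LinearEquiv.ofBijective (peterWeyl q)
    ⟨Function.LeftInverse.injective peterWeylInv_peterWeyl, peterWeyl_surjective⟩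

variable {q}

/-- An injective map that preserves weights reflects them, if the weight spaces span the source and
are independent in the target. -/
theorem mem_of_apply_mem {V W : Type*} [AddCommGroup V] [Module Mer V] [AddCommGroup W]
    [Module Mer W] {φ : V →ₗ[Mer] W} (hφ : Function.Injective φ) {A : ℂ → Submodule Mer V}
    {B : ℂ → Submodule Mer W} (hAB : ∀ n, A n ≤ (B n).comap φ) (hA : ⨆ n, A n = ⊤)
    (hB : iSupIndep B) {n : ℂ} {v : V} (hv : φ v ∈ B n) : v ∈ A n := by
  have h1 : v ∈ A n ⊔ ⨆ (m) (_ : m ≠ n), A m := by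
    rw [← iSup_split_single, hA]
    exact Submodule.mem_top
  obtain ⟨a, ha, b, hb, rfl⟩ := Submodule.mem_sup.1 h1
  have h2 : φ b ∈ B n := by
    rw [map_add] at hv
    exact (Submodule.add_mem_iff_right (B n) (hAB n ha)).1 hv
  have h3 : (⨆ (m) (_ : m ≠ n), A m) ≤ (⨆ (m) (_ : m ≠ n), B m).comap φ :=
    iSup₂_le fun m hm => (hAB m).trans (Submodule.comap_mono (le_iSup₂_of_le m hm le_rfl))
  have h4 : b = 0 := hφ ((Submodule.disjoint_def.1 ((iSupIndep_def.1 hB) n) _ h2 (h3 hb)).trans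
    (map_zero φ).symm)
  rw [h4, add_zero]
  exact ha

theorem of_mem_sumV_gr {N : ℕ} {n : ℂ} {v : VN q N} (hv : v ∈ (corepV q N).gr n)
    (g : Fin (N + 1) → Mer) :
    DirectSum.of (TensV q) N (v ⊗ₜ[ℂ] g) ∈ (sumV q).gr n := by
  refine Submodule.mem_iInf _ |>.2 fun i => ?_
  rw [Submodule.mem_comap, ← DirectSum.apply_eq_component]
  by_cases h : i = N
  · subst h
    rw [DirectSum.of_eq_same]
    exact Submodule.subset_span ⟨v, hv, g, rfl⟩
  · rw [DirectSum.of_eq_of_ne _ _ _ h]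
    exact zero_mem _

theorem peterWeyl_mem {n : ℂ} {x : SumV q} (hx : x ∈ (sumV q).gr n) :
    peterWeyl q x ∈ regularGr q n := by
  have h (N : ℕ) (y) (hy : y ∈ ((corepV q N).tensor (Fin (N + 1) → Mer)).gr n) :
      coeffMap N y ∈ regularGr q n := by
    induction hy using Submodule.span_induction with
    | mem y hy =>
      obtain ⟨v, hv, g, rfl⟩ := hy
      exact FT.contract_mem_regularGr _ _ ((corepV_isCorep N).map_gr n v hv)
    | zero => rw [map_zero]; exact zero_mem _
    | add x y _ _ hx hy => rw [map_add]; exact add_mem hx hy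
    | smul f x _ hx => rw [map_smul]; exact Submodule.smul_mem _ _ hx
  classical
  rw [← DirectSum.sum_support_of x, map_sum]
  refine sum_mem fun N _ => ?_
  rw [peterWeyl_of]
  exact h N _ ((Submodule.mem_iInf _).1 hx N)

theorem iSup_sumV_gr : ⨆ n, (sumV q).gr n = ⊤ := by
  rw [eq_top_iff]
  intro x _
  induction x using sumV_induction with
  | zero => exact zero_mem _
  | add x y hx hy => exact add_mem (hx trivial) (hy trivial)
  | tmul N f k g =>
    exact Submodule.mem_iSup_of_mem _
      (of_mem_sumV_gr (Submodule.smul_mem _ f (vec_mem_gr N k)) g)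

theorem Coaction.tensor_toFun_tmul {V W : Type*} [AddCommGroup V] [Module Mer V] [Module ℂ V]
    [IsScalarTower ℂ Mer V] [AddCommGroup W] [Module ℂ W] (C : Coaction q V) (v : V) (w : W) :
    (C.tensor W).toFun (v ⊗ₜ[ℂ] w) =
      FT.map ((TensorProduct.AlgebraTensorModule.mk ℂ Mer V W).flip w) (C.toFun v) := rfl

theorem Coaction.directSum_toFun_of {ι : Type*} [DecidableEq ι] {X : ι → Type*}
    [∀ i, AddCommGroup (X i)] [∀ i, Module Mer (X i)] (C : ∀ i, Coaction q (X i)) (i : ι)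
    (x : X i) : (Coaction.directSum C).toFun (DirectSum.of X i x) =
      FT.map (DirectSum.lof Mer ι X i) ((C i).toFun x) :=
  DirectSum.toModule_lof Mer i x

/-- Coassociativity of `V_N` says that forming matrix coefficients with a fixed linear form is an
intertwiner. -/
theorem coproduct_peterWeyl (x : SumV q) :
    coproduct q (peterWeyl q x) = FT.map (peterWeyl q) ((sumV q).toFun x) := by
  induction x using sumV_induction with
  | zero => simp only [map_zero]
  | add x y hx hy => simp only [map_add, hx, hy]
  | tmul N f k g =>
    have h := Coaction.directSum_toFun_of
      (fun N => (corepV q N).tensor (Fin (N + 1) → Mer)) N ((f • vec q N k) ⊗ₜ[ℂ] g)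
    refine Eq.trans ?_ (congrArg (FT.map (peterWeyl q)) h).symm
    rw [Coaction.tensor_toFun_tmul, FT.map_map, FT.map_map, peterWeyl_of, coeffMap_tmul,
      coproduct_contract, (corepV_isCorep N).coassoc, FT.map_map]
    refine congrArg (fun φ => FT.map φ _) (LinearMap.ext fun v => ?_)
    exact (peterWeyl_of N (v ⊗ₜ[ℂ] g)).symm

variable (q)

/-- The isomorphism between `⨁_N V_N ⊗_ℂ M^{N+1}` and the regular corepresentation. -/
def peterWeylIso : (sumV q).Iso (regular q) where
  toEquiv := peterWeylEquiv q
  map_gr _ _ := ⟨mem_of_apply_mem (peterWeylEquiv q).injective (φ := peterWeyl q)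
    (fun _ _ => peterWeyl_mem) iSup_sumV_gr regularGr_iSupIndep, peterWeyl_mem⟩
  map_coaction := coproduct_peterWeyl

variable {q}

/-! ### Irreducibility -/

/-- If `U` is invariant, `0 ≠ u ∈ U` and `φ` is a linear form vanishing on `U`, the matrix
coefficient of `u` and `φ` is zero, and therefore `φ = 0`. -/
theorem corepV_isIrreducible (N : ℕ) : (corepV q N).IsIrreducible := by
  refine ⟨⟨vec q N 0, 0, ?_⟩, fun U _ hU => ?_⟩
  · rw [← vecBasis_apply]
    exact (vecBasis q N).ne_zero 0
  by_contra! hne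
  obtain ⟨u, hu, hu0⟩ := (Submodule.ne_bot_iff U).1 hne.1
  obtain ⟨φ, hφ, hUφ⟩ := Submodule.exists_le_ker_of_lt_top U hne.2.lt_top
  obtain ⟨g, rfl⟩ := ((vecBasis q N).constr ℂ).surjective φ
  obtain ⟨s, hs⟩ := hU u hu
  have h1 : coeffMap N (u ⊗ₜ[ℂ] g) = 0 := by
    rw [coeffMap_tmul, ← hs, FT.contract_map,
      show (vecBasis q N).constr ℂ g ∘ₗ U.subtype = 0 from LinearMap.ext fun x => hUφ x.2,
      FT.contract_zero]
  rw [← peterWeyl_of] at h1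
  have h2 := (peterWeylEquiv q).map_eq_zero_iff.1 h1
  have h3 : u ⊗ₜ[ℂ] g = 0 := DirectSum.of_injective N (h2.trans (map_zero _).symm)
  have hg : g ≠ 0 := fun h => hφ (by rw [h, map_zero])
  -- a pure tensor of nonzero vectors is detected by linear forms on the factors
  obtain ⟨ξ, hξ⟩ := not_forall.1 (mt (Module.forall_dual_apply_eq_zero_iff ℂ u).1 hu0)
  obtain ⟨η, hη⟩ := not_forall.1 (mt (Module.forall_dual_apply_eq_zero_iff ℂ g).1 hg)
  have h4 := TensorProduct.dualDistrib_apply ξ η u g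
  rw [h3, map_zero] at h4
  exact mul_ne_zero hξ hη h4.symm

end

end DynSL2

open scoped TensorProduct
open DynSL2

theorem mainTheorem2 (q : Set.Ioo (0 : ℝ) 1) :
    (regular q).IsCorep ∧ (∀ N, (corepV q N).IsCorep) ∧
    ∃ t : (N : ℕ) → Fin (N + 1) → Fin (N + 1) → F q,
      (∀ t', IsMatrixElements q t' ↔ t' = t) ∧
      Function.Injective (moment q) ∧
      (∃ b : Module.Basis (Σ N : ℕ, Fin (N + 1) × Fin (N + 1)) (base q) (F q),
        ∀ (N : ℕ) (k j : Fin (N + 1)), b ⟨N, k, j⟩ = t N k j) ∧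
      (∃ e : (sumV q).Iso (regular q), ∀ (N : ℕ) (k : Fin (N + 1)) (g : Fin (N + 1) → Mer),
        e.toEquiv (DirectSum.of _ N (vec q N k ⊗ₜ[ℂ] g)) = ∑ j, μr q (g j) * t N k j) ∧
      (∀ N : ℕ, ¬ Module.Finite ℂ (Fin (N + 1) → Mer)) ∧
      ∀ N : ℕ, (corepV q N).IsIrreducible :=
  ⟨regular_isCorep, corepV_isCorep, matElem q, isMatrixElements_iff, moment_injective,
    ⟨matBasis q, matBasis_apply q⟩,
    ⟨peterWeylIso q, fun N k g => (peterWeyl_of N _).trans (coeffMap_vec N k g)⟩,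
    not_finite_fun, corepV_isIrreducible⟩
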